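/- Let $m\in\mathbb{Q}^\times$, and for $n\in\mathbb{Q}^\times$ let $X_n\subset\mathbb{P}(1,1,1,2)$ be the surface $x^4+y^4-nz^4=w^2$ over $\mathbb{Q}$. A conic bundle is a dominant morphism from a smooth projective surface to $\mathbb{P}^1$ all of whose fibres are isomorphic to plane conics. In each of the four cases below, $X_n$ is a smooth projective surface, the rational map given by the pair $(A,B)$ extends to a conic bundle $\pi:X_n\to\mathbb{P}^1$, and $\pi$ together with the anticanonical map $\varphi:X_n\to\mathbb{P}^2$, $(x,y,z,w)\mapsto(x,y,z)$, is a closed embedding $(\pi,\varphi):X_n\to\mathbb{P}^1\times\mathbb{P}^2$ (over $\mathbb{Q}$) with image the surface $F(s,t;x_0,x_1,x_2)=0$ of bidegree $(2,2)$. Moreover $\Delta(s,t)$ is the determinant of the symmetric matrix of $F$, viewed as a quadratic form in $x_0,x_1,x_2$, and the fibre of $\pi$ over a point $p \in \mathbb{P}^1$ is singular (not smooth over the residue field of $p$) if and only if $\Delta$ vanishes at $p$. 1. $n=-4m^4$: $(A,B)=(x^2+2mxz+2m^2z^2,\ w-y^2)$; $F=(s^2-t^2)x_0^2-2stx_1^2-2m(s^2+t^2)x_0x_2+2m^2(s^2-t^2)x_2^2$;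 $\Delta=-2m^2st(s^2-2st-t^2)(s^2+2st-t^2)$. 2. $n=m^2$: $(A,B)=(x^2-mz^2,\ w-y^2)$; $F=(s^2-t^2)x_0^2-2stx_1^2+m(s^2+t^2)x_2^2$; $\Delta=-2mst(s-t)(s+t)(s^2+t^2)$. 3. $n=2m^2$: $(A,B)=(xy-mz^2,\ x^2-y^2-w)$; $F=2stx_0^2+(2s^2-t^2)x_0x_1-2stx_1^2+m(2s^2+t^2)x_2^2$; $\Delta=-\tfrac m4(2s^2+t^2)(4s^4+12s^2t^2+t^4)$. 4. $n=-2m^2$: $(A,B)=(xy-mz^2,\ x^2+y^2-w)$; $F=2stx_0^2-(2s^2+t^2)x_0x_1+2stx_1^2-m(2s^2-t^2)x_2^2$; $\Delta=\tfrac m4(2s^2-t^2)(2s^2-4st+t^2)(2s^2+4st+t^2)$. -/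

import Mathlib

open AlgebraicGeometry CategoryTheory CategoryTheory.Limits

noncomputable section

namespace FermatDelPezzo

universe u

/-! ### The grading on a quotient by a homogeneous ideal -/

section Quotient

variable {R A : Type u} [CommRing R] [CommRing A] [Algebra R A]

/-- The degree `d` part of `A ⧸ I`: the image of the degree `d` part of `A`. -/
def quotientGrading (𝒜 : ℕ → Submodule R A) (I : Ideal A) (d : ℕ) : Submodule R (A ⧸ I) :=
  (𝒜 d).map (Ideal.Quotient.mkₐ R I).toLinearMap

/-- The projection from the degree `d` part of `A` to the degree `d` part of `A ⧸ I`. -/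
def quotientGradingMk (𝒜 : ℕ → Submodule R A) (I : Ideal A) (d : ℕ) :
    𝒜 d →+ quotientGrading 𝒜 I d where
  toFun a := ⟨Ideal.Quotient.mkₐ R I a, ⟨a, a.2, rfl⟩⟩
  map_zero' := by ext; simp
  map_add' a b := by ext; simp

/-- The decomposition of an element of `A ⧸ I` into its homogeneous parts. -/
def quotientDecompose (𝒜 : ℕ → Submodule R A) [GradedAlgebra 𝒜] (I : Ideal A)
    (hI : I.IsHomogeneous 𝒜) : A ⧸ I →+ DirectSum ℕ fun i => quotientGrading 𝒜 I i :=
  QuotientAddGroup.lift I.toAddSubgroup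
    ((DirectSum.map (quotientGradingMk 𝒜 I)).comp
      (DirectSum.decomposeAddEquiv 𝒜).toAddMonoidHom) (by
      intro a ha
      refine DFinsupp.ext fun i => Subtype.ext ?_
      exact Ideal.Quotient.eq_zero_iff_mem.mpr (hI i (show a ∈ I from ha)))

theorem quotientDecompose_mk (𝒜 : ℕ → Submodule R A) [GradedAlgebra 𝒜] (I : Ideal A)
    (hI : I.IsHomogeneous 𝒜) (a : A) :
    quotientDecompose 𝒜 I hI (Ideal.Quotient.mk I a) =
      DirectSum.map (quotientGradingMk 𝒜 I) (DirectSum.decompose 𝒜 a) := rfl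

theorem coe_map_quotientGradingMk (𝒜 : ℕ → Submodule R A) (I : Ideal A)
    (v : DirectSum ℕ fun i => 𝒜 i) :
    DirectSum.coeAddMonoidHom (quotientGrading 𝒜 I) (DirectSum.map (quotientGradingMk 𝒜 I) v) =
      Ideal.Quotient.mk I (DirectSum.coeAddMonoidHom 𝒜 v) := by
  induction v using DirectSum.induction_on with
  | zero => simp
  | of i x => simp [DirectSum.map_of, quotientGradingMk]
  | add x y hx hy => simp only [map_add, hx, hy]

/-- The quotient of a graded algebra by a homogeneous ideal is a graded algebra. -/
abbrev quotientGradedAlgebra (𝒜 : ℕ → Submodule R A) [GradedAlgebra 𝒜] (I : Ideal A)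
    (hI : I.IsHomogeneous 𝒜) : GradedAlgebra (quotientGrading 𝒜 I) where
  one_mem := ⟨1, SetLike.one_mem_graded 𝒜, map_one (Ideal.Quotient.mkₐ R I)⟩
  mul_mem := by
    rintro i j _ _ ⟨a, ha, rfl⟩ ⟨b, hb, rfl⟩
    exact ⟨a * b, SetLike.mul_mem_graded ha hb, map_mul (Ideal.Quotient.mkₐ R I) _ _⟩
  toDecomposition := DirectSum.Decomposition.ofAddHom (ℳ := quotientGrading 𝒜 I)
    (quotientDecompose 𝒜 I hI)
    (by
      refine AddMonoidHom.ext fun q => ?_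
      obtain ⟨a, rfl⟩ := Ideal.Quotient.mk_surjective q
      rw [AddMonoidHom.comp_apply, quotientDecompose_mk, coe_map_quotientGradingMk]
      exact congrArg _ ((DirectSum.decompose 𝒜).symm_apply_apply a))
    (by
      refine DirectSum.addHom_ext fun i y => ?_
      obtain ⟨_, a, ha, rfl⟩ := y
      rw [AddMonoidHom.comp_apply, DirectSum.coeAddMonoidHom_of]
      refine (quotientDecompose_mk 𝒜 I hI a).trans ?_
      rw [DirectSum.decompose_of_mem 𝒜 ha, DirectSum.map_of]
      rfl)

end Quotient

attribute [instance] MvPolynomial.gradedAlgebra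

/-! ### `Proj` over a base ring and projective spaces -/

section Proj

variable {K A : Type u} [CommRing K] [CommRing A] [Algebra K A]

/-- The structure morphism of `Proj` of a graded `K`-algebra. -/
def projToSpec (𝒜 : ℕ → Submodule K A) [GradedAlgebra 𝒜] : Proj 𝒜 ⟶ Spec (.of K) :=
  Proj.toSpecZero 𝒜 ≫ Spec.map (CommRingCat.ofHom (algebraMap K (𝒜 0)))

/-- The regular function `h / g` on the basic open `D₊(g)`, for `g`, `h` of the same degree. -/
def ratio (𝒜 : ℕ → Submodule K A) [GradedAlgebra 𝒜] {d : ℕ} {g h : A} (hg : g ∈ 𝒜 d)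
    (hh : h ∈ 𝒜 d) : Γ(Proj 𝒜, Proj.basicOpen 𝒜 g) :=
  Proj.awayToSection 𝒜 g (HomogeneousLocalization.Away.mk 𝒜 hg 1 h (by simpa using hh))

variable (K) in
/-- Projective `r`-space over `K`. -/
abbrev ProjSpace (r : ℕ) : Scheme.{u} := Proj (MvPolynomial.homogeneousSubmodule (Fin (r + 1)) K)

variable (K) in
/-- The structure morphism of projective space. -/
abbrev projSpaceToSpec (r : ℕ) : ProjSpace K r ⟶ Spec (.of K) :=
  projToSpec (MvPolynomial.homogeneousSubmodule (Fin (r + 1)) K)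

variable (K) in
/-- The open `D₊(q)` of projective space where the homogeneous polynomial `q` does not vanish. -/
abbrev nonvanishing {r : ℕ} (q : MvPolynomial (Fin (r + 1)) K) : (ProjSpace K r).Opens :=
  Proj.basicOpen (MvPolynomial.homogeneousSubmodule (Fin (r + 1)) K) q

variable (K) in
/-- The standard chart `D₊(x_j)` of projective space. -/
abbrev chart {r : ℕ} (j : Fin (r + 1)) : (ProjSpace K r).Opens :=
  nonvanishing K (MvPolynomial.X j)

variable (K) in
/-- The affine coordinate `x_k / x_j` on the chart `D₊(x_j)`. -/
def coord {r : ℕ} (j k : Fin (r + 1)) : Γ(ProjSpace K r, chart K j) :=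
  ratio (MvPolynomial.homogeneousSubmodule (Fin (r + 1)) K)
    (MvPolynomial.isHomogeneous_X K j) (MvPolynomial.isHomogeneous_X K k)

/-- The constants: for a `K`-scheme `Y`, the ring homomorphism from `K` to the functions on an
open of `Y`. -/
def scalars {Y : Scheme.{u}} (f : Y ⟶ Spec (.of K)) (U : Y.Opens) : K →+* Γ(Y, U) :=
  (f.appLE ⊤ U le_top).hom.comp (Scheme.ΓSpecIso (.of K)).inv.hom

/-- The morphism `f : Proj 𝒜 ⟶ ℙ^r` is the rational map `(g₀ : … : g_r)`: the `g_i` are homogeneous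
of one common degree, they define a map on the dense open `⋃ D₊(g_i)`, and there `f` agrees with
it, that is, `D₊(g_i)` is mapped to the chart `D₊(x_i)`, with `x_j / x_i` pulled back to
`g_j / g_i`. -/
def IsGivenBy (𝒜 : ℕ → Submodule K A) [GradedAlgebra 𝒜] {r : ℕ} (f : Proj 𝒜 ⟶ ProjSpace K r)
    (g : Fin (r + 1) → A) : Prop :=
  ∃ (d : ℕ) (hg : ∀ i, g i ∈ 𝒜 d),
    Dense ((⨆ i, Proj.basicOpen 𝒜 (g i) : (Proj 𝒜).Opens) : Set (Proj 𝒜)) ∧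
    ∀ i, ∃ h : Proj.basicOpen 𝒜 (g i) ≤ f ⁻¹ᵁ chart K i,
      ∀ j, (f.appLE (chart K i) (Proj.basicOpen 𝒜 (g i)) h).hom (coord K i j) =
        ratio 𝒜 (hg i) (hg j)

/-- The dehomogenisation `q(x_0 / x_j, …, x_r / x_j)` of `q`, a function on `D₊(x_j)`. -/
def dehomogenize {r : ℕ} (q : MvPolynomial (Fin (r + 1)) K) (j : Fin (r + 1)) :
    Γ(ProjSpace K r, chart K j) :=
  q.eval₂ (scalars (projSpaceToSpec K r) (chart K j)) (coord K j)

/-- The morphism `i` is the inclusion of the closed subscheme `q = 0` of `ℙ^r`: it is a closed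
immersion whose ideal on each standard chart is generated by the dehomogenisation of `q`. -/
def IsHypersurface {Y : Scheme.{u}} {r : ℕ} (i : Y ⟶ ProjSpace K r)
    (q : MvPolynomial (Fin (r + 1)) K) : Prop :=
  IsClosedImmersion i ∧
    ∀ j, RingHom.ker (i.app (chart K j)).hom = Ideal.span {dehomogenize q j}

end Proj

/-! ### Conic bundles -/

section ConicBundle

variable {K : Type u} [Field K]

/-- A plane conic over `K`: a `K`-scheme isomorphic to the zero locus in `ℙ²` of a nonzero
quadratic form. -/
def IsPlaneConic {C : Scheme.{u}} (c : C ⟶ Spec (.of K)) : Prop :=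
  ∃ q : MvPolynomial (Fin 3) K, q.IsHomogeneous 2 ∧ q ≠ 0 ∧
    ∃ i : C ⟶ ProjSpace K 2, i ≫ projSpaceToSpec K 2 = c ∧ IsHypersurface i q

/-- A smooth projective (integral) surface over `K`. -/
structure IsSmoothProjectiveSurface {X : Scheme.{u}} (x : X ⟶ Spec (.of K)) : Prop where
  integral : IsIntegral X
  smooth : SmoothOfRelativeDimension 2 x
  projective : ∃ (N : ℕ) (i : X ⟶ ProjSpace K N),
    i ≫ projSpaceToSpec K N = x ∧ IsClosedImmersion i

/-- A conic bundle: a dominant `K`-morphism from a smooth projective surface to `ℙ¹` all of whose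
fibres are isomorphic to plane conics (over the residue field of the point below). -/
structure IsConicBundle {X : Scheme.{u}} (x : X ⟶ Spec (.of K)) (π : X ⟶ ProjSpace K 1) :
    Prop where
  surface : IsSmoothProjectiveSurface x
  comp_eq : π ≫ projSpaceToSpec K 1 = x
  dominant : IsDominant π
  fibre : ∀ p : ProjSpace K 1,
    IsPlaneConic (K := (ProjSpace K 1).residueField p) (π.fiberToSpecResidueField p)

/-! ### Bihomogeneous equations in `ℙ¹ × ℙ²` -/

variable (K) in
/-- The product `ℙ¹ × ℙ²` over `K`. -/
abbrev P1P2 : Scheme.{u} := pullback (projSpaceToSpec K 1) (projSpaceToSpec K 2)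

variable (K) in
/-- The first projection of `ℙ¹ × ℙ²`. -/
abbrev pr₁ : P1P2 K ⟶ ProjSpace K 1 := pullback.fst _ _

variable (K) in
/-- The second projection of `ℙ¹ × ℙ²`. -/
abbrev pr₂ : P1P2 K ⟶ ProjSpace K 2 := pullback.snd _ _

variable (K) in
/-- The standard affine chart `D₊(t_i) × D₊(x_j)` of `ℙ¹ × ℙ²`. -/
def biChart (i : Fin 2) (j : Fin 3) : (P1P2 K).Opens :=
  pr₁ K ⁻¹ᵁ chart K i ⊓ pr₂ K ⁻¹ᵁ chart K j

/-- A polynomial in `x₀, x₁, x₂` whose coefficients are polynomials in `s, t` has bidegree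
`(2, 2)`. -/
def IsBidegreeTwoTwo (F : MvPolynomial (Fin 3) (MvPolynomial (Fin 2) K)) : Prop :=
  F.IsHomogeneous 2 ∧ ∀ e, (F.coeff e).IsHomogeneous 2

/-- The dehomogenisation of `F` on the chart `D₊(t_i) × D₊(x_j)`: the variables `t_k` and `x_k`
are replaced with `t_k / t_i` and `x_k / x_j`. -/
def biDehomogenize (F : MvPolynomial (Fin 3) (MvPolynomial (Fin 2) K)) (i : Fin 2) (j : Fin 3) :
    Γ(P1P2 K, biChart K i j) :=
  F.eval₂
    (MvPolynomial.eval₂Hom (scalars (pr₁ K ≫ projSpaceToSpec K 1) (biChart K i j))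
      fun k => ((pr₁ K).appLE (chart K i) (biChart K i j) inf_le_left).hom (coord K i k))
    fun k => ((pr₂ K).appLE (chart K j) (biChart K i j) inf_le_right).hom (coord K j k)

/-- The morphism `f` is an embedding into `ℙ¹ × ℙ²` with image the closed subscheme `F = 0`: it is
a closed immersion whose ideal on each standard chart is generated by the dehomogenisation
of `F`. -/
def IsEmbeddingOnto {X : Scheme.{u}} (f : X ⟶ P1P2 K)
    (F : MvPolynomial (Fin 3) (MvPolynomial (Fin 2) K)) : Prop :=
  IsClosedImmersion f ∧
    ∀ i j, RingHom.ker (f.app (biChart K i j)).hom = Ideal.span {biDehomogenize F i j}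

/-- The symmetric matrix of `F`, seen as a quadratic form in `x₀, x₁, x₂`. -/
def gramMatrix (F : MvPolynomial (Fin 3) (MvPolynomial (Fin 2) K)) :
    Matrix (Fin 3) (Fin 3) (MvPolynomial (Fin 2) K) :=
  Matrix.of fun i j =>
    if i = j then F.coeff (Finsupp.single i 2)
    else MvPolynomial.C (1 / 2) * F.coeff (Finsupp.single i 1 + Finsupp.single j 1)

end ConicBundle

/-! ### The surfaces `x⁴ + y⁴ - n z⁴ = w²` in `ℙ(1,1,1,2)` -/

/-- The coordinates on `ℙ(1,1,1,2)`. -/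
abbrev x : MvPolynomial (Fin 4) ℚ := MvPolynomial.X 0
abbrev y : MvPolynomial (Fin 4) ℚ := MvPolynomial.X 1
abbrev z : MvPolynomial (Fin 4) ℚ := MvPolynomial.X 2
abbrev w : MvPolynomial (Fin 4) ℚ := MvPolynomial.X 3

/-- The weights of the coordinates `x, y, z, w`. -/
abbrev weights : Fin 4 → ℕ := ![1, 1, 1, 2]

/-- The grading of `ℚ[x, y, z, w]` with weights `1, 1, 1, 2`. -/
abbrev weightedGrading : ℕ → Submodule ℚ (MvPolynomial (Fin 4) ℚ) :=
  MvPolynomial.weightedHomogeneousSubmodule ℚ weights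

instance : GradedAlgebra weightedGrading := MvPolynomial.weightedGradedAlgebra ℚ weights

/-- The ideal of the surface `X_n`. -/
abbrev surfaceIdeal (n : ℚ) : Ideal (MvPolynomial (Fin 4) ℚ) :=
  Ideal.span {x ^ 4 + y ^ 4 - MvPolynomial.C n * z ^ 4 - w ^ 2}

theorem surfaceIdeal_isHomogeneous (n : ℚ) : (surfaceIdeal n).IsHomogeneous weightedGrading := by
  refine Ideal.homogeneous_span _ _ ?_
  rintro _ rfl
  refine ⟨4, ?_⟩
  have hX : ∀ i, (MvPolynomial.X i : MvPolynomial (Fin 4) ℚ) ∈ weightedGrading (weights i) :=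
    fun i => MvPolynomial.isWeightedHomogeneous_X ℚ weights i
  have hx : x ^ 4 ∈ weightedGrading 4 := SetLike.pow_mem_graded 4 (hX 0)
  have hy : y ^ 4 ∈ weightedGrading 4 := SetLike.pow_mem_graded 4 (hX 1)
  have hz : z ^ 4 ∈ weightedGrading 4 := SetLike.pow_mem_graded 4 (hX 2)
  have hw : w ^ 2 ∈ weightedGrading 4 := SetLike.pow_mem_graded 2 (hX 3)
  rw [MvPolynomial.C_mul']
  exact sub_mem (sub_mem (add_mem hx hy) (Submodule.smul_mem _ n hz)) hw

/-- The homogeneous coordinate ring `ℚ[x, y, z, w] / (x⁴ + y⁴ - n z⁴ - w²)` of `X_n`. -/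
abbrev CoordRing (n : ℚ) : Type := MvPolynomial (Fin 4) ℚ ⧸ surfaceIdeal n

/-- The grading of the homogeneous coordinate ring. -/
def surfaceGrading (n : ℚ) : ℕ → Submodule ℚ (CoordRing n) :=
  quotientGrading weightedGrading (surfaceIdeal n)

instance (n : ℚ) : GradedAlgebra (surfaceGrading n) :=
  quotientGradedAlgebra weightedGrading (surfaceIdeal n) (surfaceIdeal_isHomogeneous n)

/-- The surface `X_n : x⁴ + y⁴ - n z⁴ = w²` in `ℙ(1,1,1,2)` over `ℚ`. -/
abbrev Surface (n : ℚ) : Scheme.{0} := Proj (surfaceGrading n)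

/-- The structure morphism of `X_n`. -/
def surfaceToSpec (n : ℚ) : Surface n ⟶ Spec (.of ℚ) := projToSpec (surfaceGrading n)

/-- The morphism `f : X_n ⟶ ℙ^r` is given by the polynomials `g₀, …, g_r` in `x, y, z, w`. -/
def IsGivenByPolynomials {n : ℚ} {r : ℕ} (f : Surface n ⟶ ProjSpace ℚ r)
    (g : Fin (r + 1) → MvPolynomial (Fin 4) ℚ) : Prop :=
  IsGivenBy (surfaceGrading n) f fun i => Ideal.Quotient.mk (surfaceIdeal n) (g i)

/-- The coordinates on `ℙ¹`. -/
abbrev s : MvPolynomial (Fin 2) ℚ := MvPolynomial.X 0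
abbrev t : MvPolynomial (Fin 2) ℚ := MvPolynomial.X 1

/-- The coordinates on `ℙ²`. -/
abbrev x₀ : MvPolynomial (Fin 3) (MvPolynomial (Fin 2) ℚ) := MvPolynomial.X 0
abbrev x₁ : MvPolynomial (Fin 3) (MvPolynomial (Fin 2) ℚ) := MvPolynomial.X 1
abbrev x₂ : MvPolynomial (Fin 3) (MvPolynomial (Fin 2) ℚ) := MvPolynomial.X 2

/-- A rational constant, as a polynomial in `s, t`. -/
abbrev const (a : ℚ) : MvPolynomial (Fin 2) ℚ := MvPolynomial.C a

/-- A polynomial in `s, t`, as a coefficient of a polynomial in `x₀, x₁, x₂`. -/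
abbrev coef (a : MvPolynomial (Fin 2) ℚ) : MvPolynomial (Fin 3) (MvPolynomial (Fin 2) ℚ) :=
  MvPolynomial.C a

/-- The pair `(A, B)` defines a conic bundle `π : X_n → ℙ¹` which, together with the anticanonical
map `φ : (x, y, z, w) ↦ (x, y, z)`, embeds `X_n` into `ℙ¹ × ℙ²` as the surface `F = 0` of bidegree
`(2, 2)`; the determinant of the quadratic form `F` in `x₀, x₁, x₂` is `Δ`, and the fibre of `π`
over a point of `ℙ¹` is singular exactly when `Δ` vanishes there. -/
def HasConicBundle (n : ℚ) (A B : MvPolynomial (Fin 4) ℚ)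
    (F : MvPolynomial (Fin 3) (MvPolynomial (Fin 2) ℚ)) (Δ : MvPolynomial (Fin 2) ℚ) : Prop :=
  IsBidegreeTwoTwo F ∧ (gramMatrix F).det = Δ ∧
  ∃ (π : Surface n ⟶ ProjSpace ℚ 1) (φ : Surface n ⟶ ProjSpace ℚ 2) (f : Surface n ⟶ P1P2 ℚ),
    IsConicBundle (surfaceToSpec n) π ∧ IsGivenByPolynomials π ![A, B] ∧
    φ ≫ projSpaceToSpec ℚ 2 = surfaceToSpec n ∧ IsGivenByPolynomials φ ![x, y, z] ∧
    f ≫ pr₁ ℚ = π ∧ f ≫ pr₂ ℚ = φ ∧ IsEmbeddingOnto f F ∧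
    ∀ p : ProjSpace ℚ 1, ¬ Smooth (π.fiberToSpecResidueField p) ↔ p ∉ nonvanishing ℚ Δ

end FermatDelPezzo

end

open FermatDelPezzo

/-!
In each of the four cases the quartic splits as `x⁴ + y⁴ - nz⁴ = b² - ac` with quadratic forms
`a`, `b`, `c` in `x, y, z` without common zero. With `r = ±w` the equation of `X_n` becomes
`(r - b)(r + b) = -ac`, so that the pairs `(-c : b + r)` and `(r - b : a)` are proportional on
`X_n`. They have no common zero, hence define a morphism `π` to `ℙ¹`, and `(s : t) = π(x, y, z, w)`
satisfies `as² + 2bst + ct² = 0`; this is the form `F`. Conversely, `r` is recovered from a point of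
`F = 0` through `rs = -(bs + ct)` and `rt = as + bt`. This substitution for `w` shows that, on the
chart `t_i = x_j = 1`, the functions on the preimage of the chart in `X_n` are the quotient of the
functions on the chart by the ideal of `F`: the comparison is made after inverting the entries
`t_i` of the two pairs, where both sides are localisations of the ring of the affine surface
`X_n ∩ {x_j = 1}` (`surjective_and_ker_eq`,
`Factorisation.isAffineOpen_and_surjective_and_ker`). So `(π, φ)` is a closed embedding with image
`F = 0` (`Factorisation.isEmbeddingOnto`).

The remaining assertions are read off from this.

* The fibre of `π` over a point `p` is a base change of the embedding, hence the plane curve with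
  equation `F` evaluated at `p` (`exists_isHypersurface_fibre`). It is a conic because the
  coefficients of `F` do not vanish simultaneously at a point of `ℙ¹`. Conics are nonempty, so `π`
  is surjective.
* A conic with symmetric matrix `M ≠ 0` is smooth if and only if `det M ≠ 0`. If the determinant is
  nonzero, the Jacobian criterion applies (`smooth_of_det_ne_zero`). Otherwise the kernel of `M`
  contains a vector `v`, and a tangent vector at `v` on which the form does not vanish cannot be
  lifted to second order, which contradicts formal smoothness (`not_formallySmooth_quad`).
* `X_n` is integral because `x⁴ + y⁴ - nz⁴` is not a square, smooth by the Jacobian criterion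
  (`smooth_surface`), and embedded in `ℙ⁶` by the seven monomials of weight `2`
  (`projective_surface`).

What is left for each case is to exhibit the symmetric matrices of `a`, `b`, `c` and to check
identities between polynomials.
-/


noncomputable section

namespace FermatDelPezzo

universe u

/-! ### Functions on `Proj` as homogeneous fractions -/

section Charts

variable {K A : Type u} [CommRing K] [CommRing A] [Algebra K A]
  (𝒜 : ℕ → Submodule K A) [GradedAlgebra 𝒜]

/-- The homogeneous prime ideal of `A` underlying a point of `Proj 𝒜`. -/
def idealAt (p : Proj 𝒜) : Ideal A :=
  (ProjectiveSpectrum.asHomogeneousIdeal p).toIdeal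

instance (p : Proj 𝒜) : (idealAt 𝒜 p).IsPrime :=
  ProjectiveSpectrum.isPrime p

theorem mem_projBasicOpen (p : Proj 𝒜) (g : A) : p ∈ Proj.basicOpen 𝒜 g ↔ g ∉ idealAt 𝒜 p :=
  Iff.rfl

/-- The value at `p` of a function on an open of `Proj 𝒜`, as a fraction of elements of `A`. -/
def evalAt {U : (Proj 𝒜).Opens} (p : Proj 𝒜) (hp : p ∈ U) :
    Γ(Proj 𝒜, U) →+* Localization.AtPrime (idealAt 𝒜 p) :=
  (algebraMap (HomogeneousLocalization.AtPrime 𝒜 (idealAt 𝒜 p)) _).comp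
    (RingHom.comp (Proj.stalkIso 𝒜 p).hom.hom ((Proj 𝒜).presheaf.germ U p hp).hom)

/-- The function `h / gⁿ` on `D₊(g)`. -/
def frac {d : ℕ} {g h : A} (hg : g ∈ 𝒜 d) (n : ℕ) (hh : h ∈ 𝒜 (n • d)) :
    Γ(Proj 𝒜, Proj.basicOpen 𝒜 g) :=
  Proj.awayToSection 𝒜 g (HomogeneousLocalization.Away.mk 𝒜 hg n h hh)

/-- Functions on an open of `Proj` are determined by their values as fractions, so that identities
between functions can be checked in the localisations of `A`. -/
theorem evalAt_ext {U : (Proj 𝒜).Opens} {a b : Γ(Proj 𝒜, U)}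
    (h : ∀ p (hp : p ∈ U), evalAt 𝒜 p hp a = evalAt 𝒜 p hp b) : a = b := by
  refine TopCat.Presheaf.section_ext (Proj 𝒜).sheaf U a b fun p hp => ?_
  exact (Proj.stalkIso 𝒜 p).commRingCatIsoToRingEquiv.injective
    (HomogeneousLocalization.val_injective _ (h p hp))

theorem evalAt_map {U V : (Proj 𝒜).Opens} (i : V ≤ U) (p : Proj 𝒜) (hp : p ∈ V)
    (a : Γ(Proj 𝒜, U)) :
    evalAt 𝒜 p hp ((Proj 𝒜).presheaf.map (homOfLE i).op a) = evalAt 𝒜 p (i hp) a := by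
  have := TopCat.Presheaf.germ_res_apply (Proj 𝒜).presheaf (homOfLE i) p hp a
  simp only [evalAt, RingHom.comp_apply]
  exact congrArg (fun z => algebraMap (HomogeneousLocalization.AtPrime 𝒜 (idealAt 𝒜 p)) _
    ((Proj.stalkIso 𝒜 p).hom.hom z)) this

theorem evalAt_frac {d : ℕ} {g h : A} (hg : g ∈ 𝒜 d) (n : ℕ) (hh : h ∈ 𝒜 (n • d)) (p : Proj 𝒜)
    (hp : p ∈ Proj.basicOpen 𝒜 g) :
    evalAt 𝒜 p hp (frac 𝒜 hg n hh) =
      Localization.mk h ⟨g ^ n, pow_mem (S := (idealAt 𝒜 p).primeCompl) hp n⟩ := by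
  have := ConcreteCategory.congr_hom (ProjectiveSpectrum.Proj.awayToSection_germ 𝒜 g p hp)
    (HomogeneousLocalization.Away.mk 𝒜 hg n h hh)
  have h2 : (Proj.stalkIso 𝒜 p).hom.hom ((Proj 𝒜).presheaf.germ _ p hp (frac 𝒜 hg n hh)) =
      HomogeneousLocalization.mapId 𝒜 (Submonoid.powers_le.mpr hp)
        (HomogeneousLocalization.Away.mk 𝒜 hg n h hh) := by
    refine (congrArg (Proj.stalkIso 𝒜 p).hom this).trans ?_
    exact ConcreteCategory.congr_hom (Proj.stalkIso 𝒜 p).inv_hom_id _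
  exact congrArg (algebraMap (HomogeneousLocalization.AtPrime 𝒜 (idealAt 𝒜 p)) _) h2

theorem mem_basicOpen_iff_isUnit_evalAt {U : (Proj 𝒜).Opens} (p : Proj 𝒜) (hp : p ∈ U)
    (a : Γ(Proj 𝒜, U)) : p ∈ (Proj 𝒜).basicOpen a ↔ IsUnit (evalAt 𝒜 p hp a) := by
  rw [Scheme.mem_basicOpen _ _ _ hp]
  refine (MulEquiv.isUnit_map (Proj.stalkIso 𝒜 p).commRingCatIsoToRingEquiv).symm.trans ?_
  exact (HomogeneousLocalization.isUnit_iff_isUnit_val (𝒜 := 𝒜) (𝔭 := idealAt 𝒜 p)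
    ((Proj.stalkIso 𝒜 p).hom.hom ((Proj 𝒜).presheaf.germ U p hp a))).symm

/-- Dehomogenisation at `f` of degree `1`, with values in the degree `0` part of the localisation:
it maps `a` of degree `d` to `a / f ^ d`. Its kernel is generated by `f - 1`. -/
def awayDehom {f : A} (hf : f ∈ 𝒜 1) : A →+* HomogeneousLocalization.Away 𝒜 f :=
  (DirectSum.toSemiring
    (fun d => (⟨⟨fun a => HomogeneousLocalization.Away.mk 𝒜 hf d a (by simp), by
        apply HomogeneousLocalization.val_injective; simp [Localization.mk_zero]⟩, fun a b => by
        apply HomogeneousLocalization.val_injective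
        simp [HomogeneousLocalization.Away.val_mk, Localization.add_mk_self]⟩ :
      𝒜 d →+ HomogeneousLocalization.Away 𝒜 f))
    (by
      apply HomogeneousLocalization.val_injective
      simp [HomogeneousLocalization.Away.val_mk])
    (fun a b => by
      apply HomogeneousLocalization.val_injective
      simp [HomogeneousLocalization.Away.val_mk, Localization.mk_mul, pow_add])).comp
  (DirectSum.decomposeRingEquiv 𝒜).toRingHom

theorem awayDehom_of_mem {f : A} (hf : f ∈ 𝒜 1) {d : ℕ} {a : A} (ha : a ∈ 𝒜 d) :
    awayDehom 𝒜 hf a = HomogeneousLocalization.Away.mk 𝒜 hf d a (by simpa using ha) := by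
  simp only [awayDehom, RingHom.comp_apply]
  have : (DirectSum.decomposeRingEquiv 𝒜).toRingHom a = DirectSum.of (fun i => 𝒜 i) d ⟨a, ha⟩ :=
    DirectSum.decompose_of_mem 𝒜 ha
  rw [this, DirectSum.toSemiring_of]
  rfl

theorem awayDehom_surjective {f : A} (hf : f ∈ 𝒜 1) : Function.Surjective (awayDehom 𝒜 hf) := by
  intro y
  obtain ⟨n, a, ha, rfl⟩ := HomogeneousLocalization.Away.mk_surjective 𝒜 hf y
  exact ⟨a, awayDehom_of_mem 𝒜 hf (by simpa using ha)⟩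

theorem ker_awayDehom {f : A} (hf : f ∈ 𝒜 1) :
    RingHom.ker (awayDehom 𝒜 hf) = Ideal.span {f - 1} := by
  have hf1 : Ideal.Quotient.mk (Ideal.span {f - 1}) f = 1 := by
    rw [← map_one (Ideal.Quotient.mk _), Ideal.Quotient.eq]
    exact Ideal.mem_span_singleton_self _
  apply le_antisymm
  -- Modulo `f - 1` the class of `f` is a unit, which gives a left inverse of `awayDehom`.
  · let ψ : HomogeneousLocalization.Away 𝒜 f →+* A ⧸ Ideal.span {f - 1} :=
      (IsLocalization.Away.lift (S := Localization.Away f) f (g := Ideal.Quotient.mk _)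
        (by rw [hf1]; exact isUnit_one)).comp (algebraMap _ _)
    have hψ : ψ.comp (awayDehom 𝒜 hf) = Ideal.Quotient.mk _ := by
      ext a
      induction a using DirectSum.Decomposition.inductionOn 𝒜 with
      | zero => simp
      | @homogeneous i m =>
        rw [RingHom.comp_apply, awayDehom_of_mem 𝒜 hf m.2]
        simp only [ψ, RingHom.comp_apply, HomogeneousLocalization.algebraMap_apply,
          HomogeneousLocalization.Away.val_mk, Localization.mk_eq_mk', IsLocalization.Away.lift,
          IsLocalization.lift_mk']
        rw [Units.mul_inv_eq_iff_eq_mul]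
        simp [IsUnit.coe_liftRight, hf1]
      | add a b ha hb => rw [map_add, map_add, ha, hb]
    intro a ha
    rw [← Ideal.Quotient.eq_zero_iff_mem, ← hψ, RingHom.comp_apply, ha, map_zero]
  · rw [Ideal.span_singleton_le_iff_mem, RingHom.mem_ker, map_sub, map_one, sub_eq_zero,
      awayDehom_of_mem 𝒜 hf hf]
    apply HomogeneousLocalization.val_injective
    simp [HomogeneousLocalization.Away.val_mk, Localization.mk_self_mk]

/-- Dehomogenisation at `f` of degree `1`, with values in the functions on `D₊(f)`. By
`dehom_surjective` and `ker_dehom`, it presents them as `A ⧸ (f - 1)`. -/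
def dehom {f : A} (hf : f ∈ 𝒜 1) : A →+* Γ(Proj 𝒜, Proj.basicOpen 𝒜 f) :=
  (Proj.awayToSection 𝒜 f).hom.comp (awayDehom 𝒜 hf)

theorem awayToSection_bijective {f : A} {d : ℕ} (hf : f ∈ 𝒜 d) (hd : 0 < d) :
    Function.Bijective (Proj.awayToSection 𝒜 f) :=
  (Proj.basicOpenIsoAway 𝒜 f hf hd).commRingCatIsoToRingEquiv.bijective

theorem dehom_surjective {f : A} (hf : f ∈ 𝒜 1) : Function.Surjective (dehom 𝒜 hf) :=
  (awayToSection_bijective 𝒜 hf one_pos).2.comp (awayDehom_surjective 𝒜 hf)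

theorem ker_dehom {f : A} (hf : f ∈ 𝒜 1) : RingHom.ker (dehom 𝒜 hf) = Ideal.span {f - 1} := by
  rw [← ker_awayDehom 𝒜 hf]
  exact RingHom.ker_comp_of_injective _ (awayToSection_bijective 𝒜 hf one_pos).1

theorem dehom_of_mem {f : A} (hf : f ∈ 𝒜 1) {d : ℕ} {a : A} (ha : a ∈ 𝒜 d) :
    dehom 𝒜 hf a = frac 𝒜 hf d (by simpa using ha) :=
  congrArg (Proj.awayToSection 𝒜 f) (awayDehom_of_mem 𝒜 hf ha)

theorem basicOpen_dehom {f : A} (hf : f ∈ 𝒜 1) {d : ℕ} {a : A} (ha : a ∈ 𝒜 d) :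
    (Proj 𝒜).basicOpen (dehom 𝒜 hf a) = Proj.basicOpen 𝒜 f ⊓ Proj.basicOpen 𝒜 a := by
  ext p
  by_cases hp : p ∈ Proj.basicOpen 𝒜 f
  · simp only [SetLike.mem_coe]
    rw [mem_basicOpen_iff_isUnit_evalAt 𝒜 p hp,
      dehom_of_mem 𝒜 hf ha, evalAt_frac, Localization.mk_eq_mk',
      IsLocalization.AtPrime.isUnit_mk'_iff _ (idealAt 𝒜 p)]
    exact ⟨fun h => ⟨hp, h⟩, fun h => h.2⟩
  · exact ⟨fun h => absurd ((Proj 𝒜).basicOpen_le _ h) hp, fun h => absurd h.1 hp⟩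

/-- The constants on `U` are computed by any ring homomorphism that describes `U ⟶ Spec K`. -/
theorem scalars_eq_of_ι_comp {Y : Scheme.{u}} (f : Y ⟶ Spec (.of K)) (U : Y.Opens)
    (φ : CommRingCat.of K ⟶ Γ(Y, U)) (h : U.ι ≫ f = U.toSpecΓ ≫ Spec.map φ) :
    scalars f U = φ.hom := by
  have h1 : f.appLE ⊤ U le_top = (Scheme.ΓSpecIso (.of K)).hom ≫ φ := by
    have h2 : f.appLE ⊤ U le_top = (U.ι ≫ f).appTop ≫ U.topIso.hom := by
      rw [Scheme.Hom.comp_appTop, Scheme.Opens.ι_appTop]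
      refine Eq.trans ?_ (Category.assoc _ _ _).symm
      refine congrArg (f.appTop ≫ ·) ?_
      exact (Y.presheaf.map_comp _ _)
    rw [h2, h, Scheme.Hom.comp_appTop, Scheme.Opens.toSpecΓ_appTop]
    simp only [Category.assoc, Iso.inv_hom_id, Category.comp_id, Scheme.ΓSpecIso_naturality]
  ext k
  rw [scalars, h1]
  simp

theorem scalars_projToSpec {f : A} {d : ℕ} (hf : f ∈ 𝒜 d) (hd : 0 < d) :
    scalars (projToSpec 𝒜) (Proj.basicOpen 𝒜 f) =
      (CommRingCat.ofHom ((HomogeneousLocalization.fromZeroRingHom 𝒜 _).comp (algebraMap K (𝒜 0))) ≫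
        (Proj.awayToSection 𝒜 f)).hom := by
  apply scalars_eq_of_ι_comp
  have h1 : (Proj.basicOpen 𝒜 f).ι =
      Proj.basicOpenToSpec 𝒜 f ≫ Proj.awayι 𝒜 f hf hd := by
    rw [← Proj.basicOpenIsoSpec_hom 𝒜 f hf hd, ← Proj.basicOpenIsoSpec_inv_ι, Iso.hom_inv_id_assoc]
  rw [h1, projToSpec, Category.assoc, Proj.awayι_toSpecZero_assoc, ← Spec.map_comp,
    Proj.basicOpenToSpec, Category.assoc, ← Spec.map_comp]
  rfl

theorem scalars_eq_dehom {f : A} (hf : f ∈ 𝒜 1) :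
    scalars (projToSpec 𝒜) (Proj.basicOpen 𝒜 f) = (dehom 𝒜 hf).comp (algebraMap K A) := by
  rw [scalars_projToSpec 𝒜 hf one_pos]
  ext k
  refine congrArg (Proj.awayToSection 𝒜 f) ?_
  rw [awayDehom_of_mem 𝒜 hf (d := 0) (SetLike.algebraMap_mem_graded 𝒜 k)]
  apply HomogeneousLocalization.val_injective
  rw [HomogeneousLocalization.Away.val_mk]
  simp only [pow_zero]
  rfl

theorem iSup_basicOpen_eq_top_of_adjoin {ι : Type*} (g : ι → A) (hg : ∀ i, ∃ n, g i ∈ 𝒜 n)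
    (h : Algebra.adjoin K (Set.range g) = ⊤) : ⨆ i, Proj.basicOpen 𝒜 (g i) = ⊤ := by
  refine Proj.iSup_basicOpen_eq_top' 𝒜 g hg (eq_top_iff.2 fun a _ => ?_)
  have ha : a ∈ Algebra.adjoin K (Set.range g) := h ▸ trivial
  induction ha using Algebra.adjoin_induction with
  | mem x hx => exact Algebra.subset_adjoin hx
  | algebraMap k =>
    exact Subalgebra.algebraMap_mem _ (⟨algebraMap K A k, SetLike.algebraMap_mem_graded 𝒜 k⟩ : 𝒜 0)
  | add x y _ _ hx hy => exact add_mem (hx trivial) (hy trivial)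
  | mul x y _ _ hx hy => exact mul_mem (hx trivial) (hy trivial)

end Charts

section ProjectiveSpace

variable (K : Type u) [CommRing K] {r : ℕ}

theorem X_mem_homogeneousSubmodule {σ : Type*} (i : σ) :
    MvPolynomial.X i ∈ MvPolynomial.homogeneousSubmodule σ K 1 :=
  MvPolynomial.isHomogeneous_X K i

theorem dehomogenize_eq_dehom (q : MvPolynomial (Fin (r + 1)) K) (j : Fin (r + 1)) :
    dehomogenize q j = dehom (MvPolynomial.homogeneousSubmodule (Fin (r + 1)) K)
      (X_mem_homogeneousSubmodule K j) q := by
  rw [dehomogenize, ← MvPolynomial.coe_eval₂Hom]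
  congr 1
  apply MvPolynomial.ringHom_ext
  · intro k
    rw [MvPolynomial.coe_eval₂Hom, MvPolynomial.eval₂_C,
      scalars_eq_dehom _ (X_mem_homogeneousSubmodule K j)]
    rfl
  · intro k
    rw [MvPolynomial.coe_eval₂Hom, MvPolynomial.eval₂_X]
    exact (dehom_of_mem _ _ (X_mem_homogeneousSubmodule K k)).symm

theorem iSup_chart : ⨆ j : Fin (r + 1), chart K j = ⊤ :=
  iSup_basicOpen_eq_top_of_adjoin _ _ (fun i => ⟨1, X_mem_homogeneousSubmodule K i⟩)
    MvPolynomial.adjoin_range_X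

theorem isAffineOpen_chart (j : Fin (r + 1)) : IsAffineOpen (chart K j) :=
  Proj.isAffineOpen_basicOpen _ _ (MvPolynomial.isHomogeneous_X K j) one_pos

end ProjectiveSpace

/-! ### Morphisms to projective space over `ℚ` -/

section General

theorem ι_comp_eq_fromSpec {X Y : Scheme.{u}} (h : X ⟶ Y) {U : Y.Opens} (hU : IsAffineOpen U)
    (V : X.Opens) (e : V ≤ h ⁻¹ᵁ U) :
    V.ι ≫ h = V.toSpecΓ ≫ Spec.map (h.appLE U V e) ≫ hU.fromSpec := by
  rw [Scheme.Opens.toSpecΓ_SpecMap_appLE_assoc, hU.toSpecΓ_fromSpec, Scheme.Hom.resLE_comp_ι]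

/-- A morphism whose restriction to `V` is described by `φ : Γ(Y, U) ⟶ Γ(X, V)` maps `V` to `U` and
pulls functions back along `φ`. -/
theorem appLE_eq_of_ι_comp {X Y : Scheme.{u}} (h : X ⟶ Y) {U : Y.Opens} (hU : IsAffineOpen U)
    {V : X.Opens} (hV : IsAffineOpen V) (φ : Γ(Y, U) ⟶ Γ(X, V))
    (H : V.ι ≫ h = V.toSpecΓ ≫ Spec.map φ ≫ hU.fromSpec) :
    ∃ e : V ≤ h ⁻¹ᵁ U, h.appLE U V e = φ := by
  have e : V ≤ h ⁻¹ᵁ U := by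
    intro p hp
    have h1 : h p = (V.ι ≫ h) ⟨p, hp⟩ := rfl
    change h p ∈ U
    rw [h1, H]
    exact hU.range_fromSpec.subset ⟨(V.toSpecΓ ≫ Spec.map φ) ⟨p, hp⟩, rfl⟩
  refine ⟨e, ?_⟩
  rw [ι_comp_eq_fromSpec h hU V e] at H
  have : IsIso V.toSpecΓ := by
    rw [← hV.isoSpec_hom]; infer_instance
  rw [cancel_epi, cancel_mono] at H
  exact Spec.map_injective H

/-- A homomorphism out of `Γ(X, U)` that inverts `f` extends to the functions on `D(f)`. -/
theorem exists_eq_map_comp {X : Scheme.{u}} {U O : X.Opens} (hU : IsAffineOpen U) (h : O ≤ U)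
    (f : Γ(X, U)) (hO : O = X.basicOpen f) {R : CommRingCat.{u}} (φ : Γ(X, U) ⟶ R)
    (hf : IsUnit (φ f)) : ∃ φ' : Γ(X, O) ⟶ R, φ = X.presheaf.map (homOfLE h).op ≫ φ' := by
  let := (X.presheaf.map (homOfLE h).op).hom.toAlgebra
  have := hU.isLocalization_of_eq_basicOpen f (homOfLE h) hO
  exact ⟨CommRingCat.ofHom (IsLocalization.Away.lift (g := φ.hom) f hf),
    CommRingCat.hom_ext <| RingHom.ext fun a =>
      (IsLocalization.Away.lift_eq (g := φ.hom) f hf a).symm⟩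

theorem epi_map_of_eq_basicOpen {X : Scheme.{u}} {U O : X.Opens} (hU : IsAffineOpen U) (h : O ≤ U)
    (f : Γ(X, U)) (hO : O = X.basicOpen f) : Epi (X.presheaf.map (homOfLE h).op) := by
  let := (X.presheaf.map (homOfLE h).op).hom.toAlgebra
  have := hU.isLocalization_of_eq_basicOpen f (homOfLE h) hO
  exact ⟨fun φ ψ e => CommRingCat.hom_ext <| IsLocalization.ringHom_ext (Submonoid.powers f)
    (congrArg CommRingCat.Hom.hom e)⟩

theorem exists_hom_of_surjective {A : Type u} [CommRing A] {B R : CommRingCat.{u}} (D : A →+* B)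
    (hD : Function.Surjective D) (ψ : A →+* R) (h : RingHom.ker D ≤ RingHom.ker ψ) :
    ∃ φ : B ⟶ R, ∀ a, φ (D a) = ψ a :=
  ⟨CommRingCat.ofHom (RingHom.liftOfSurjective D hD ⟨ψ, h⟩), fun a =>
    RingHom.liftOfRightInverse_comp_apply D _ _ ⟨ψ, h⟩ a⟩

end General

section ProjectiveSpace

variable (K : Type u) [CommRing K] {r : ℕ}

theorem basicOpen_coord (i j : Fin (r + 1)) :
    (ProjSpace K r).basicOpen (coord K i j) = chart K i ⊓ chart K j := by
  have := basicOpen_dehom _ (X_mem_homogeneousSubmodule K i) (X_mem_homogeneousSubmodule K j)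
  rw [dehom_of_mem _ _ (X_mem_homogeneousSubmodule K j)] at this
  exact this

theorem evalAt_coord (i j : Fin (r + 1)) (p : ProjSpace K r) (hp : p ∈ chart K i) :
    evalAt _ p hp (coord K i j) = Localization.mk (MvPolynomial.X j) ⟨MvPolynomial.X i, hp⟩ := by
  refine (evalAt_frac _ (X_mem_homogeneousSubmodule K i) 1 _ p hp).trans ?_
  congr 2
  exact pow_one _

theorem evalAt_ratio {A : Type u} [CommRing A] [Algebra K A] (𝒜 : ℕ → Submodule K A)
    [GradedAlgebra 𝒜] {d : ℕ} {g h : A} (hg : g ∈ 𝒜 d) (hh : h ∈ 𝒜 d) (p : Proj 𝒜)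
    (hp : p ∈ Proj.basicOpen 𝒜 g) :
    evalAt 𝒜 p hp (ratio 𝒜 hg hh) = Localization.mk h ⟨g, hp⟩ := by
  refine (evalAt_frac 𝒜 hg 1 _ p hp).trans ?_
  congr 2
  exact pow_one _

theorem coord_self (i : Fin (r + 1)) : coord K i i = 1 := by
  apply evalAt_ext
  intro p hp
  rw [evalAt_coord, map_one]
  exact Localization.mk_self (⟨MvPolynomial.X i, hp⟩ : (idealAt _ p).primeCompl)

/-- The identity `(x_k / x_i) (x_i / x_j) = x_k / x_j`. -/
theorem map_coord_mul_coord {i j : Fin (r + 1)} (k : Fin (r + 1)) {U : (ProjSpace K r).Opens}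
    (hi : U ≤ chart K i) (hj : U ≤ chart K j) :
    (ProjSpace K r).presheaf.map (homOfLE hi).op (coord K i k) *
      (ProjSpace K r).presheaf.map (homOfLE hj).op (coord K j i) =
    (ProjSpace K r).presheaf.map (homOfLE hj).op (coord K j k) := by
  apply evalAt_ext
  intro p hp
  rw [map_mul, evalAt_map, evalAt_map, evalAt_map, evalAt_coord, evalAt_coord, evalAt_coord,
    Localization.mk_mul, Localization.mk_eq_mk_iff, Localization.r_iff_exists]
  exact ⟨1, by simp; ring⟩

/-- Ring homomorphisms out of the functions on a chart are determined by the constants and the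
coordinates. -/
theorem chart_hom_ext {i : Fin (r + 1)} {R : CommRingCat.{u}}
    {φ ψ : Γ(ProjSpace K r, chart K i) ⟶ R}
    (hs : φ.hom.comp (scalars (projSpaceToSpec K r) _) =
      ψ.hom.comp (scalars (projSpaceToSpec K r) _))
    (h : ∀ k, φ (coord K i k) = ψ (coord K i k)) : φ = ψ := by
  ext f
  obtain ⟨q, rfl⟩ := dehom_surjective _ (X_mem_homogeneousSubmodule K i) f
  rw [← dehomogenize_eq_dehom, dehomogenize]
  rw [MvPolynomial.hom_eval₂, MvPolynomial.hom_eval₂, hs]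
  congr 1
  ext k
  exact h k

/-- The functions on the chart `D₊(x_i)` form the polynomial ring in the `x_k / x_i`, `k ≠ i`. -/
theorem exists_chart_hom (i : Fin (r + 1)) (R : CommRingCat.{u}) (c : K →+* R) (g : Fin (r + 1) → R)
    (hg : g i = 1) : ∃ φ : Γ(ProjSpace K r, chart K i) ⟶ R,
      φ.hom.comp (scalars (projSpaceToSpec K r) _) = c ∧ ∀ k, φ (coord K i k) = g k := by
  obtain ⟨φ, h⟩ := exists_hom_of_surjective (dehom _ (X_mem_homogeneousSubmodule K i))
    (dehom_surjective _ _) (MvPolynomial.eval₂Hom c g) (by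
      rw [ker_dehom, Ideal.span_singleton_le_iff_mem, RingHom.mem_ker]
      simp [hg])
  refine ⟨φ, ?_, fun k => ?_⟩
  · rw [projSpaceToSpec, scalars_eq_dehom _ (X_mem_homogeneousSubmodule K i)]
    ext a
    exact (h (.C a)).trans (MvPolynomial.eval₂_C _ _ _)
  · have := h (MvPolynomial.X k)
    rw [dehom_of_mem _ _ (X_mem_homogeneousSubmodule K k), MvPolynomial.coe_eval₂Hom,
      MvPolynomial.eval₂_X] at this
    exact this

end ProjectiveSpace

section Rational

variable {r : ℕ}

theorem chart_hom_ext_rat {i : Fin (r + 1)} {R : CommRingCat.{0}}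
    {φ ψ : Γ(ProjSpace ℚ r, chart ℚ i) ⟶ R}
    (h : ∀ k, φ (coord ℚ i k) = ψ (coord ℚ i k)) : φ = ψ :=
  chart_hom_ext ℚ (Subsingleton.elim _ _) h

/-- Two morphisms from an affine scheme to charts of `ℙ^r` agree as morphisms to `ℙ^r` when their
tuples of coordinates are proportional. -/
theorem SpecMap_fromSpec_chart_eq {R : CommRingCat.{0}} {i j : Fin (r + 1)}
    (φ : Γ(ProjSpace ℚ r, chart ℚ i) ⟶ R) (ψ : Γ(ProjSpace ℚ r, chart ℚ j) ⟶ R)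
    (h : ∀ k l, φ (coord ℚ i k) * ψ (coord ℚ j l) = φ (coord ℚ i l) * ψ (coord ℚ j k)) :
    Spec.map φ ≫ (isAffineOpen_chart ℚ i).fromSpec =
      Spec.map ψ ≫ (isAffineOpen_chart ℚ j).fromSpec := by
  -- Both morphisms land in the intersection `O` of the charts, since they invert the coordinates.
  have hij : φ (coord ℚ i j) * ψ (coord ℚ j i) = 1 := by
    rw [h, coord_self, coord_self, map_one, map_one, one_mul]
  have hψ : IsUnit (ψ (coord ℚ j i)) := .of_mul_eq_one_right _ hij
  let O : (ProjSpace ℚ r).Opens := chart ℚ i ⊓ chart ℚ j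
  have hi : O ≤ chart ℚ i := inf_le_left
  have hj : O ≤ chart ℚ j := inf_le_right
  have hOi : O = (ProjSpace ℚ r).basicOpen (coord ℚ i j) := (basicOpen_coord ℚ i j).symm
  have hOj : O = (ProjSpace ℚ r).basicOpen (coord ℚ j i) :=
    (inf_comm _ _).trans (basicOpen_coord ℚ j i).symm
  have hO : IsAffineOpen O := hOi ▸ (isAffineOpen_chart ℚ i).basicOpen _
  obtain ⟨φ', eφ⟩ := exists_eq_map_comp (isAffineOpen_chart ℚ i) hi _ hOi φ (.of_mul_eq_one _ hij)
  obtain ⟨ψ', eψ⟩ := exists_eq_map_comp (isAffineOpen_chart ℚ j) hj _ hOj ψ hψ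
  have := epi_map_of_eq_basicOpen (isAffineOpen_chart ℚ i) hi _ hOi
  have e : φ' = ψ' := by
    rw [← cancel_epi ((ProjSpace ℚ r).presheaf.map (homOfLE hi).op), ← eφ]
    apply chart_hom_ext_rat
    intro k
    apply hψ.mul_right_cancel
    refine (h k i).trans ?_
    rw [coord_self, map_one, one_mul, eψ]
    refine (congrArg ψ'.hom (map_coord_mul_coord ℚ k hi hj)).symm.trans ?_
    exact map_mul ψ'.hom _ _
  rw [eφ, eψ, e, Spec.map_comp, Spec.map_comp, Category.assoc, Category.assoc,
    (isAffineOpen_chart ℚ i).map_fromSpec hO, (isAffineOpen_chart ℚ j).map_fromSpec hO]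

/-- The morphism `h` maps the open `U` to the chart `D₊(x_i)`, with `x_k / x_i` pulled back to
`g k`. -/
def MapsBy {X : Scheme.{0}} (h : X ⟶ ProjSpace ℚ r) (U : X.Opens) (i : Fin (r + 1))
    (g : Fin (r + 1) → Γ(X, U)) : Prop :=
  ∃ e : U ≤ h ⁻¹ᵁ chart ℚ i, ∀ k, (h.appLE (chart ℚ i) U e).hom (coord ℚ i k) = g k

/-- As `ℤ → ℚ` is an epimorphism of rings, compatibility with structure morphisms to `Spec ℚ` is
automatic. -/
theorem hom_SpecRat_ext {X : Scheme.{0}} (f g : X ⟶ Spec (.of ℚ)) : f = g := by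
  apply (ΓSpec.adjunction.homEquiv X (Opposite.op (.of ℚ))).symm.injective
  apply Quiver.Hom.unop_inj
  ext q
  exact RingHom.congr_fun (Subsingleton.elim _ _) q

/-- Compatible tuples of functions on an affine open cover define a morphism to projective
space. -/
theorem exists_mapsBy {X : Scheme.{0}} (x : X ⟶ Spec (.of ℚ)) {ι : Type} (U : ι → X.Opens)
    (hU : ∀ a, IsAffineOpen (U a)) (hc : ⨆ a, U a = ⊤) (c : ι → Fin (r + 1))
    (g : ∀ a, Fin (r + 1) → Γ(X, U a)) (hg : ∀ a, g a (c a) = 1)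
    (compat : ∀ a b k l,
      X.presheaf.map (homOfLE (inf_le_left : U a ⊓ U b ≤ _)).op (g a k) *
        X.presheaf.map (homOfLE (inf_le_right : U a ⊓ U b ≤ _)).op (g b l) =
      X.presheaf.map (homOfLE (inf_le_left : U a ⊓ U b ≤ _)).op (g a l) *
        X.presheaf.map (homOfLE (inf_le_right : U a ⊓ U b ≤ _)).op (g b k)) :
    ∃ h : X ⟶ ProjSpace ℚ r, ∀ a, MapsBy h (U a) (c a) (g a) := by
  choose φ hφ using fun a => (exists_chart_hom ℚ (c a) Γ(X, U a) (scalars x (U a)) (g a)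
    (hg a)).imp fun _ h => h.2
  let f (a : ι) : (U a : Scheme) ⟶ ProjSpace ℚ r :=
    (U a).toSpecΓ ≫ Spec.map (φ a) ≫ (isAffineOpen_chart ℚ (c a)).fromSpec
  have key (a b) : X.homOfLE (inf_le_left : U a ⊓ U b ≤ _) ≫ f a =
      X.homOfLE (inf_le_right : U a ⊓ U b ≤ _) ≫ f b := by
    simp only [f]
    rw [← Scheme.Opens.toSpecΓ_SpecMap_presheaf_map_assoc,
      ← Scheme.Opens.toSpecΓ_SpecMap_presheaf_map_assoc, ← Spec.map_comp_assoc,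
      ← Spec.map_comp_assoc]
    congr 1
    apply SpecMap_fromSpec_chart_eq
    intro k l
    simp only [CommRingCat.comp_apply, hφ]
    exact compat a b k l
  let 𝒰 := X.openCoverOfIsOpenCover U hc
  have hglue (a b : ι) : pullback.fst (𝒰.f a) (𝒰.f b) ≫ f a =
      pullback.snd (𝒰.f a) (𝒰.f b) ≫ f b := by
    have h1 := (isPullback_opens_inf (U a) (U b)).isoPullback_inv_fst
    have h2 := (isPullback_opens_inf (U a) (U b)).isoPullback_inv_snd
    refine (congrArg (· ≫ f a) h1).symm.trans (Eq.trans ?_ (congrArg (· ≫ f b) h2))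
    simp only [Category.assoc, key]
  refine ⟨𝒰.glueMorphisms f hglue, fun a => ?_⟩
  have := 𝒰.ι_glueMorphisms f hglue a
  obtain ⟨e, he⟩ := appLE_eq_of_ι_comp (𝒰.glueMorphisms f hglue) (isAffineOpen_chart ℚ (c a)) (hU a)
    (φ a) this
  refine ⟨e, fun k => ?_⟩
  rw [he]
  exact hφ a k

/-- The preimage of another chart is cut out on `U` by the corresponding coordinate. -/
theorem MapsBy.preimage_inf {X : Scheme.{0}} {h : X ⟶ ProjSpace ℚ r} {U : X.Opens} {i : Fin (r + 1)}
    {g : Fin (r + 1) → Γ(X, U)} (H : MapsBy h U i g) (j : Fin (r + 1)) :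
    U ⊓ h ⁻¹ᵁ chart ℚ j = X.basicOpen (g j) := by
  obtain ⟨e, he⟩ := H
  rw [← he, Scheme.basicOpen_appLE, basicOpen_coord, Scheme.Hom.preimage_inf, ← inf_assoc,
    inf_eq_left.mpr e]

theorem MapsBy.mono {X : Scheme.{0}} {h : X ⟶ ProjSpace ℚ r} {U V : X.Opens} {i : Fin (r + 1)}
    {g : Fin (r + 1) → Γ(X, U)} (H : MapsBy h U i g) (hV : V ≤ U) :
    MapsBy h V i fun k => X.presheaf.map (homOfLE hV).op (g k) := by
  obtain ⟨e, he⟩ := H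
  refine ⟨hV.trans e, fun k => ?_⟩
  beta_reduce
  rw [← he, ← Scheme.Hom.appLE_map h e (homOfLE hV).op]
  rfl

end Rational

section Graded

variable {A : Type} [CommRing A] [Algebra ℚ A] (𝒜 : ℕ → Submodule ℚ A) [GradedAlgebra 𝒜] {r : ℕ}

theorem ratio_self {d : ℕ} {g : A} (hg : g ∈ 𝒜 d) : ratio 𝒜 hg hg = 1 := by
  apply evalAt_ext
  intro p hp
  rw [evalAt_ratio, map_one]
  exact Localization.mk_self (⟨g, hp⟩ : (idealAt 𝒜 p).primeCompl)

theorem basicOpen_ratio {d : ℕ} {g h : A} (hg : g ∈ 𝒜 d) (hh : h ∈ 𝒜 d) :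
    (Proj 𝒜).basicOpen (ratio 𝒜 hg hh) = Proj.basicOpen 𝒜 g ⊓ Proj.basicOpen 𝒜 h := by
  ext p
  by_cases hp : p ∈ Proj.basicOpen 𝒜 g
  · simp only [SetLike.mem_coe]
    rw [mem_basicOpen_iff_isUnit_evalAt 𝒜 p hp, evalAt_ratio, Localization.mk_eq_mk',
      IsLocalization.AtPrime.isUnit_mk'_iff _ (idealAt 𝒜 p)]
    exact ⟨fun h => ⟨hp, h⟩, fun h => h.2⟩
  · exact ⟨fun h => absurd ((Proj 𝒜).basicOpen_le _ h) hp, fun h => absurd h.1 hp⟩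

/-- Pairwise proportional tuples of homogeneous elements without common zero define a morphism to
projective space. -/
theorem exists_mapsBy_ratio {ι : Type} (G : ι → Fin (r + 1) → A) (d : ι → ℕ) (hd : ∀ a, 0 < d a)
    (hG : ∀ a k, G a k ∈ 𝒜 (d a)) (compat : ∀ a b k l, G a k * G b l = G a l * G b k)
    (hc : ⨆ a, ⨆ k, Proj.basicOpen 𝒜 (G a k) = ⊤) :
    ∃ h : Proj 𝒜 ⟶ ProjSpace ℚ r, ∀ a i,
      MapsBy h (Proj.basicOpen 𝒜 (G a i)) i fun k => ratio 𝒜 (hG a i) (hG a k) := by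
  obtain ⟨h, hh⟩ := exists_mapsBy (r := r) (projToSpec 𝒜) (ι := ι × Fin (r + 1))
    (fun a => Proj.basicOpen 𝒜 (G a.1 a.2))
    (fun a => Proj.isAffineOpen_basicOpen _ _ (hG a.1 a.2) (hd a.1)) (by rw [iSup_prod, hc])
    (fun a => a.2) (fun a k => ratio 𝒜 (hG a.1 a.2) (hG a.1 k)) (fun a => ratio_self 𝒜 _)
    (by
      intro a b k l
      apply evalAt_ext
      intro p hp
      simp only [map_mul, evalAt_map, evalAt_ratio, Localization.mk_mul]
      rw [compat])
  exact ⟨h, fun a i => hh (a, i)⟩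

/-- The preimage of a chart is the union of the opens on which the morphism is defined to land
there. -/
theorem preimage_chart_of_mapsBy {ι : Type} (G : ι → Fin (r + 1) → A) (d : ι → ℕ)
    (hG : ∀ a k, G a k ∈ 𝒜 (d a)) (hc : ⨆ a, ⨆ k, Proj.basicOpen 𝒜 (G a k) = ⊤)
    {h : Proj 𝒜 ⟶ ProjSpace ℚ r} (H : ∀ a i,
      MapsBy h (Proj.basicOpen 𝒜 (G a i)) i fun k => ratio 𝒜 (hG a i) (hG a k)) (i : Fin (r + 1)) :
    h ⁻¹ᵁ chart ℚ i = ⨆ a, Proj.basicOpen 𝒜 (G a i) := by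
  apply le_antisymm
  · intro p hp
    have hp' : p ∈ (⊤ : (Proj 𝒜).Opens) := trivial
    rw [← hc] at hp'
    simp only [TopologicalSpace.Opens.mem_iSup] at hp' ⊢
    obtain ⟨a, k, hk⟩ := hp'
    have := (H a k).preimage_inf i
    rw [basicOpen_ratio] at this
    have h2 : p ∈ Proj.basicOpen 𝒜 (G a k) ⊓ Proj.basicOpen 𝒜 (G a i) := this ▸ ⟨hk, hp⟩
    exact ⟨a, h2.2⟩
  · exact iSup_le fun a => (H a i).1

end Graded

/-! ### Closed immersions on affine covers -/

section ClosedImmersion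

theorem isClosedImmersion_of_affine_cover {X Y : Scheme.{u}} (f : X ⟶ Y) {ι : Type*}
    (U : ι → Y.Opens) (hU : ∀ i, IsAffineOpen (U i)) (hc : ⨆ i, U i = ⊤)
    (hf : ∀ i, IsAffineOpen (f ⁻¹ᵁ U i)) (hs : ∀ i, Function.Surjective (f.app (U i)).hom) :
    IsClosedImmersion f := by
  refine (IsZariskiLocalAtTarget.iff_of_iSup_eq_top (P := @IsClosedImmersion) U hc).mpr
    fun i => ?_
  have : IsAffine (U i) := hU i
  have : IsAffine (f ⁻¹ᵁ U i) := hf i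
  refine IsClosedImmersion.of_surjective_of_isAffine (f ∣_ U i) ?_
  rw [morphismRestrict_appTop]
  have h : Function.Surjective (f.app ((U i).ι ''ᵁ ⊤)).hom := by
    rw [Scheme.Opens.ι_image_top]
    exact hs i
  exact (asIso (X.presheaf.map (eqToHom
    (image_morphismRestrict_preimage f (U i) ⊤)).op)).commRingCatIsoToRingEquiv.surjective.comp h

theorem ker_of_isPushout {R A R' P : CommRingCat.{u}} {a : R ⟶ A} {b : R ⟶ R'} {c : A ⟶ P}
    {d : R' ⟶ P} (H : IsPushout a b c d) (ha : Function.Surjective a.hom) :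
    RingHom.ker d.hom = (RingHom.ker a.hom).map b.hom := by
  apply le_antisymm
  · let q : R' ⟶ CommRingCat.of (R' ⧸ (RingHom.ker a.hom).map b.hom) :=
      CommRingCat.ofHom (Ideal.Quotient.mk _)
    obtain ⟨e, he⟩ := exists_hom_of_surjective (R := .of (R' ⧸ (RingHom.ker a.hom).map b.hom))
      a.hom ha (b ≫ q).hom (by
        intro r hr
        exact Ideal.Quotient.eq_zero_iff_mem.mpr (Ideal.mem_map_of_mem _ hr))
    have w : a ≫ e = b ≫ q := by ext r; exact he r
    intro r hr
    have : q.hom r = 0 := by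
      rw [← H.inr_desc e q w]
      exact (congrArg (H.desc e q w).hom hr).trans (map_zero _)
    exact Ideal.Quotient.eq_zero_iff_mem.mp this
  · rw [Ideal.map_le_iff_le_comap]
    intro r hr
    have h1 : c.hom (a.hom r) = d.hom (b.hom r) := congrArg (fun z => z.hom r) H.w
    rw [Ideal.mem_comap, RingHom.mem_ker, ← h1, (show a.hom r = 0 from hr), map_zero]

/-- The ideal of a closed subscheme, after a base change, is the extension of its ideal. -/
theorem ker_app_of_isPullback {X Y X' Y' : Scheme.{u}} {f : X ⟶ Y} {g : Y' ⟶ Y} {f' : X' ⟶ Y'}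
    {g' : X' ⟶ X} (H : IsPullback g' f' f g) [IsClosedImmersion f] {V : Y.Opens} {V' : Y'.Opens}
    (hV : IsAffineOpen V) (hV' : IsAffineOpen V') (h : V' ≤ g ⁻¹ᵁ V) :
    RingHom.ker (f'.app V').hom = (RingHom.ker (f.app V).hom).map (g.appLE V V' h).hom := by
  have hUY : f' ⁻¹ᵁ V' = g' ⁻¹ᵁ (f ⁻¹ᵁ V) ⊓ f' ⁻¹ᵁ V' := by
    refine (inf_eq_right.mpr ?_).symm
    refine (f'.preimage_mono h).trans ?_
    rw [← Scheme.Hom.comp_preimage, ← Scheme.Hom.comp_preimage, H.w]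
  have hX : IsAffineOpen (f ⁻¹ᵁ V) := hV.preimage f
  have h1 := isIso_pushoutSection_of_isAffineOpen H h le_rfl hUY hV hV' hX
  have h2 := (isIso_pushoutSection_iff H h le_rfl hUY).mp h1
  have h3 : f.appLE V (f ⁻¹ᵁ V) le_rfl = f.app V := f.app_eq_appLE.symm
  have h4 := ker_of_isPushout h2 (by rw [h3]; exact f.app_surjective V hV)
  rw [h3] at h4
  rw [← h4, Scheme.Hom.app_eq_appLE]

end ClosedImmersion

/-! ### The standard charts of `ℙ¹ × ℙ²` -/

section BiChart

/-- The functions on a product of affine opens of a fibre product form the tensor product. -/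
theorem isPushout_pullback {X Y S : Scheme.{u}} (f : X ⟶ S) (g : Y ⟶ S) [IsAffine S] {U : X.Opens}
    {V : Y.Opens} (hU : IsAffineOpen U) (hV : IsAffineOpen V) :
    IsPushout (f.appLE ⊤ U le_top) (g.appLE ⊤ V le_top)
      ((pullback.fst f g).appLE U (pullback.fst f g ⁻¹ᵁ U ⊓ pullback.snd f g ⁻¹ᵁ V) inf_le_left)
      ((pullback.snd f g).appLE V (pullback.fst f g ⁻¹ᵁ U ⊓ pullback.snd f g ⁻¹ᵁ V) inf_le_right) :=
  (isIso_pushoutSection_iff _ _ _ rfl).mp (isIso_pushoutSection_of_isAffineOpen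
    (IsPullback.of_hasPullback f g) (US := ⊤) (UX := U) (UT := V) le_top le_top
    rfl (isAffineOpen_top _) hV hU)

theorem isAffineOpen_pullback {X Y S : Scheme.{u}} (f : X ⟶ S) (g : Y ⟶ S) [IsAffine S]
    {U : X.Opens} {V : Y.Opens} (hU : IsAffineOpen U) (hV : IsAffineOpen V) :
    IsAffineOpen (pullback.fst f g ⁻¹ᵁ U ⊓ pullback.snd f g ⁻¹ᵁ V) := by
  have h := Scheme.Hom.isPullback_resLE (IsPullback.of_hasPullback f g) (US := ⊤) (UX := U)
    (UT := V) le_top le_top rfl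
  have : IsAffine U := hU
  have : IsAffine V := hV
  have : IsAffine (⊤ : S.Opens) := isAffineOpen_top S
  exact .of_isIso h.isoPullback.hom

variable (K : Type u) [Field K]

theorem isAffineOpen_biChart (i : Fin 2) (j : Fin 3) : IsAffineOpen (biChart K i j) :=
  isAffineOpen_pullback _ _ (isAffineOpen_chart K i) (isAffineOpen_chart K j)

theorem isPushout_biChart (i : Fin 2) (j : Fin 3) :
    IsPushout ((projSpaceToSpec K 1).appLE ⊤ (chart K i) le_top)
      ((projSpaceToSpec K 2).appLE ⊤ (chart K j) le_top)
      ((pr₁ K).appLE (chart K i) (biChart K i j) inf_le_left)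
      ((pr₂ K).appLE (chart K j) (biChart K i j) inf_le_right) :=
  isPushout_pullback _ _ (isAffineOpen_chart K i) (isAffineOpen_chart K j)

theorem iSup_biChart : ⨆ a : Fin 2 × Fin 3, biChart K a.1 a.2 = ⊤ := by
  refine eq_top_iff.mpr fun p _ => ?_
  have h1 : (pr₁ K) p ∈ (⊤ : (ProjSpace K 1).Opens) := trivial
  have h2 : (pr₂ K) p ∈ (⊤ : (ProjSpace K 2).Opens) := trivial
  rw [← iSup_chart, TopologicalSpace.Opens.mem_iSup] at h1 h2
  obtain ⟨i, hi⟩ := h1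
  obtain ⟨j, hj⟩ := h2
  exact TopologicalSpace.Opens.mem_iSup.mpr ⟨(i, j), hi, hj⟩

/-- Dehomogenisation on a chart of `ℙ¹ × ℙ²`, as a ring homomorphism. -/
def biDehom (i : Fin 2) (j : Fin 3) :
    MvPolynomial (Fin 3) (MvPolynomial (Fin 2) K) →+* Γ(P1P2 K, biChart K i j) :=
  MvPolynomial.eval₂Hom
    (MvPolynomial.eval₂Hom (scalars (pr₁ K ≫ projSpaceToSpec K 1) (biChart K i j))
      fun k => ((pr₁ K).appLE (chart K i) (biChart K i j) inf_le_left).hom (coord K i k))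
    fun k => ((pr₂ K).appLE (chart K j) (biChart K i j) inf_le_right).hom (coord K j k)

theorem biDehomogenize_eq (F : MvPolynomial (Fin 3) (MvPolynomial (Fin 2) K)) (i : Fin 2)
    (j : Fin 3) : biDehomogenize F i j = biDehom K i j F := rfl

theorem appLE_scalars {X Y : Scheme.{u}} (h : X ⟶ Y) (y : Y ⟶ Spec (.of K)) {U : Y.Opens}
    {V : X.Opens} (e : V ≤ h ⁻¹ᵁ U) (c : K) :
    (h.appLE U V e).hom (scalars y U c) = scalars (h ≫ y) V c := by
  have := h.appLE_comp_appLE y ⊤ U V le_top e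
  exact congrArg (fun z => z.hom ((Scheme.ΓSpecIso (.of K)).inv.hom c)) this

/-- The functions on a chart of `ℙ¹ × ℙ²` are generated by the constants and the coordinates. -/
theorem biDehom_surjective (i : Fin 2) (j : Fin 3) : Function.Surjective (biDehom K i j) := by
  rw [← RingHom.range_eq_top, eq_top_iff,
    ← CommRingCat.closure_range_union_range_eq_top_of_isPushout (isPushout_biChart K i j),
    Subring.closure_le]
  have aux {r : ℕ} (l : Fin (r + 1)) (T : Subring Γ(P1P2 K, biChart K i j))
      (h : P1P2 K ⟶ ProjSpace K r) (e : biChart K i j ≤ h ⁻¹ᵁ chart K l)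
      (h0 : ∀ c, scalars (h ≫ projSpaceToSpec K r) (biChart K i j) c ∈ T)
      (h1 : ∀ k, (h.appLE (chart K l) _ e).hom (coord K l k) ∈ T) :
      Set.range (h.appLE (chart K l) _ e) ⊆ (T : Set Γ(P1P2 K, biChart K i j)) := by
    rintro _ ⟨a, rfl⟩
    obtain ⟨q, rfl⟩ := dehom_surjective _ (X_mem_homogeneousSubmodule K l) a
    rw [← dehomogenize_eq_dehom, dehomogenize]
    refine (MvPolynomial.hom_eval₂ q _ (h.appLE (chart K l) _ e).hom _).symm ▸ ?_
    induction q using MvPolynomial.induction_on with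
    | C c =>
      rw [MvPolynomial.eval₂_C, RingHom.comp_apply, appLE_scalars]
      exact h0 c
    | add p q hp hq => rw [MvPolynomial.eval₂_add]; exact add_mem hp hq
    | mul_X p k hp =>
      rw [MvPolynomial.eval₂_mul, MvPolynomial.eval₂_X]
      exact mul_mem hp (h1 k)
  refine Set.union_subset (aux i _ _ _ (fun c => ?_) fun k => ?_)
    (aux j _ _ _ (fun c => ?_) fun k => ?_)
  · exact ⟨MvPolynomial.C (MvPolynomial.C c), by simp [biDehom]⟩
  · exact ⟨MvPolynomial.C (MvPolynomial.X k), by simp [biDehom]⟩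
  · exact ⟨MvPolynomial.C (MvPolynomial.C c), by simp [biDehom, pullback.condition]⟩
  · exact ⟨MvPolynomial.X k, by simp [biDehom]⟩

end BiChart

/-! ### Projective embeddings of `Proj` -/

section ProjectiveEmbedding

variable {A : Type} [CommRing A] [Algebra ℚ A] (𝒜 : ℕ → Submodule ℚ A) [GradedAlgebra 𝒜] {r : ℕ}

/-- If the Veronese subring of degree `d` is generated by the `g k`, these define a closed
embedding. -/
theorem exists_closedImmersion {d : ℕ} (hd : 0 < d) (g : Fin (r + 1) → A) (hg : ∀ k, g k ∈ 𝒜 d)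
    (hc : ⨆ k, Proj.basicOpen 𝒜 (g k) = ⊤)
    (hgen : ∀ n, 𝒜 (n • d) ≤ Submodule.span ℚ (Set.range g) ^ n) :
    ∃ i : Proj 𝒜 ⟶ ProjSpace ℚ r, IsClosedImmersion i := by
  have hc' : ⨆ _ : Unit, ⨆ k, Proj.basicOpen 𝒜 (g k) = ⊤ := by rw [iSup_const, hc]
  obtain ⟨h, H⟩ := exists_mapsBy_ratio 𝒜 (fun _ : Unit => g) (fun _ => d) (fun _ => hd)
    (fun _ => hg) (fun _ _ k l => mul_comm _ _) hc'
  have hpre (k) : h ⁻¹ᵁ chart ℚ k = Proj.basicOpen 𝒜 (g k) := by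
    rw [preimage_chart_of_mapsBy 𝒜 (fun _ : Unit => g) (fun _ => d) (fun _ => hg) hc' H k,
      iSup_const]
  refine ⟨h, isClosedImmersion_of_affine_cover h (chart ℚ) (isAffineOpen_chart ℚ) (iSup_chart ℚ)
    (fun k => hpre k ▸ Proj.isAffineOpen_basicOpen _ _ (hg k) hd) fun k => ?_⟩
  obtain ⟨e, he⟩ := H () k
  suffices hs : Function.Surjective (h.appLE (chart ℚ k) _ e).hom by
    have : ∀ (W : (Proj 𝒜).Opens) (e' : W ≤ h ⁻¹ᵁ chart ℚ k) (_ : W = Proj.basicOpen 𝒜 (g k)),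
        Function.Surjective (h.appLE (chart ℚ k) W e').hom := by
      rintro _ _ rfl; exact hs
    rw [Scheme.Hom.app_eq_appLE]
    exact this _ _ (hpre k)
  intro b
  obtain ⟨b, rfl⟩ := (awayToSection_bijective 𝒜 (hg k) hd).2 b
  obtain ⟨n, a, ha, rfl⟩ := HomogeneousLocalization.Away.mk_surjective 𝒜 (hg k) b
  have hgs : Submodule.span ℚ (Set.range g) ≤ 𝒜 d := Submodule.span_le.mpr (by
    rintro _ ⟨l, rfl⟩; exact hg l)
  -- By induction on `n`, the fractions `a / g_kⁿ` are polynomials in the `g_l / g_k`.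
  have key : ∀ n, ∀ a ∈ Submodule.span ℚ (Set.range g) ^ n, ∃ ha : a ∈ 𝒜 (n • d),
      frac 𝒜 (hg k) n ha ∈ (h.appLE (chart ℚ k) _ e).hom.range := by
    have hscal (c : ℚ) : ∃ hc : algebraMap ℚ A c ∈ 𝒜 (0 • d),
        frac 𝒜 (hg k) 0 hc ∈ (h.appLE (chart ℚ k) _ e).hom.range := by
      refine ⟨by rw [zero_smul]; exact SetLike.algebraMap_mem_graded 𝒜 c,
        scalars (projSpaceToSpec ℚ r) _ c, ?_⟩
      -- Two ring homomorphisms out of `ℚ` agree, so any one of them computes the constants.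
      let ψ : ℚ →+* Γ(Proj 𝒜, Proj.basicOpen 𝒜 (g k)) := (Proj.awayToSection 𝒜 (g k)).hom.comp
        ((HomogeneousLocalization.fromZeroRingHom 𝒜 _).comp (algebraMap ℚ (𝒜 0)))
      refine (RingHom.congr_fun (Subsingleton.elim ((h.appLE (chart ℚ k) _ e).hom.comp
        (scalars (projSpaceToSpec ℚ r) _)) ψ) c).trans ?_
      refine congrArg (Proj.awayToSection 𝒜 (g k)) ?_
      apply HomogeneousLocalization.val_injective
      rw [HomogeneousLocalization.Away.val_mk]
      simp only [pow_zero]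
      rfl
    have hadd (n : ℕ) (a b : A) (ha : a ∈ 𝒜 (n • d)) (hb : b ∈ 𝒜 (n • d)) :
        frac 𝒜 (hg k) n (add_mem ha hb) = frac 𝒜 (hg k) n ha + frac 𝒜 (hg k) n hb := by
      apply evalAt_ext
      intro p hp
      rw [map_add, evalAt_frac, evalAt_frac, evalAt_frac, Localization.add_mk_self]
    intro n a ha
    refine Submodule.pow_induction_on_left' (C := fun n a _ => ∃ ha : a ∈ 𝒜 (n • d),
      frac 𝒜 (hg k) n ha ∈ (h.appLE (chart ℚ k) _ e).hom.range) _ hscal ?_ ?_ ha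
    · rintro a b n - - ⟨ha, ha'⟩ ⟨hb, hb'⟩
      exact ⟨add_mem ha hb, hadd n a b ha hb ▸ add_mem ha' hb'⟩
    · rintro m hm n a - ⟨ha, ha'⟩
      have hmul : ∀ m ∈ 𝒜 d, m * a ∈ 𝒜 ((n + 1) • d) := fun m hm => by
        rw [add_smul, one_smul, add_comm]; exact SetLike.mul_mem_graded hm ha
      refine ⟨hmul m (hgs hm), ?_⟩
      have hfr (m : A) (hm : m ∈ 𝒜 d) :
          frac 𝒜 (hg k) (n + 1) (hmul m hm) = ratio 𝒜 (hg k) hm * frac 𝒜 (hg k) n ha := by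
        apply evalAt_ext
        intro p hp
        rw [map_mul, evalAt_frac, evalAt_ratio, evalAt_frac, Localization.mk_mul]
        congr 1
        exact Subtype.ext (pow_succ' _ _)
      have : ∀ m ∈ Submodule.span ℚ (Set.range g), ∃ hm : m ∈ 𝒜 d,
          ratio 𝒜 (hg k) hm ∈ (h.appLE (chart ℚ k) _ e).hom.range := by
        intro m hm
        induction hm using Submodule.span_induction with
        | mem m hm =>
          obtain ⟨l, rfl⟩ := hm
          exact ⟨hg l, coord ℚ k l, he l⟩
        | zero =>
          have : ratio 𝒜 (hg k) (zero_mem (𝒜 d)) = 0 := by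
            apply evalAt_ext
            intro p hp
            rw [evalAt_ratio, map_zero, Localization.mk_zero]
          exact ⟨zero_mem _, this ▸ zero_mem _⟩
        | add a b ha hb iha ihb =>
          obtain ⟨ha, ha'⟩ := iha
          obtain ⟨hb, hb'⟩ := ihb
          have : ratio 𝒜 (hg k) (add_mem ha hb) = ratio 𝒜 (hg k) ha + ratio 𝒜 (hg k) hb := by
            apply evalAt_ext
            intro p hp
            rw [map_add, evalAt_ratio, evalAt_ratio, evalAt_ratio, Localization.add_mk_self]
          exact ⟨add_mem ha hb, this ▸ add_mem ha' hb'⟩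
        | smul c a ha iha =>
          obtain ⟨ha, ha'⟩ := iha
          obtain ⟨hc, hc'⟩ := hscal c
          have : ratio 𝒜 (hg k) (Submodule.smul_mem _ c ha) =
              frac 𝒜 (hg k) 0 hc * ratio 𝒜 (hg k) ha := by
            apply evalAt_ext
            intro p hp
            rw [map_mul, evalAt_frac, evalAt_ratio, evalAt_ratio, Localization.mk_mul,
              Algebra.smul_def]
            congr 1
            exact Subtype.ext (by simp)
          exact ⟨Submodule.smul_mem _ c ha, this ▸ mul_mem hc' ha'⟩
      exact (hfr m (hgs hm)).symm ▸ mul_mem (this m hm).2 ha'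
  exact (key n a (hgen n ha)).2

end ProjectiveEmbedding

/-! ### A local criterion for a presentation of a ring -/

section LocalCriterion

/-- An ideal that contains powers of elements generating the unit ideal is the unit ideal. -/
theorem eq_top_of_pow_mem {M : Type*} [CommRing M] {ι : Type*} {I K : Ideal M} (b : ι → M)
    (h : I ⊔ Ideal.span (Set.range b) = ⊤) (hI : I ≤ K) (hb : ∀ k, ∃ N, b k ^ N ∈ K) : K = ⊤ := by
  rw [← Ideal.radical_eq_top, eq_top_iff, ← h]
  refine sup_le (hI.trans Ideal.le_radical) (Ideal.span_le.mpr ?_)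
  rintro _ ⟨k, rfl⟩
  exact hb k

/-- A ring homomorphism `Θ : M → Γ` is surjective with kernel `I` when it is so after inverting
elements `σ (g k)` that generate the unit ideal modulo `I`; the localisations of `M ⧸ I` and of `Γ`
are compared with those of a third ring `P ⧸ J`. -/
theorem surjective_and_ker_eq {P M Γ : Type*} [CommRing P] [CommRing M] [CommRing Γ] {κ : Type*}
    {R : κ → Type*} [∀ k, CommRing (R k)] (Θ : M →+* Γ) {I : Ideal M} (hI : I ≤ RingHom.ker Θ)
    (σ : P →+* M) (g : κ → P) (hg : I ⊔ Ideal.span (Set.range fun k => σ (g k)) = ⊤)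
    (l : ∀ k, Γ →+* R k) (hl : ∀ k v, l k v = 0 → ∃ N, Θ (σ (g k)) ^ N * v = 0)
    {J : Ideal P} (hJ : ∀ p ∈ J, σ p ∈ I) (hinj : ∀ k p, l k (Θ (σ p)) = 0 → ∃ N, g k ^ N * p ∈ J)
    (hsurj : ∀ k z, ∃ N p, l k (Θ (σ (g k))) ^ N * z = l k (Θ (σ p)))
    (hgen : ∀ k b, ∃ N p, σ (g k) ^ N * b - σ p ∈ I) :
    Function.Surjective Θ ∧ RingHom.ker Θ = I := by
  constructor
  -- The elements whose multiple of `v` lies in the image form an ideal.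
  · intro v
    let K : Ideal M :=
      { carrier := {m | ∃ m', Θ m' = Θ m * v}
        add_mem' := by
          rintro a b ⟨a', ha⟩ ⟨b', hb⟩
          exact ⟨a' + b', by rw [map_add, map_add, ha, hb, add_mul]⟩
        zero_mem' := ⟨0, by simp⟩
        smul_mem' := by
          rintro c a ⟨a', ha⟩
          exact ⟨c * a', by rw [map_mul, smul_eq_mul, map_mul, ha, mul_assoc]⟩ }
    have hK : K = ⊤ := by
      refine eq_top_of_pow_mem (fun k => σ (g k)) hg (fun m hm => ⟨0, ?_⟩) fun k => ?_
      · rw [show Θ m = 0 from hI hm, zero_mul, map_zero]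
      · obtain ⟨N, p, h⟩ := hsurj k (l k v)
        obtain ⟨N', h'⟩ := hl k (Θ (σ (g k)) ^ N * v - Θ (σ p)) (by
          rw [map_sub, map_mul, map_pow, h, sub_self])
        refine ⟨N' + N, σ (g k) ^ N' * σ p, ?_⟩
        rw [mul_sub, sub_eq_zero] at h'
        rw [map_mul, map_pow, ← h', map_pow, pow_add, mul_assoc]
    obtain ⟨m, hm⟩ : (1 : M) ∈ K := hK ▸ trivial
    exact ⟨m, by simpa using hm⟩
  -- The elements that multiply `b` into `I` form an ideal.
  · refine le_antisymm (fun b hb => ?_) hI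
    let K : Ideal M :=
      { carrier := {m | m * b ∈ I}
        add_mem' := fun {x y} hx hy => by
          simpa only [Set.mem_ofPred_eq, add_mul] using add_mem hx hy
        zero_mem' := by simp
        smul_mem' := fun c x hx => by
          simpa only [Set.mem_ofPred_eq, smul_eq_mul, mul_assoc] using I.mul_mem_left c hx }
    have hK : K = ⊤ := by
      refine eq_top_of_pow_mem (fun k => σ (g k)) hg (fun m hm => I.mul_mem_right _ hm) fun k => ?_
      obtain ⟨N, p, h⟩ := hgen k b
      have h0 : l k (Θ (σ p)) = 0 := by
        have := congrArg (l k) (show Θ _ = 0 from hI h)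
        rw [map_sub, map_mul, (show Θ b = 0 from hb), mul_zero, zero_sub, map_neg, map_zero,
          neg_eq_zero] at this
        exact this
      obtain ⟨N', h'⟩ := hinj k p h0
      refine ⟨N' + N, ?_⟩
      have h1 : σ (g k) ^ N' * σ p ∈ I := by simpa using hJ _ h'
      have h2 := add_mem (I.mul_mem_left (σ (g k) ^ N') h) h1
      rw [mul_sub, sub_add_cancel, ← mul_assoc, ← pow_add] at h2
      exact h2
    have : (1 : M) ∈ K := hK ▸ trivial
    simpa [K] using this

end LocalCriterion

/-! ### Factorisations of the equation, and the elimination of `w` -/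

section Homogeneous

theorem aeval_mem_of_isHomogeneous {K A σ : Type*} [CommRing K] [CommRing A] [Algebra K A]
    (𝒜 : ℕ → Submodule K A) [GradedAlgebra 𝒜] {v : σ → A} (hv : ∀ i, v i ∈ 𝒜 1) {d : ℕ}
    {q : MvPolynomial σ K} (hq : q.IsHomogeneous d) : MvPolynomial.aeval v q ∈ 𝒜 d := by
  rw [MvPolynomial.aeval_def, MvPolynomial.eval₂_eq]
  refine sum_mem fun e he => ?_
  rw [← Algebra.smul_def]
  refine Submodule.smul_mem _ _ ?_
  have h := SetLike.prod_pow_mem_graded 𝒜 (fun _ => 1) v (F := e.support) e (fun i _ => hv i)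
  have h2 : ∑ i ∈ e.support, e i • 1 = d := by
    have := hq (MvPolynomial.mem_support_iff.mp he)
    rw [Finsupp.weight_apply, Finsupp.sum] at this
    simpa using this
  rwa [h2] at h

end Homogeneous

/-- The inclusion of `ℚ[x, y, z]` in `ℚ[x, y, z, w]`. -/
def inclXYZ : MvPolynomial (Fin 3) ℚ →ₐ[ℚ] MvPolynomial (Fin 4) ℚ := MvPolynomial.aeval ![x, y, z]

theorem w_mem : w ∈ weightedGrading 2 := MvPolynomial.isWeightedHomogeneous_X ℚ weights 3

theorem X_castSucc_mem (l : Fin 3) : MvPolynomial.X l.castSucc ∈ weightedGrading 1 := by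
  have := MvPolynomial.isWeightedHomogeneous_X ℚ weights l.castSucc
  fin_cases l <;> exact this

theorem inclXYZ_X (l : Fin 3) : inclXYZ (MvPolynomial.X l) = MvPolynomial.X l.castSucc := by
  rw [inclXYZ, MvPolynomial.aeval_X]
  fin_cases l <;> rfl

theorem inclXYZ_mem {d : ℕ} {q : MvPolynomial (Fin 3) ℚ} (hq : q.IsHomogeneous d) :
    inclXYZ q ∈ weightedGrading d :=
  aeval_mem_of_isHomogeneous _ (fun l => by
    have := X_castSucc_mem l
    fin_cases l <;> exact this) hq

/-- Quadratic forms `a`, `b`, `c` in `x, y, z` with `b² - ac = x⁴ + y⁴ - nz⁴`, without common zero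
(stated as: powers of the variables lie in the ideal they generate), and a sign `e`. These are the
data of a factorisation `(ew - b)(ew + b) = -ac` of the equation of `X_n`. -/
structure Factorisation (n : ℚ) where
  (a b c : MvPolynomial (Fin 3) ℚ)
  e : ℚ
  ha : a.IsHomogeneous 2
  hb : b.IsHomogeneous 2
  hc : c.IsHomogeneous 2
  he : e * e = 1
  disc : b ^ 2 - a * c = .X 0 ^ 4 + .X 1 ^ 4 - .C n * .X 2 ^ 4
  noZero : ∀ l, ∃ N, MvPolynomial.X l ^ N ∈ Ideal.span {a, b, c}

namespace Factorisation

variable {n : ℚ} (D : Factorisation n)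

/-- The square root `ew` of `b² - ac`. -/
def root : MvPolynomial (Fin 4) ℚ := .C D.e * w

/-- The two descriptions `(-c : b + ew) = (ew - b : a)` of the map to `ℙ¹`. -/
def tuple : Fin 2 → Fin 2 → MvPolynomial (Fin 4) ℚ :=
  ![![-inclXYZ D.c, inclXYZ D.b + D.root], ![D.root - inclXYZ D.b, inclXYZ D.a]]

/-- The inclusion of `ℚ[x, y, z]` in `ℚ[s, t][x₀, x₁, x₂]`. -/
def inclBi : MvPolynomial (Fin 3) ℚ →+* MvPolynomial (Fin 3) (MvPolynomial (Fin 2) ℚ) :=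
  MvPolynomial.map MvPolynomial.C

/-- The form `a s² + 2 b s t + c t²`. -/
def form : MvPolynomial (Fin 3) (MvPolynomial (Fin 2) ℚ) :=
  inclBi D.a * coef (s ^ 2) + 2 * inclBi D.b * coef (s * t) + inclBi D.c * coef (t ^ 2)

/-- The products `rs` and `rt`, where `r` is the square root of `b² - ac` on the surface
`form = 0`. -/
def rootBi : Fin 2 → MvPolynomial (Fin 3) (MvPolynomial (Fin 2) ℚ) :=
  ![-(inclBi D.c * coef t + inclBi D.b * coef s), inclBi D.a * coef s + inclBi D.b * coef t]

/-- The substitution that eliminates `w` on the chart `t_i = 1`. -/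
def elim (i : Fin 2) :
    MvPolynomial (Fin 4) ℚ →+* MvPolynomial (Fin 3) (MvPolynomial (Fin 2) ℚ) :=
  (MvPolynomial.aeval ![x₀, x₁, x₂, .C (.C D.e) * D.rootBi i]).toRingHom

/-- The ideal of the surface `form = 0` in the chart `t_i = x_j = 1`. -/
def chartIdeal (i : Fin 2) (j : Fin 3) : Ideal (MvPolynomial (Fin 3) (MvPolynomial (Fin 2) ℚ)) :=
  Ideal.span {D.form, coef (.X i) - 1, .X j - 1}

theorem elim_C (i : Fin 2) (q : ℚ) : D.elim i (.C q) = .C (.C q) := by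
  simp [elim, MvPolynomial.algebraMap_eq, IsScalarTower.algebraMap_apply ℚ (MvPolynomial (Fin 2) ℚ)]

theorem elim_inclXYZ (i : Fin 2) (q : MvPolynomial (Fin 3) ℚ) :
    D.elim i (inclXYZ q) = inclBi q := by
  induction q using MvPolynomial.induction_on with
  | C c =>
    rw [← MvPolynomial.algebraMap_eq, AlgHom.commutes, MvPolynomial.algebraMap_eq, elim_C]
    simp [inclBi]
  | add p q hp hq => rw [map_add, map_add, hp, hq, map_add]
  | mul_X p l hp =>
    rw [map_mul, map_mul, hp, inclXYZ_X, map_mul]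
    congr 1
    rw [inclBi, MvPolynomial.map_X]
    fin_cases l <;> simp [elim]

theorem elim_root (i : Fin 2) : D.elim i D.root = D.rootBi i := by
  have h : D.elim i w = .C (.C D.e) * D.rootBi i := by simp [elim]
  rw [root, map_mul, h, elim_C, ← mul_assoc, ← MvPolynomial.C_mul, ← MvPolynomial.C_mul, D.he]
  simp

/-- The equation of `X_n` is `b² - ac - (ew)²`. -/
theorem equation_eq : x ^ 4 + y ^ 4 - MvPolynomial.C n * z ^ 4 - w ^ 2 =
    inclXYZ D.b ^ 2 - inclXYZ D.a * inclXYZ D.c - D.root ^ 2 := by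
  rw [← map_pow, ← map_mul, ← map_sub, D.disc, root, mul_pow, ← MvPolynomial.C_pow, sq D.e, D.he]
  simp only [map_sub, map_add, map_mul, map_pow, inclXYZ_X]
  have h : inclXYZ (.C n) = .C n := inclXYZ.commutes n
  rw [h, MvPolynomial.C_1, one_mul]
  rfl

theorem form_mem (i j) : D.form ∈ D.chartIdeal i j := Ideal.subset_span (by simp)

theorem coef_mem (i j) : coef (.X i) - 1 ∈ D.chartIdeal i j := Ideal.subset_span (by simp)

theorem X_mem (i j) : .X j - 1 ∈ D.chartIdeal i j := Ideal.subset_span (by simp)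

/-- Eliminating `w` turns the equation of `X_n` into a multiple of the form, on the chart
`t_i = 1`. -/
theorem elim_equation_mem (i j) :
    D.elim i (x ^ 4 + y ^ 4 - MvPolynomial.C n * z ^ 4 - w ^ 2) ∈ D.chartIdeal i j := by
  rw [D.equation_eq]
  simp only [map_sub, map_mul, map_pow, elim_inclXYZ, elim_root]
  have h1 := D.form_mem i j
  have h2 := D.coef_mem i j
  rw [← Ideal.Quotient.eq_zero_iff_mem] at h1 h2 ⊢
  obtain rfl | rfl : i = 0 ∨ i = 1 := by omega
  all_goals
    simp only [form, rootBi, Matrix.cons_val_zero, Matrix.cons_val_one, map_sub, map_neg, map_add,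
      map_mul, map_pow, map_ofNat, map_one] at h1 h2 ⊢
    generalize Ideal.Quotient.mk (D.chartIdeal _ j) = q at *
  · linear_combination -q (inclBi D.c) * h1 -
      (q (inclBi D.b) ^ 2 - q (inclBi D.a) * q (inclBi D.c)) * (q (coef s) + 1) * h2
  · linear_combination -q (inclBi D.a) * h1 -
      (q (inclBi D.b) ^ 2 - q (inclBi D.a) * q (inclBi D.c)) * (q (coef t) + 1) * h2

/-- After the elimination of `w`, each of the two pairs is proportional to `(s : t)`. -/
theorem elim_tuple_mul (i j) (k l : Fin 2) :
    D.elim i (D.tuple k i) * coef (.X l) - D.elim i (D.tuple k l) ∈ D.chartIdeal i j := by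
  have h1 := D.form_mem i j
  have h2 := D.coef_mem i j
  rw [← Ideal.Quotient.eq_zero_iff_mem] at h1 h2 ⊢
  obtain rfl | hl := eq_or_ne l i
  · simp only [map_sub, map_mul, map_one] at h2 ⊢
    generalize Ideal.Quotient.mk (D.chartIdeal _ j) = q at *
    linear_combination q (D.elim l (D.tuple k l)) * h2
  obtain ⟨rfl, rfl⟩ | ⟨rfl, rfl⟩ : i = 0 ∧ l = 1 ∨ i = 1 ∧ l = 0 := by omega
  all_goals
    obtain rfl | rfl : k = 0 ∨ k = 1 := by omega
  all_goals
    simp only [form, tuple, Matrix.cons_val_zero, Matrix.cons_val_one, elim_inclXYZ, elim_root,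
      rootBi, map_sub, map_neg, map_add, map_mul, map_pow, map_ofNat, map_one] at h1 h2 ⊢
    generalize Ideal.Quotient.mk (D.chartIdeal _ j) = q at *
  · linear_combination q (inclBi D.b) * h2
  · linear_combination -h1 + (q (inclBi D.a) * (q (coef s) + 1) + q (inclBi D.b) * q (coef t)) * h2
  · linear_combination h1 - (q (inclBi D.b) * q (coef s) + q (inclBi D.c) * (q (coef t) + 1)) * h2
  · linear_combination -q (inclBi D.b) * h2

/-- On each chart, the `t_i` entries of the two pairs have no common zero on `form = 0`: there `a`,
`b` and `c` would all vanish. -/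
theorem sup_span_elim_tuple (i j) :
    D.chartIdeal i j ⊔ Ideal.span (Set.range fun k => D.elim i (D.tuple k i)) = ⊤ := by
  obtain ⟨T, hT⟩ : ∃ T, T = D.chartIdeal i j ⊔
    Ideal.span (Set.range fun k => D.elim i (D.tuple k i)) := ⟨_, rfl⟩
  have h1 : D.form ∈ T := hT ▸ le_sup_left (a := D.chartIdeal i j) (D.form_mem i j)
  have h2 : coef (.X i) - 1 ∈ T := hT ▸ le_sup_left (a := D.chartIdeal i j) (D.coef_mem i j)
  have h3 : .X j - 1 ∈ T := hT ▸ le_sup_left (a := D.chartIdeal i j) (D.X_mem i j)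
  have h4 (k) : D.elim i (D.tuple k i) ∈ T :=
    hT ▸ le_sup_right (a := D.chartIdeal i j) (Ideal.subset_span ⟨k, rfl⟩)
  have h5 := h4 1
  replace h4 := h4 0
  rw [← hT]
  clear hT
  rw [← Ideal.Quotient.eq_zero_iff_mem] at h1 h2 h3 h4 h5
  have h2' : (2 : MvPolynomial (Fin 3) (MvPolynomial (Fin 2) ℚ) ⧸ T) *
      Ideal.Quotient.mk T (.C (.C (1 / 2))) = 1 := by
    rw [← map_one (Ideal.Quotient.mk T), ← map_ofNat (Ideal.Quotient.mk T) 2,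
      ← map_ofNat MvPolynomial.C 2, ← map_ofNat MvPolynomial.C 2,
      ← map_mul, ← MvPolynomial.C_mul, ← MvPolynomial.C_mul]
    norm_num
  have key : Ideal.Quotient.mk T (inclBi D.a) = 0 ∧ Ideal.Quotient.mk T (inclBi D.b) = 0 ∧
      Ideal.Quotient.mk T (inclBi D.c) = 0 := by
    obtain rfl | rfl : i = 0 ∨ i = 1 := by omega
    all_goals
      simp only [form, tuple, Matrix.cons_val_zero, Matrix.cons_val_one, elim_inclXYZ, elim_root,
        rootBi, map_sub, map_neg, map_add, map_mul, map_pow, map_ofNat, map_one] at h1 h2 h4 h5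
      generalize Ideal.Quotient.mk T (inclBi D.a) = a at *
      generalize Ideal.Quotient.mk T (inclBi D.b) = b at *
      generalize Ideal.Quotient.mk T (inclBi D.c) = c at *
      generalize Ideal.Quotient.mk T (coef s) = s at *
      generalize Ideal.Quotient.mk T (coef t) = t at *
      generalize Ideal.Quotient.mk T (.C (.C (1 / 2))) = u at *
    · obtain rfl : c = 0 := by linear_combination -h4
      obtain rfl : s = 1 := by linear_combination h2
      obtain rfl : b = 0 := by linear_combination -u * h5 - b * h2'
      exact ⟨by linear_combination h1, rfl, rfl⟩
    · obtain rfl : a = 0 := h5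
      obtain rfl : t = 1 := by linear_combination h2
      obtain rfl : b = 0 := by linear_combination u * h4 - b * h2'
      exact ⟨rfl, rfl, by linear_combination h1⟩
  obtain ⟨N, hN⟩ := D.noZero j
  have h6 : Ideal.span {D.a, D.b, D.c} ≤ RingHom.ker ((Ideal.Quotient.mk T).comp inclBi) := by
    rw [Ideal.span_le]
    rintro _ (rfl | rfl | rfl)
    exacts [key.1, key.2.1, key.2.2]
  have h7 : Ideal.Quotient.mk T (.X j) ^ N = 0 := by
    have := h6 hN
    rwa [RingHom.mem_ker, RingHom.comp_apply, map_pow, map_pow, inclBi, MvPolynomial.map_X] at this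
  rw [map_sub, map_one, sub_eq_zero] at h3
  rw [h3, one_pow] at h7
  exact (Ideal.eq_top_iff_one _).mpr (Ideal.Quotient.eq_zero_iff_mem.mp ((map_one _).trans h7))

end Factorisation

/-! ### The morphisms to `ℙ¹` and `ℙ²`, and their product -/

section BasicOpen

variable {X : Scheme.{u}} {U O : X.Opens}

theorem exists_pow_mul_eq_zero (hU : IsAffineOpen U) (h : O ≤ U) (f : Γ(X, U))
    (hO : O = X.basicOpen f) {a : Γ(X, U)} (ha : (X.presheaf.map (homOfLE h).op).hom a = 0) :
    ∃ N, f ^ N * a = 0 := by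
  let := (X.presheaf.map (homOfLE h).op).hom.toAlgebra
  have := hU.isLocalization_of_eq_basicOpen f (homOfLE h) hO
  obtain ⟨⟨_, N, rfl⟩, hN⟩ :=
    (IsLocalization.map_eq_zero_iff (Submonoid.powers f) Γ(X, O) a).mp ha
  exact ⟨N, hN⟩

theorem exists_pow_mul_eq_map (hU : IsAffineOpen U) (h : O ≤ U) (f : Γ(X, U))
    (hO : O = X.basicOpen f) (z : Γ(X, O)) :
    ∃ (N : ℕ) (a : Γ(X, U)), (X.presheaf.map (homOfLE h).op).hom f ^ N * z =
      (X.presheaf.map (homOfLE h).op).hom a := by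
  let := (X.presheaf.map (homOfLE h).op).hom.toAlgebra
  have := hU.isLocalization_of_eq_basicOpen f (homOfLE h) hO
  obtain ⟨⟨a, _, N, rfl⟩, hN⟩ := IsLocalization.surj (Submonoid.powers f) z
  exact ⟨N, a, by rw [mul_comm, ← map_pow]; exact hN⟩

theorem isUnit_map_of_eq_basicOpen (h : O ≤ U) (f : Γ(X, U)) (hO : O = X.basicOpen f) :
    IsUnit ((X.presheaf.map (homOfLE h).op).hom f) := by
  subst hO
  exact RingedSpace.isUnit_res_basicOpen X.toRingedSpace f

end BasicOpen

/-- Ring homomorphisms agree on rational constants. -/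
theorem hom_C_rat {σ τ R : Type*} [Semiring R] (f : MvPolynomial σ ℚ →+* R)
    (g : MvPolynomial τ ℚ →+* R) (c : ℚ) : f (.C c) = g (.C c) :=
  RingHom.congr_fun (Subsingleton.elim (f.comp MvPolynomial.C) (g.comp MvPolynomial.C)) c

section Surface

variable {n : ℚ}

/-- The class of a polynomial in the homogeneous coordinate ring. -/
abbrev cl (n : ℚ) : MvPolynomial (Fin 4) ℚ →+* CoordRing n := Ideal.Quotient.mk (surfaceIdeal n)

theorem cl_mem {d : ℕ} {q : MvPolynomial (Fin 4) ℚ} (hq : q ∈ weightedGrading d) :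
    cl n q ∈ surfaceGrading n d := ⟨q, hq, rfl⟩

theorem cl_X_mem (l : Fin 3) : cl n (.X l.castSucc) ∈ surfaceGrading n 1 :=
  cl_mem (X_castSucc_mem l)

theorem adjoin_cl_X : Algebra.adjoin ℚ (Set.range fun i => cl n (.X i)) = ⊤ := by
  have h : (Set.range fun i => cl n (.X i)) =
      Ideal.Quotient.mkₐ ℚ (surfaceIdeal n) '' Set.range MvPolynomial.X := by
    rw [← Set.range_comp]; rfl
  rw [h, Algebra.adjoin_image, MvPolynomial.adjoin_range_X, Algebra.map_top,
    AlgHom.range_eq_top]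
  exact Ideal.Quotient.mk_surjective

/-- If `x`, `y`, `z` vanish at a point of the surface, then so does `w`: the opens where one of
`x`, `y`, `z` does not vanish cover it. -/
theorem iSup_basicOpen_cl_X :
    ⨆ l : Fin 3, Proj.basicOpen (surfaceGrading n) (cl n (.X l.castSucc)) = ⊤ := by
  have h := iSup_basicOpen_eq_top_of_adjoin (surfaceGrading n) (fun i => cl n (.X i)) (fun i =>
    ⟨weights i, cl_mem (MvPolynomial.isWeightedHomogeneous_X ℚ weights i)⟩) adjoin_cl_X
  rw [eq_top_iff, ← h]
  intro p hp
  obtain ⟨i, hi⟩ := TopologicalSpace.Opens.mem_iSup.mp hp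
  by_contra hx
  simp only [TopologicalSpace.Opens.mem_iSup, not_exists, mem_projBasicOpen, not_not] at hx
  apply hi
  have heq : cl n w ^ 2 = cl n x ^ 4 + cl n y ^ 4 - cl n (.C n) * cl n z ^ 4 := by
    have := Ideal.Quotient.eq_zero_iff_mem.mpr (Ideal.mem_span_singleton_self
      (x ^ 4 + y ^ 4 - MvPolynomial.C n * z ^ 4 - w ^ 2))
    simp only [map_sub, map_add, map_mul, map_pow] at this
    exact (sub_eq_zero.mp this).symm
  have hw : cl n w ∈ idealAt (surfaceGrading n) p := by
    refine Ideal.IsPrime.mem_of_pow_mem inferInstance 2 (heq ▸ ?_)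
    refine sub_mem (add_mem ?_ ?_) (Ideal.mul_mem_left _ _ ?_)
    exacts [Ideal.pow_mem_of_mem _ (hx 0) 4 (by norm_num),
      Ideal.pow_mem_of_mem _ (hx 1) 4 (by norm_num), Ideal.pow_mem_of_mem _ (hx 2) 4 (by norm_num)]
  change cl n (.X i) ∈ idealAt (surfaceGrading n) p
  fin_cases i
  exacts [hx 0, hx 1, hx 2, hw]

end Surface

namespace Factorisation

variable {n : ℚ} (D : Factorisation n)

theorem root_mem : D.root ∈ weightedGrading 2 := by
  rw [root, MvPolynomial.C_mul']
  exact Submodule.smul_mem _ _ w_mem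

theorem tuple_mem_weighted (k l : Fin 2) : D.tuple k l ∈ weightedGrading 2 := by
  have ha := inclXYZ_mem D.ha
  have hb := inclXYZ_mem D.hb
  have hc := inclXYZ_mem D.hc
  fin_cases k <;> fin_cases l
  exacts [neg_mem hc, add_mem hb D.root_mem, sub_mem D.root_mem hb, ha]

theorem tuple_mem (k l : Fin 2) : cl n (D.tuple k l) ∈ surfaceGrading n 2 :=
  cl_mem (D.tuple_mem_weighted k l)

theorem cl_root_sq : cl n D.root ^ 2 =
    cl n (inclXYZ D.b) ^ 2 - cl n (inclXYZ D.a) * cl n (inclXYZ D.c) := by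
  have := (congrArg (cl n) D.equation_eq).symm.trans
    (Ideal.Quotient.eq_zero_iff_mem.mpr (Ideal.mem_span_singleton_self _))
  simp only [map_sub, map_mul, map_pow] at this
  exact (sub_eq_zero.mp this).symm

/-- The two pairs are proportional on the surface. -/
theorem tuple_compat (k k' l l' : Fin 2) : cl n (D.tuple k l) * cl n (D.tuple k' l') =
    cl n (D.tuple k l') * cl n (D.tuple k' l) := by
  have h := D.cl_root_sq
  fin_cases k <;> fin_cases k' <;> fin_cases l <;> fin_cases l' <;>
    simp only [tuple, Fin.zero_eta, Fin.mk_one, Matrix.cons_val_zero, Matrix.cons_val_one,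
      map_neg, map_sub, map_add] <;> first | ring1 | linear_combination h | linear_combination -h

/-- The two pairs have no common zero on the surface. -/
theorem iSup_tuple : ⨆ k, ⨆ l, Proj.basicOpen (surfaceGrading n) (cl n (D.tuple k l)) = ⊤ := by
  refine eq_top_iff.mpr fun p hp => ?_
  rw [← iSup_basicOpen_cl_X] at hp
  obtain ⟨l, hl⟩ := TopologicalSpace.Opens.mem_iSup.mp hp
  by_contra hx
  simp only [TopologicalSpace.Opens.mem_iSup, not_exists, mem_projBasicOpen, not_not] at hx
  apply hl
  set I := idealAt (surfaceGrading n) p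
  have h00 := hx 0 0
  have h01 := hx 0 1
  have h10 := hx 1 0
  have ha := hx 1 1
  simp only [tuple, Matrix.cons_val_zero, Matrix.cons_val_one, map_neg, map_sub, map_add,
    neg_mem_iff] at h00 h01 h10 ha
  have hb : cl n (inclXYZ D.b) ∈ I := by
    have h2 : cl n (.C (1 / 2)) * 2 = 1 := by
      rw [← map_ofNat (cl n) 2, ← map_ofNat MvPolynomial.C 2, ← map_mul, ← MvPolynomial.C_mul]
      norm_num
    have := I.mul_mem_left (cl n (.C (1 / 2))) (sub_mem h01 h10)
    convert this using 1
    linear_combination -cl n (inclXYZ D.b) * h2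
  obtain ⟨N, hN⟩ := D.noZero l
  have h6 : Ideal.span {D.a, D.b, D.c} ≤ I.comap ((cl n).comp inclXYZ.toRingHom) := by
    rw [Ideal.span_le]
    rintro _ (rfl | rfl | rfl)
    exacts [ha, hb, h00]
  have h7 := h6 hN
  rw [Ideal.mem_comap, map_pow] at h7
  have h8 := Ideal.IsPrime.mem_of_pow_mem (I := I) inferInstance N h7
  change cl n (inclXYZ (.X l)) ∈ I at h8
  rwa [inclXYZ_X] at h8

/-- After multiplication by a power of the `t_i` entry of a pair, every polynomial on the chart
comes from one in `x, y, z, w`: the entry times `t_l` is the other entry. -/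
theorem exists_pow_elim_mul (i : Fin 2) (j : Fin 3) (k : Fin 2)
    (b : MvPolynomial (Fin 3) (MvPolynomial (Fin 2) ℚ)) :
    ∃ (N : ℕ) (p : MvPolynomial (Fin 4) ℚ),
      D.elim i (D.tuple k i) ^ N * b - D.elim i p ∈ D.chartIdeal i j := by
  set g := D.elim i (D.tuple k i) with hg
  have hadd (b b') (h : ∃ N p, g ^ N * b - D.elim i p ∈ D.chartIdeal i j)
      (h' : ∃ N p, g ^ N * b' - D.elim i p ∈ D.chartIdeal i j) :
      ∃ N p, g ^ N * (b + b') - D.elim i p ∈ D.chartIdeal i j := by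
    obtain ⟨N, p, h⟩ := h
    obtain ⟨N', p', h'⟩ := h'
    refine ⟨N + N', D.tuple k i ^ N' * p + D.tuple k i ^ N * p', ?_⟩
    convert add_mem (Ideal.mul_mem_left _ (g ^ N') h) (Ideal.mul_mem_left _ (g ^ N) h') using 1
    rw [map_add, map_mul, map_mul, map_pow, map_pow, ← hg]
    ring
  induction b using MvPolynomial.induction_on with
  | C q =>
    induction q using MvPolynomial.induction_on with
    | C c => exact ⟨0, .C c, by simp [elim_C]⟩
    | add q q' h h' => rw [map_add]; exact hadd _ _ h h'
    | mul_X q l h =>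
      obtain ⟨N, p, h⟩ := h
      refine ⟨N + 1, p * D.tuple k l, ?_⟩
      convert add_mem (Ideal.mul_mem_left _ (g * coef (.X l)) h)
        (Ideal.mul_mem_left _ (D.elim i p) (D.elim_tuple_mul i j k l)) using 1
      rw [map_mul, map_mul, ← hg]
      ring
  | add b b' h h' => exact hadd _ _ h h'
  | mul_X b l h =>
    obtain ⟨N, p, h⟩ := h
    refine ⟨N, p * .X l.castSucc, ?_⟩
    have hX : D.elim i (.X l.castSucc) = .X l := by
      rw [← inclXYZ_X, elim_inclXYZ, inclBi, MvPolynomial.map_X]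
    convert Ideal.mul_mem_left _ (.X l) h using 1
    rw [map_mul, hX]
    ring

/-- The morphism `π` is given by the two tuples of `D`. -/
def IsPi (π : Surface n ⟶ ProjSpace ℚ 1) : Prop :=
  ∀ k i, MapsBy π (Proj.basicOpen (surfaceGrading n) (cl n (D.tuple k i))) i
    fun l => ratio (surfaceGrading n) (D.tuple_mem k i) (D.tuple_mem k l)

theorem exists_isPi : ∃ π, D.IsPi π :=
  exists_mapsBy_ratio (surfaceGrading n) (fun k l => cl n (D.tuple k l)) (fun _ => 2)
    (fun _ => two_pos) D.tuple_mem D.tuple_compat D.iSup_tuple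

/-- The open `D₊(x_j)` of `X_n`. -/
abbrev openX (n : ℚ) (j : Fin 3) : (Surface n).Opens :=
  Proj.basicOpen (surfaceGrading n) (cl n (.X j.castSucc))

variable (n) in
/-- The morphism `φ` is given by `x, y, z`. -/
def IsPhi (φ : Surface n ⟶ ProjSpace ℚ 2) : Prop :=
  ∀ j : Fin 3, MapsBy (r := 2) φ (openX n j) j
    fun l : Fin 3 => ratio (surfaceGrading n) (cl_X_mem (n := n) j) (cl_X_mem (n := n) l)

variable (n) in
theorem exists_isPhi : ∃ φ, IsPhi n φ := by
  obtain ⟨φ, h⟩ := exists_mapsBy_ratio (surfaceGrading n)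
    (fun (_ : Unit) (l : Fin 3) => cl n (.X l.castSucc)) (fun _ => 1)
    (fun _ => one_pos) (fun _ => cl_X_mem) (fun _ _ _ _ => mul_comm _ _)
    (by rw [iSup_const, iSup_basicOpen_cl_X])
  exact ⟨φ, fun j => h () j⟩

/-- The open `D₊(x_j)`, intersected with the open where the `k`-th tuple maps to `t_i ≠ 0`. -/
abbrev piece (k i : Fin 2) (j : Fin 3) : (Surface n).Opens :=
  Proj.basicOpen (surfaceGrading n) (cl n (D.tuple k i)) ⊓ openX n j

/-- The restriction to `piece` of the dehomogenisation of a polynomial in `x, y, z, w`. -/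
def pieceHom (k i : Fin 2) (j : Fin 3) :
    MvPolynomial (Fin 4) ℚ →+* Γ(Surface n, D.piece k i j) :=
  (((Surface n).presheaf.map (homOfLE inf_le_right).op).hom.comp
    (dehom (surfaceGrading n) (cl_X_mem j))).comp (cl n)

theorem evalAt_pieceHom (k i : Fin 2) (j : Fin 3) {d : ℕ} {q : MvPolynomial (Fin 4) ℚ}
    (hq : q ∈ weightedGrading d) (p : Surface n) (hp : p ∈ D.piece k i j) :
    evalAt _ p hp (D.pieceHom k i j q) = Localization.mk (cl n q)
      ⟨cl n (.X j.castSucc) ^ d,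
        pow_mem (S := (idealAt (surfaceGrading n) p).primeCompl) hp.2 d⟩ := by
  refine (evalAt_map _ inf_le_right p hp _).trans ?_
  rw [dehom_of_mem _ _ (cl_mem hq), evalAt_frac]

section Chart

variable {π : Surface n ⟶ ProjSpace ℚ 1} {φ : Surface n ⟶ ProjSpace ℚ 2}
  {f : Surface n ⟶ P1P2 ℚ} (hπ : D.IsPi π) (hφ : IsPhi n φ) (h₁ : f ≫ pr₁ ℚ = π)
  (h₂ : f ≫ pr₂ ℚ = φ) (i : Fin 2) (j : Fin 3)

include hφ in
theorem preimage_chart_phi : φ ⁻¹ᵁ chart ℚ j = openX n j := by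
  have := preimage_chart_of_mapsBy (surfaceGrading n)
    (fun (_ : Unit) (l : Fin 3) => cl n (.X l.castSucc)) (fun _ => 1)
    (fun _ => cl_X_mem) (by rw [iSup_const, iSup_basicOpen_cl_X]) (fun _ j => hφ j) j
  rwa [iSup_const] at this

include hπ hφ h₁ h₂ in
theorem preimage_biChart : f ⁻¹ᵁ biChart ℚ i j = ⨆ k, D.piece k i j := by
  have h1 := preimage_chart_of_mapsBy (surfaceGrading n) (fun k l => cl n (D.tuple k l))
    (fun _ => 2) D.tuple_mem D.iSup_tuple hπ i
  rw [biChart, Scheme.Hom.preimage_inf, ← Scheme.Hom.comp_preimage, ← Scheme.Hom.comp_preimage,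
    h₁, h₂, h1, preimage_chart_phi hφ, iSup_inf_eq]

include hπ hφ h₁ h₂ in
theorem piece_le (k : Fin 2) : D.piece k i j ≤ f ⁻¹ᵁ biChart ℚ i j :=
  (le_iSup (fun k => D.piece k i j) k).trans (D.preimage_biChart hπ hφ h₁ h₂ i j).ge

include hπ h₁ in
/-- On a piece, the function `t_l / t_i` pulls back to the quotient of the entries of the pair. -/
theorem appLE_biDehom_coef_X (k l : Fin 2) (e : D.piece k i j ≤ f ⁻¹ᵁ biChart ℚ i j) :
    (f.appLE (biChart ℚ i j) (D.piece k i j) e).hom (biDehom ℚ i j (coef (.X l))) *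
      D.pieceHom k i j (D.tuple k i) = D.pieceHom k i j (D.tuple k l) := by
  have h : (f.appLE (biChart ℚ i j) (D.piece k i j) e).hom (biDehom ℚ i j (coef (.X l))) =
      (π.appLE (chart ℚ i) (D.piece k i j) (inf_le_left.trans (hπ k i).1)).hom (coord ℚ i l) := by
    subst h₁
    rw [biDehom, MvPolynomial.coe_eval₂Hom, MvPolynomial.eval₂_C, MvPolynomial.coe_eval₂Hom,
      MvPolynomial.eval₂_X]
    exact congrArg (fun z => z.hom (coord ℚ i l))
      (Scheme.Hom.appLE_comp_appLE f (pr₁ ℚ) _ (biChart ℚ i j) _ inf_le_left e)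
  obtain ⟨e', he'⟩ := (hπ k i).mono (V := D.piece k i j) inf_le_left
  rw [h, he' l]
  apply evalAt_ext
  intro p hp
  rw [map_mul, evalAt_map, evalAt_ratio, D.evalAt_pieceHom k i j (D.tuple_mem_weighted k i),
    D.evalAt_pieceHom k i j (D.tuple_mem_weighted k l), Localization.mk_mul,
    Localization.mk_eq_mk_iff, Localization.r_iff_exists]
  exact ⟨1, by simp; ring⟩

include hφ h₂ in
theorem appLE_biDehom_X (k : Fin 2) (l : Fin 3) (e : D.piece k i j ≤ f ⁻¹ᵁ biChart ℚ i j) :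
    (f.appLE (biChart ℚ i j) (D.piece k i j) e).hom (biDehom ℚ i j (.X l)) =
      D.pieceHom k i j (.X l.castSucc) := by
  have h : (f.appLE (biChart ℚ i j) (D.piece k i j) e).hom (biDehom ℚ i j (.X l)) =
      (φ.appLE (chart ℚ j) (D.piece k i j) (inf_le_right.trans (hφ j).1)).hom (coord ℚ j l) := by
    subst h₂
    rw [biDehom, MvPolynomial.coe_eval₂Hom, MvPolynomial.eval₂_X]
    exact congrArg (fun z => z.hom (coord ℚ j l))
      (Scheme.Hom.appLE_comp_appLE f (pr₂ ℚ) _ (biChart ℚ i j) _ inf_le_right e)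
  obtain ⟨e', he'⟩ := (hφ j).mono (V := D.piece k i j) inf_le_right
  rw [h, he' l]
  apply evalAt_ext
  intro p hp
  rw [evalAt_map, evalAt_ratio, D.evalAt_pieceHom k i j (X_castSucc_mem l)]
  congr 1
  exact Subtype.ext (pow_one _).symm

theorem isAffineOpen_openX : IsAffineOpen (openX n j) :=
  Proj.isAffineOpen_basicOpen _ _ (cl_X_mem j) one_pos

/-- The piece is a principal open of the affine surface `D₊(x_j)`. -/
theorem piece_eq_basicOpen (k : Fin 2) : D.piece k i j = (Surface n).basicOpen
    (dehom (surfaceGrading n) (cl_X_mem j) (cl n (D.tuple k i))) := by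
  rw [basicOpen_dehom _ _ (D.tuple_mem k i), inf_comm]

theorem isUnit_pieceHom_tuple (k : Fin 2) : IsUnit (D.pieceHom k i j (D.tuple k i)) :=
  isUnit_map_of_eq_basicOpen inf_le_right _ (D.piece_eq_basicOpen i j k)

theorem pieceHom_X_self (k : Fin 2) : D.pieceHom k i j (.X j.castSucc) = 1 := by
  have : cl n (.X j.castSucc) - 1 ∈ RingHom.ker (dehom (surfaceGrading n) (cl_X_mem j)) := by
    rw [ker_dehom]
    exact Ideal.mem_span_singleton_self _
  rw [RingHom.mem_ker, map_sub, map_one, sub_eq_zero] at this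
  exact (congrArg ((Surface n).presheaf.map (homOfLE inf_le_right).op).hom this).trans (map_one _)

theorem pieceHom_root_sq (k : Fin 2) : D.pieceHom k i j D.root ^ 2 =
    D.pieceHom k i j (inclXYZ D.b) ^ 2 -
      D.pieceHom k i j (inclXYZ D.a) * D.pieceHom k i j (inclXYZ D.c) := by
  have := congrArg (((Surface n).presheaf.map (homOfLE inf_le_right).op).hom.comp
    (dehom (surfaceGrading n) (cl_X_mem j)) : _ →+* Γ(Surface n, D.piece k i j)) D.cl_root_sq
  simp only [map_sub, map_mul, map_pow] at this
  exact this

include hφ h₂ in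
theorem appLE_biDehom_inclBi (k : Fin 2) (q : MvPolynomial (Fin 3) ℚ)
    (e : D.piece k i j ≤ f ⁻¹ᵁ biChart ℚ i j) :
    (f.appLE (biChart ℚ i j) (D.piece k i j) e).hom (biDehom ℚ i j (inclBi q)) =
      D.pieceHom k i j (inclXYZ q) := by
  have : ((f.appLE (biChart ℚ i j) (D.piece k i j) e).hom.comp (biDehom ℚ i j)).comp inclBi =
      (D.pieceHom k i j).comp inclXYZ.toRingHom := by
    apply MvPolynomial.ringHom_ext
    · intro c
      rw [RingHom.comp_apply, inclBi, MvPolynomial.map_C]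
      exact hom_C_rat (((f.appLE (biChart ℚ i j) (D.piece k i j) e).hom.comp
        (biDehom ℚ i j)).comp MvPolynomial.C) _ c
    · intro l
      have h1 : inclBi (.X l) = .X l := by rw [inclBi, MvPolynomial.map_X]
      have h2 : inclXYZ.toRingHom (.X l) = .X l.castSucc := inclXYZ_X l
      rw [RingHom.comp_apply, h1]
      refine Eq.trans ?_ (congrArg (D.pieceHom k i j) h2).symm
      exact D.appLE_biDehom_X hφ h₂ i j k l e
  exact RingHom.congr_fun this q

include hπ hφ h₁ h₂ in
/-- Eliminating `w` and then mapping to the piece is dehomogenisation. -/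
theorem appLE_biDehom_elim (k : Fin 2) (e : D.piece k i j ≤ f ⁻¹ᵁ biChart ℚ i j) :
    ((f.appLE (biChart ℚ i j) (D.piece k i j) e).hom.comp (biDehom ℚ i j)).comp (D.elim i) =
      D.pieceHom k i j := by
  have hroot : (f.appLE (biChart ℚ i j) (D.piece k i j) e).hom (biDehom ℚ i j (D.rootBi i)) =
      D.pieceHom k i j D.root := by
    -- Multiplied by the `t_i` entry of the pair, this becomes an identity on the surface.
    apply (D.isUnit_pieceHom_tuple i j k).mul_right_cancel
    have h0 := D.appLE_biDehom_coef_X hπ h₁ i j k 0 e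
    have h1 := D.appLE_biDehom_coef_X hπ h₁ i j k 1 e
    have hr := D.pieceHom_root_sq i j k
    have ha := D.appLE_biDehom_inclBi hφ h₂ i j k D.a e
    have hb := D.appLE_biDehom_inclBi hφ h₂ i j k D.b e
    have hc := D.appLE_biDehom_inclBi hφ h₂ i j k D.c e
    obtain rfl | rfl : i = 0 ∨ i = 1 := by omega
    all_goals
      simp only [rootBi, Matrix.cons_val_zero, Matrix.cons_val_one, map_neg, map_add, map_mul, ha,
        hb, hc]
    · trans -(D.pieceHom k 0 j (inclXYZ D.c) * D.pieceHom k 0 j (D.tuple k 1) +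
          D.pieceHom k 0 j (inclXYZ D.b) * D.pieceHom k 0 j (D.tuple k 0))
      · linear_combination -D.pieceHom k 0 j (inclXYZ D.c) * h1 -
          D.pieceHom k 0 j (inclXYZ D.b) * h0
      · obtain rfl | rfl : k = 0 ∨ k = 1 := by omega
        all_goals
          simp only [tuple, Matrix.cons_val_zero, Matrix.cons_val_one, map_neg, map_add, map_sub]
        · ring
        · linear_combination -hr
    · trans (D.pieceHom k 1 j (inclXYZ D.a) * D.pieceHom k 1 j (D.tuple k 0) +
          D.pieceHom k 1 j (inclXYZ D.b) * D.pieceHom k 1 j (D.tuple k 1))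
      · linear_combination D.pieceHom k 1 j (inclXYZ D.a) * h0 +
          D.pieceHom k 1 j (inclXYZ D.b) * h1
      · obtain rfl | rfl : k = 0 ∨ k = 1 := by omega
        all_goals
          simp only [tuple, Matrix.cons_val_zero, Matrix.cons_val_one, map_neg, map_add, map_sub]
        · linear_combination -hr
        · ring
  apply MvPolynomial.ringHom_ext
  · intro c
    exact hom_C_rat _ _ c
  · intro l
    induction l using Fin.lastCases with
    | cast l =>
      rw [← inclXYZ_X, RingHom.comp_apply, elim_inclXYZ]
      exact D.appLE_biDehom_inclBi hφ h₂ i j k _ e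
    | last =>
      have hw : MvPolynomial.X (Fin.last 3) = MvPolynomial.C D.e * D.root := by
        rw [root, ← mul_assoc, ← MvPolynomial.C_mul, D.he, MvPolynomial.C_1, one_mul]
        rfl
      rw [hw, map_mul, map_mul, RingHom.comp_apply _ _ D.root, elim_root]
      refine congrArg₂ (· * ·) ?_ hroot
      exact hom_C_rat _ _ D.e

include hπ hφ h₁ h₂ in
/-- The form `F` vanishes on the image of the surface. -/
theorem chartIdeal_le_ker (k : Fin 2) (e : D.piece k i j ≤ f ⁻¹ᵁ biChart ℚ i j) :
    D.chartIdeal i j ≤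
      RingHom.ker ((f.appLE (biChart ℚ i j) (D.piece k i j) e).hom.comp (biDehom ℚ i j)) := by
  rw [chartIdeal, Ideal.span_le]
  have hu := D.isUnit_pieceHom_tuple i j k
  rintro _ (rfl | rfl | rfl)
  · rw [SetLike.mem_coe, RingHom.mem_ker, RingHom.comp_apply]
    apply (hu.mul hu).mul_right_cancel
    have h0 := D.appLE_biDehom_coef_X hπ h₁ i j k 0 e
    have h1 := D.appLE_biDehom_coef_X hπ h₁ i j k 1 e
    have hr := D.pieceHom_root_sq i j k
    simp only [form, map_add, map_mul, map_pow, map_ofNat, D.appLE_biDehom_inclBi hφ h₂ i j k _ e]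
    trans D.pieceHom k i j (inclXYZ D.a) * D.pieceHom k i j (D.tuple k 0) ^ 2 +
      2 * D.pieceHom k i j (inclXYZ D.b) * (D.pieceHom k i j (D.tuple k 0) *
        D.pieceHom k i j (D.tuple k 1)) +
      D.pieceHom k i j (inclXYZ D.c) * D.pieceHom k i j (D.tuple k 1) ^ 2
    · rw [← h1, ← h0]; ring
    · obtain rfl | rfl : k = 0 ∨ k = 1 := by omega
      all_goals
        simp only [tuple, Matrix.cons_val_zero, Matrix.cons_val_one, map_neg, map_add, map_sub]
      · linear_combination D.pieceHom 0 i j (inclXYZ D.c) * hr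
      · linear_combination D.pieceHom 1 i j (inclXYZ D.a) * hr
  · rw [SetLike.mem_coe, RingHom.mem_ker, RingHom.comp_apply]
    apply hu.mul_right_cancel
    simp only [map_sub, map_one, sub_mul, zero_mul, D.appLE_biDehom_coef_X hπ h₁ i j k i e, one_mul,
      sub_self]
  · rw [SetLike.mem_coe, RingHom.mem_ker, RingHom.comp_apply]
    simp only [map_sub, map_one, D.appLE_biDehom_X hφ h₂ i j k j e, pieceHom_X_self, sub_self]

include hπ hφ h₁ h₂ in
/-- The preimage of a chart of `ℙ¹ × ℙ²` is affine, and its ring is the quotient of the polynomial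
ring by the ideal of `F = 0` in this chart. The preimage is covered by the two pieces; both
rings become the ring of the `k`-th piece once the `t_i` entry of the `k`-th pair is inverted. -/
theorem isAffineOpen_and_surjective_and_ker :
    IsAffineOpen (f ⁻¹ᵁ biChart ℚ i j) ∧
      Function.Surjective ((f.app (biChart ℚ i j)).hom.comp (biDehom ℚ i j)) ∧
      RingHom.ker ((f.app (biChart ℚ i j)).hom.comp (biDehom ℚ i j)) = D.chartIdeal i j := by
  have hle := D.piece_le hπ hφ h₁ h₂ i j
  have hV := D.preimage_biChart hπ hφ h₁ h₂ i j
  set V := f ⁻¹ᵁ biChart ℚ i j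
  set Θ := (f.app (biChart ℚ i j)).hom.comp (biDehom ℚ i j) with hΘ
  have hres (k) : ((Surface n).presheaf.map (homOfLE (hle k)).op).hom.comp Θ =
    (f.appLE (biChart ℚ i j) (D.piece k i j) (hle k)).hom.comp (biDehom ℚ i j) := rfl
  have helim (k) (q : MvPolynomial (Fin 4) ℚ) : ((Surface n).presheaf.map (homOfLE (hle k)).op).hom
      (Θ (D.elim i q)) = D.pieceHom k i j q :=
    RingHom.congr_fun (D.appLE_biDehom_elim hπ hφ h₁ h₂ i j k (hle k)) q
  have hI : D.chartIdeal i j ≤ RingHom.ker Θ := by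
    intro b hb
    rw [RingHom.mem_ker]
    apply evalAt_ext
    intro p hp
    obtain ⟨k, hk⟩ := TopologicalSpace.Opens.mem_iSup.mp (hV ▸ (show p ∈ V from hp))
    rw [← evalAt_map _ (hle k) p hk]
    have := D.chartIdeal_le_ker hπ hφ h₁ h₂ i j k (hle k) hb
    rw [RingHom.mem_ker, ← hres] at this
    refine (congrArg (evalAt _ p hk) this).trans ?_
    rw [map_zero, map_zero]
  have hspan := D.sup_span_elim_tuple i j
  have hbo (k) : (Surface n).basicOpen (Θ (D.elim i (D.tuple k i))) = D.piece k i j := by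
    ext p
    have key (k') (hp : p ∈ D.piece k' i j) :
        p ∈ (Surface n).basicOpen (Θ (D.elim i (D.tuple k i))) ↔ p ∈ D.piece k i j := by
      rw [mem_basicOpen_iff_isUnit_evalAt _ p (hle k' hp), ← evalAt_map _ (hle k') p hp]
      refine (iff_of_eq (congrArg (fun z => IsUnit (evalAt _ p hp z)) (helim k' _))).trans ?_
      rw [D.evalAt_pieceHom k' i j (D.tuple_mem_weighted k i), Localization.mk_eq_mk',
        IsLocalization.AtPrime.isUnit_mk'_iff _ (idealAt _ p)]
      exact ⟨fun h => ⟨h, hp.2⟩, fun h => h.1⟩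
    refine ⟨fun hp => ?_, fun hp => (key k hp).mpr hp⟩
    have hp' : p ∈ V := (Surface n).basicOpen_le _ hp
    rw [hV] at hp'
    obtain ⟨k', hk'⟩ := TopologicalSpace.Opens.mem_iSup.mp hp'
    exact (key k' hk').mp hp
  have haX : IsAffineOpen (openX n j) := isAffineOpen_openX j
  have hpb := D.piece_eq_basicOpen i j
  have hpiece (k) : IsAffineOpen (D.piece k i j) := hpb k ▸ haX.basicOpen _
  have haff : IsAffineOpen V := by
    refine isAffineOpen_of_isAffineOpen_basicOpen V (Set.range fun k => Θ (D.elim i (D.tuple k i)))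
      ?_ ?_
    · have := congrArg (Ideal.map Θ) hspan
      rw [Ideal.map_sup, Ideal.map_span, Ideal.map_top,
        (Ideal.map_eq_bot_iff_le_ker Θ).mpr hI, bot_sup_eq, ← Set.range_comp] at this
      exact this
    · rintro _ ⟨k, rfl⟩
      exact hbo k ▸ hpiece k
  refine ⟨haff, surjective_and_ker_eq Θ hI (D.elim i) (fun k => D.tuple k i) hspan
    (fun k => ((Surface n).presheaf.map (homOfLE (hle k)).op).hom) ?_
    (J := surfaceIdeal n ⊔ Ideal.span {.X j.castSucc - 1}) ?_ ?_ ?_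
    (fun k b => D.exists_pow_elim_mul i j k b)⟩
  · intro k v hv
    exact exists_pow_mul_eq_zero haff (hle k) _ (hbo k).symm hv
  · have hJ : surfaceIdeal n ⊔ Ideal.span {.X j.castSucc - 1} ≤
        (D.chartIdeal i j).comap (D.elim i) := by
      refine sup_le ?_ ?_ <;> rw [Ideal.span_singleton_le_iff_mem, Ideal.mem_comap]
      · exact D.elim_equation_mem i j
      · rw [map_sub, map_one, ← inclXYZ_X, elim_inclXYZ, inclBi, MvPolynomial.map_X]
        exact D.X_mem i j
    exact fun p hp => hJ hp
  · intro k p hp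
    rw [helim] at hp
    obtain ⟨N, hN⟩ := exists_pow_mul_eq_zero haX inf_le_right _ (hpb k) hp
    refine ⟨N, ?_⟩
    rw [← map_pow, ← map_mul, ← RingHom.mem_ker, ker_dehom, ← map_pow, ← map_mul] at hN
    rw [sup_comm, ← Ideal.mem_quotient_iff_mem_sup, Ideal.map_span, Set.image_singleton, map_sub,
      map_one]
    exact hN
  · intro k z
    obtain ⟨N, a', ha⟩ := exists_pow_mul_eq_map haX inf_le_right _ (hpb k) z
    obtain ⟨a, rfl⟩ := dehom_surjective (surfaceGrading n) (cl_X_mem j) a'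
    obtain ⟨p, rfl⟩ := Ideal.Quotient.mk_surjective a
    refine ⟨N, p, ?_⟩
    rw [helim, helim]
    exact ha

end Chart

end Factorisation

/-! ### The Jacobian criterion on charts -/

section StandardSmooth

/-- The affine scheme `G = 0`, `X_j = 1` is smooth of the expected dimension when `G` and its
partial derivatives other than `∂_j G` have no common zero with `X_j = 1`. -/
theorem locally_isStandardSmooth {K Γ : Type u} [CommRing K] [CommRing Γ] {σ : Type} [Fintype σ]
    (θ : MvPolynomial σ K →+* Γ) (hθ : Function.Surjective θ) (G : MvPolynomial σ K) (j : σ)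
    (hker : RingHom.ker θ = Ideal.span {G, .X j - 1})
    (hjac : Ideal.span {G, .X j - 1} ⊔
      Ideal.span ((fun k => MvPolynomial.pderiv k G) '' {k | k ≠ j}) = ⊤) :
    RingHom.Locally (RingHom.IsStandardSmoothOfRelativeDimension (Fintype.card σ - 2))
      (θ.comp MvPolynomial.C) := by
  classical
  refine ⟨θ '' ((fun k => MvPolynomial.pderiv k G) '' {k | k ≠ j}), ?_, ?_⟩
  · have := congrArg (Ideal.map θ) hjac
    rwa [Ideal.map_sup, (Ideal.map_eq_bot_iff_le_ker θ).mpr hker.ge, bot_sup_eq, Ideal.map_span,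
      Ideal.map_top] at this
  rintro _ ⟨_, ⟨k, hk, rfl⟩, rfl⟩
  let v : Fin 2 → MvPolynomial σ K := ![G, .X j - 1]
  have hv : Ideal.span (Set.range v) = RingHom.ker θ := by
    rw [hker, Matrix.range_cons_cons_empty]
  let a : Fin 2 → σ := ![k, j]
  have ha : Function.Injective a := by
    intro p q h
    fin_cases p <;> fin_cases q <;> simp_all [a]
  let := (θ.comp MvPolynomial.C).toAlgebra
  let θ' : MvPolynomial σ K →ₐ[K] Γ := { θ with commutes' := fun _ => rfl }
  let e : (MvPolynomial σ K ⧸ Ideal.span (Set.range v)) ≃ₐ[K] Γ :=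
    (Ideal.quotientEquivAlgOfEq K hv).trans (Ideal.quotientKerAlgEquivOfSurjective (f := θ') hθ)
  let P₀ := Algebra.PreSubmersivePresentation.naive (R := K) (v := v) a ha
  have hP₀ : P₀.jacobian = Ideal.Quotient.mk _ (MvPolynomial.pderiv k G) := by
    rw [Algebra.PreSubmersivePresentation.jacobian_eq_jacobiMatrix_det]
    have hdet : P₀.jacobiMatrix.det = MvPolynomial.pderiv k G := by
      rw [Matrix.det_fin_two]
      simp only [P₀, Algebra.PreSubmersivePresentation.jacobiMatrix_naive]
      have hk' : k ≠ j := hk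
      simp [v, a, MvPolynomial.pderiv_X, hk'.symm]
    rw [hdet]
    rfl
  let P := P₀.ofAlgEquiv e
  have hP : P.jacobian = θ (MvPolynomial.pderiv k G) := by
    rw [Algebra.PreSubmersivePresentation.jacobian_ofAlgEquiv, hP₀]
    rfl
  let T := Localization.Away (θ (MvPolynomial.pderiv k G))
  let Q := Algebra.PreSubmersivePresentation.localizationAway T (θ (MvPolynomial.pderiv k G))
  have hjac : IsUnit (Q.comp P).jacobian := by
    rw [Algebra.PreSubmersivePresentation.comp_jacobian_eq_jacobian_smul_jacobian, hP,
      Algebra.PreSubmersivePresentation.localizationAway_jacobian, Algebra.smul_def]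
    have := IsLocalization.Away.algebraMap_isUnit (S := T) (θ (MvPolynomial.pderiv k G))
    exact this.mul this
  have hdim : (Q.comp P).dimension = Fintype.card σ - 2 := by
    rw [Algebra.PreSubmersivePresentation.dimension_comp_eq_dimension_add_dimension]
    have : Q.dimension = 0 := Algebra.Presentation.localizationAway_dimension_zero _
    rw [this, zero_add]
    simp [Algebra.Presentation.dimension]
  have : Algebra.IsStandardSmoothOfRelativeDimension (Fintype.card σ - 2) K T :=
    Algebra.SubmersivePresentation.isStandardSmoothOfRelativeDimension
      { Q.comp P with jacobian_isUnit := hjac } hdim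
  exact (RingHom.isStandardSmoothOfRelativeDimension_algebraMap _).mpr this

end StandardSmooth

section Charts

variable {K : Type u} [CommRing K] {Y : Scheme.{u}} (y : Y ⟶ Spec (.of K))

theorem appLE_top_eq (U : Y.Opens) : (y.appLE ⊤ U le_top).hom =
    (scalars y U).comp (Scheme.ΓSpecIso (.of K)).commRingCatIsoToRingEquiv.toRingHom := by
  ext a
  refine congrArg (y.appLE ⊤ U le_top).hom ?_
  exact ((Scheme.ΓSpecIso (.of K)).commRingCatIsoToRingEquiv.symm_apply_apply a).symm

theorem smoothOfRelativeDimension_of_charts {d : ℕ} {ι : Type} (V : ι → Y.Opens)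
    (hV : ∀ i, IsAffineOpen (V i)) (hc : ⨆ i, V i = ⊤)
    (h : ∀ i, RingHom.Locally (RingHom.IsStandardSmoothOfRelativeDimension d) (scalars y (V i))) :
    SmoothOfRelativeDimension d y := by
  rw [HasRingHomProperty.iff_exists_appLE (P := @SmoothOfRelativeDimension d)
    (RingHom.locally_stableUnderCompositionWithLocalizationAwaySource
      (RingHom.isStandardSmoothOfRelativeDimension_stableUnderCompositionWithLocalizationAway
        d).left)]
  intro p
  have hp : p ∈ (⊤ : Y.Opens) := trivial
  rw [← hc] at hp
  obtain ⟨i, hi⟩ := TopologicalSpace.Opens.mem_iSup.mp hp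
  refine ⟨⟨⊤, isAffineOpen_top _⟩, ⟨V i, hV i⟩, hi, le_top, ?_⟩
  rw [appLE_top_eq]
  exact (RingHom.locally_respectsIso
    RingHom.isStandardSmoothOfRelativeDimension_respectsIso).2 _ _ (h i)

theorem smooth_scalars [Smooth y] {U : Y.Opens} (hU : IsAffineOpen U) :
    (scalars y U).Smooth := by
  have h := y.smooth_appLE (isAffineOpen_top _) hU le_top
  have := RingHom.Smooth.propertyIsLocal.respectsIso.2 _
    (Scheme.ΓSpecIso (.of K)).commRingCatIsoToRingEquiv.symm h
  exact this

end Charts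

/-! ### Quadratic forms in three variables -/

section QuadraticForm

variable {R : Type*} [CommRing R]

/-- The quadratic form `∑ M a b x_a x_b` of a matrix. -/
def quad (M : Matrix (Fin 3) (Fin 3) R) : MvPolynomial (Fin 3) R :=
  ∑ a, ∑ b, .C (M a b) * .X a * .X b

theorem quad_isHomogeneous (M : Matrix (Fin 3) (Fin 3) R) : (quad M).IsHomogeneous 2 := by
  refine MvPolynomial.IsHomogeneous.sum _ _ _ fun a _ =>
    MvPolynomial.IsHomogeneous.sum _ _ _ fun b _ => ?_
  exact ((MvPolynomial.isHomogeneous_C _ _).mul (MvPolynomial.isHomogeneous_X R a)).mul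
    (MvPolynomial.isHomogeneous_X R b)

theorem map_quad {S : Type*} [CommRing S] (f : R →+* S) (M : Matrix (Fin 3) (Fin 3) R) :
    MvPolynomial.map f (quad M) = quad (M.map f) := by
  simp [quad]

theorem coeff_quad (M : Matrix (Fin 3) (Fin 3) R) (i j : Fin 3) :
    (quad M).coeff (Finsupp.single i 1 + Finsupp.single j 1) =
      if i = j then M i i else M i j + M j i := by
  have h (a b : Fin 3) : (MvPolynomial.C (M a b) * .X a * .X b : MvPolynomial (Fin 3) R) =
      .monomial (Finsupp.single a 1 + Finsupp.single b 1) (M a b) := by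
    rw [MvPolynomial.X, MvPolynomial.X, MvPolynomial.C_mul_monomial, MvPolynomial.monomial_mul]
    simp
  have h2 (a b : Fin 3) : (Finsupp.single a 1 + Finsupp.single b 1 : Fin 3 →₀ ℕ) =
      Finsupp.single i 1 + Finsupp.single j 1 ↔ (a = i ∧ b = j) ∨ (a = j ∧ b = i) := by
    constructor
    · intro h
      have h0 := DFunLike.congr_fun h 0
      have h1 := DFunLike.congr_fun h 1
      have h2 := DFunLike.congr_fun h 2
      simp only [Finsupp.add_apply, Finsupp.single_apply] at h0 h1 h2
      clear h
      fin_cases a <;> fin_cases b <;> fin_cases i <;> fin_cases j <;> simp_all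
    · rintro (⟨rfl, rfl⟩ | ⟨rfl, rfl⟩)
      exacts [rfl, add_comm _ _]
  simp only [quad, h, MvPolynomial.coeff_sum, MvPolynomial.coeff_monomial, h2]
  fin_cases i <;> fin_cases j <;> simp [Fin.sum_univ_three] <;> exact add_comm _ _

theorem pderiv_quad {M : Matrix (Fin 3) (Fin 3) R} (hM : M.IsSymm) (k : Fin 3) :
    MvPolynomial.pderiv k (quad M) = 2 * ∑ b, .C (M k b) * .X b := by
  have h1 : M 1 0 = M 0 1 := hM.apply 0 1
  have h2 : M 2 0 = M 0 2 := hM.apply 0 2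
  have h3 : M 2 1 = M 1 2 := hM.apply 1 2
  fin_cases k <;>
  · simp [quad, Fin.sum_univ_three, MvPolynomial.pderiv_X, h1, h2, h3]
    ring

/-- A nondegenerate conic is smooth. By the Euler relation the remaining partial derivative
vanishes at a common zero as well, and then `adj(M) M = det M` gives `det M = 0` there. -/
theorem jacobian_quad {K : Type*} [Field K] [CharZero K] {M : Matrix (Fin 3) (Fin 3) K}
    (hM : M.IsSymm) (hdet : M.det ≠ 0) (j : Fin 3) :
    Ideal.span {quad M, .X j - 1} ⊔
      Ideal.span ((fun k => MvPolynomial.pderiv k (quad M)) '' {k | k ≠ j}) = ⊤ := by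
  set T := Ideal.span {quad M, .X j - 1} ⊔
    Ideal.span ((fun k => MvPolynomial.pderiv k (quad M)) '' {k | k ≠ j})
  have hq : quad M ∈ T := Ideal.mem_sup_left (Ideal.subset_span (by simp))
  have hX : .X j - 1 ∈ T := Ideal.mem_sup_left (Ideal.subset_span (by simp))
  let L (k : Fin 3) : MvPolynomial (Fin 3) K := ∑ b, .C (M k b) * .X b
  have hL' (k) (hk : k ≠ j) : L k ∈ T := by
    have h1 : MvPolynomial.pderiv k (quad M) ∈ T :=
      Ideal.mem_sup_right (Ideal.subset_span ⟨k, hk, rfl⟩)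
    rw [pderiv_quad hM] at h1
    have h2 := T.mul_mem_left (.C (1 / 2)) h1
    rwa [← mul_assoc, ← map_ofNat MvPolynomial.C 2, ← MvPolynomial.C_mul,
      one_div, inv_mul_cancel₀ two_ne_zero, MvPolynomial.C_1, one_mul] at h2
  have hquad : quad M = ∑ a, .X a * L a := by
    simp only [quad, L, Finset.mul_sum]
    exact Finset.sum_congr rfl fun a _ => Finset.sum_congr rfl fun b _ => by ring
  have hL (k) : L k ∈ T := by
    by_cases hk : k = j
    · subst hk
      have h1 : .X k * L k ∈ T := by
        rw [hquad, ← Finset.add_sum_erase _ _ (Finset.mem_univ k)] at hq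
        refine (Ideal.add_mem_iff_left _ ?_).mp hq
        exact sum_mem fun a ha => T.mul_mem_left _ (hL' a (Finset.ne_of_mem_erase ha))
      have h2 := sub_mem h1 (T.mul_mem_left (L k) hX)
      convert h2 using 1
      ring
    · exact hL' k hk
  have h1 : MvPolynomial.C M.det * .X j ∈ T := by
    let M' : Matrix (Fin 3) (Fin 3) (MvPolynomial (Fin 3) K) := M.map MvPolynomial.C
    have h2 : M'.adjugate.mulVec (M'.mulVec MvPolynomial.X) j = MvPolynomial.C M.det * .X j := by
      rw [Matrix.mulVec_mulVec, Matrix.adjugate_mul, Matrix.smul_mulVec, Matrix.one_mulVec,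
        Pi.smul_apply, smul_eq_mul]
      congr 1
      exact (RingHom.map_det MvPolynomial.C M).symm
    rw [← h2]
    exact Ideal.sum_mem T (t := Finset.univ) (f := fun k => M'.adjugate j k * L k)
      fun k _ => T.mul_mem_left _ (hL k)
  have h2 : MvPolynomial.C M.det ∈ T := by
    have h3 := sub_mem h1 (T.mul_mem_left (.C M.det) hX)
    convert h3 using 1
    ring
  exact T.eq_top_of_isUnit_mem h2 ((Ne.isUnit hdet).map MvPolynomial.C)

/-- Expansion of a quadratic form along `v + uτ + wτ²`, with `v` in its kernel and `τ³ = 0`: the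
second order term `w` does not contribute. -/
theorem quad_expansion {B : Type*} [CommRing B] {M : Matrix (Fin 3) (Fin 3) B} (hM : M.IsSymm)
    {v : Fin 3 → B} (hv : ∀ a, ∑ b, M a b * v b = 0) (u w : Fin 3 → B) {τ : B} (hτ : τ ^ 3 = 0) :
    ∑ a, ∑ b, M a b * (v a + u a * τ + w a * τ ^ 2) * (v b + u b * τ + w b * τ ^ 2) =
      (∑ a, ∑ b, M a b * u a * u b) * τ ^ 2 := by
  have h1 : M 1 0 = M 0 1 := hM.apply 0 1
  have h2 : M 2 0 = M 0 2 := hM.apply 0 2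
  have h3 : M 2 1 = M 1 2 := hM.apply 1 2
  have hv0 := hv 0
  have hv1 := hv 1
  have hv2 := hv 2
  simp only [Fin.sum_univ_three, h1, h2, h3] at hv0 hv1 hv2 ⊢
  linear_combination (v 0 + 2 * (u 0 * τ + w 0 * τ ^ 2)) * hv0 +
    (v 1 + 2 * (u 1 * τ + w 1 * τ ^ 2)) * hv1 + (v 2 + 2 * (u 2 * τ + w 2 * τ ^ 2)) * hv2 +
    (2 * (u 0 * (M 0 0 * w 0 + M 0 1 * w 1 + M 0 2 * w 2) +
      u 1 * (M 0 1 * w 0 + M 1 1 * w 1 + M 1 2 * w 2) +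
      u 2 * (M 0 2 * w 0 + M 1 2 * w 1 + M 2 2 * w 2)) +
      τ * (w 0 * (M 0 0 * w 0 + M 0 1 * w 1 + M 0 2 * w 2) +
      w 1 * (M 0 1 * w 0 + M 1 1 * w 1 + M 1 2 * w 2) +
      w 2 * (M 0 2 * w 0 + M 1 2 * w 1 + M 2 2 * w 2))) * hτ

/-- A nonzero form with kernel vector `v` is nonzero at a vector `u` with `u_j = 0`, since any
vector can be moved there by a multiple of `v`. -/
theorem exists_vector_ne_zero {K : Type*} [Field K] [CharZero K] {M : Matrix (Fin 3) (Fin 3) K}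
    (hM : M.IsSymm) (hM0 : M ≠ 0) {v : Fin 3 → K} (hv : ∀ a, ∑ b, M a b * v b = 0) {j : Fin 3}
    (hvj : v j = 1) : ∃ u : Fin 3 → K, u j = 0 ∧ ∑ a, ∑ b, M a b * u a * u b ≠ 0 := by
  by_contra! h
  have h' (w : Fin 3 → K) : ∑ a, ∑ b, M a b * w a * w b = 0 := by
    have h1 : M 1 0 = M 0 1 := hM.apply 0 1
    have h2 : M 2 0 = M 0 2 := hM.apply 0 2
    have h3 : M 2 1 = M 1 2 := hM.apply 1 2
    have hw := h (fun l => w l - w j * v l) (by rw [hvj, mul_one, sub_self])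
    have hv0 := hv 0
    have hv1 := hv 1
    have hv2 := hv 2
    simp only [Fin.sum_univ_three, h1, h2, h3] at hv0 hv1 hv2 hw ⊢
    linear_combination hw + w j * (2 * w 0 - w j * v 0) * hv0 +
      w j * (2 * w 1 - w j * v 1) * hv1 + w j * (2 * w 2 - w j * v 2) * hv2
  apply hM0
  have hii (i) : M i i = 0 := by
    have := h' (Pi.single i 1)
    simpa [Pi.single_apply] using this
  ext i k
  have := h' (Pi.single i 1 + Pi.single k 1)
  have hki : M k i = M i k := hM.apply i k
  simp [Pi.single_apply, mul_add, Finset.sum_add_distrib, hii, hki] at this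
  exact this

/-- A nonzero conic is not smooth at a point `v` of the kernel of its matrix: every `v + uτ` lies on
it modulo `τ²`, but for a tangent vector `u` on which the form does not vanish, this point over
`K[τ]/(τ²)` does not lift to `K[τ]/(τ³)`. -/
theorem not_formallySmooth_quad {K Γ : Type*} [Field K] [CharZero K] [CommRing Γ] [Algebra K Γ]
    {M : Matrix (Fin 3) (Fin 3) K} (hM : M.IsSymm) (hM0 : M ≠ 0) {v : Fin 3 → K}
    (hv : ∀ a, ∑ b, M a b * v b = 0) {j : Fin 3} (hvj : v j = 1)
    (θ : MvPolynomial (Fin 3) K →ₐ[K] Γ) (hθ : Function.Surjective θ)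
    (hker : RingHom.ker θ = Ideal.span {quad M, .X j - 1}) : ¬ Algebra.FormallySmooth K Γ := by
  intro _
  obtain ⟨u, huj, hu⟩ := exists_vector_ne_zero hM hM0 hv hvj
  obtain ⟨B, _, _, τ, hτ, hτ2⟩ : ∃ (B : Type _) (_ : CommRing B) (_ : Algebra K B) (τ : B),
      τ ^ 3 = 0 ∧ ∀ c : K, algebraMap K B c * τ ^ 2 = 0 → c = 0 := by
    refine ⟨Polynomial K ⧸ Ideal.span {(Polynomial.X : Polynomial K) ^ 3}, inferInstance,
      inferInstance, Ideal.Quotient.mk _ Polynomial.X, ?_, fun c hc => ?_⟩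
    · rw [← map_pow]
      exact Ideal.Quotient.eq_zero_iff_mem.mpr (Ideal.mem_span_singleton_self _)
    · rw [← map_pow] at hc
      have h1 : Polynomial.C c * Polynomial.X ^ 2 ∈
          Ideal.span {(Polynomial.X : Polynomial K) ^ 3} :=
        Ideal.Quotient.eq_zero_iff_mem.mp ((map_mul _ _ _).trans hc)
      have h2 := Polynomial.X_pow_dvd_iff.mp (Ideal.mem_span_singleton.mp h1) 2 (by norm_num)
      simpa using h2
  let I : Ideal B := Ideal.span {τ ^ 2}
  have hI : I ^ 2 = ⊥ := by
    rw [Ideal.span_singleton_pow, Ideal.span_singleton_eq_bot]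
    linear_combination τ * hτ
  have hquad (p : Fin 3 → B) : MvPolynomial.aeval p (quad M) =
      ∑ a, ∑ b, algebraMap K B (M a b) * p a * p b := by
    simp [quad]
  let M' := M.map (algebraMap K B)
  have hM' : M'.IsSymm := hM.map _
  have hv' (a) : ∑ b, M' a b * algebraMap K B (v b) = 0 := by
    simp only [M', Matrix.map_apply, ← map_mul, ← map_sum, hv a, map_zero]
  have hexp (w : Fin 3 → B) : MvPolynomial.aeval (fun l => algebraMap K B (v l) +
      algebraMap K B (u l) * τ + w l * τ ^ 2) (quad M) =
      algebraMap K B (∑ a, ∑ b, M a b * u a * u b) * τ ^ 2 := by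
    rw [hquad]
    refine (quad_expansion hM' hv' (fun l => algebraMap K B (u l)) w hτ).trans ?_
    simp [M']
  let p (l : Fin 3) : B := algebraMap K B (v l) + algebraMap K B (u l) * τ
  let g' : MvPolynomial (Fin 3) K →ₐ[K] B ⧸ I :=
    (Ideal.Quotient.mkₐ K I).comp (MvPolynomial.aeval p)
  have hg' : ∀ a, θ a = 0 → g' a = 0 := by
    have : RingHom.ker θ ≤ RingHom.ker g' := by
      rw [hker, Ideal.span_le]
      rintro _ (rfl | rfl)
      · refine Ideal.Quotient.eq_zero_iff_mem.mpr (Ideal.mem_span_singleton'.mpr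
          ⟨algebraMap K B (∑ a, ∑ b, M a b * u a * u b), ?_⟩)
        rw [← hexp 0]
        simp [p]
      · simp [g', p, hvj, huj, RingHom.mem_ker]
    exact fun a ha => this ha
  let g : Γ →ₐ[K] B ⧸ I := (Ideal.Quotient.liftₐ (RingHom.ker θ) g' hg').comp
    (Ideal.quotientKerAlgEquivOfSurjective hθ).symm.toAlgHom
  have hg (a) : g (θ a) = g' a := by
    have : (Ideal.quotientKerAlgEquivOfSurjective hθ).symm (θ a) = Ideal.Quotient.mk _ a := by
      rw [AlgEquiv.symm_apply_eq]
      rfl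
    simp only [g, AlgHom.comp_apply]
    exact (congrArg _ this).trans rfl
  obtain ⟨f, hf⟩ := Algebra.FormallySmooth.exists_lift I ⟨2, hI⟩ g
  have hw (l : Fin 3) : ∃ w, f (θ (.X l)) = p l + w * τ ^ 2 := by
    have h1 : Ideal.Quotient.mk I (f (θ (.X l))) = Ideal.Quotient.mk I (p l) := by
      refine (DFunLike.congr_fun hf (θ (.X l))).trans ((hg _).trans ?_)
      simp [g']
    obtain ⟨w, hw⟩ := Ideal.mem_span_singleton'.mp (Ideal.Quotient.eq.mp h1)
    exact ⟨w, by rw [hw]; ring⟩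
  choose w hw using hw
  have h0 : MvPolynomial.aeval (fun l => f (θ (.X l))) (quad M) = 0 := by
    have h1 : (f.comp θ) = MvPolynomial.aeval (fun l => f (θ (.X l))) := by
      ext l; simp
    rw [← h1, AlgHom.comp_apply]
    have h2 : quad M ∈ RingHom.ker θ := hker ▸ Ideal.subset_span (by simp)
    rw [(show θ (quad M) = 0 from h2), map_zero]
  rw [funext hw, hexp w] at h0
  exact hu (hτ2 _ h0)

end QuadraticForm

/-! ### `Proj` of a graded domain -/

section Domain

variable {K A : Type u} [CommRing K] [CommRing A] [Algebra K A] [IsDomain A]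
  (𝒜 : ℕ → Submodule K A) [GradedAlgebra 𝒜]

/-- The generic point of `Proj` of a graded domain lies on every nonempty open. An element `f ≠ 0`
of positive degree ensures that the zero ideal is a relevant prime. -/
theorem exists_mem_of_nonempty {d : ℕ} (hd : 0 < d) {f : A} (hf : f ∈ 𝒜 d) (hf0 : f ≠ 0) :
    ∃ η : Proj 𝒜, (∀ g ≠ 0, η ∈ Proj.basicOpen 𝒜 g) ∧
      ∀ U : (Proj 𝒜).Opens, (U : Set (Proj 𝒜)).Nonempty → η ∈ U := by
  have hη : ¬ HomogeneousIdeal.irrelevant 𝒜 ≤ ⊥ := by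
    intro h
    have h1 : f ∈ (⊥ : HomogeneousIdeal 𝒜) := h <| by
      rw [HomogeneousIdeal.mem_irrelevant_iff, GradedRing.proj_apply,
        DirectSum.decompose_of_mem_ne 𝒜 hf hd.ne']
    exact hf0 h1
  let η : Proj 𝒜 := (⟨⊥, Ideal.isPrime_bot, hη⟩ : ProjectiveSpectrum 𝒜)
  have h0 (g : A) (hg : g ≠ 0) : η ∈ Proj.basicOpen 𝒜 g := hg
  refine ⟨η, h0, fun U ⟨p, hp⟩ => ?_⟩
  obtain ⟨_, ⟨g, rfl⟩, hg, hgU⟩ :=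
    (ProjectiveSpectrum.isTopologicalBasis_basic_opens 𝒜).exists_subset_of_mem_open hp U.isOpen
  refine hgU (h0 g ?_)
  rintro rfl
  exact hg (idealAt 𝒜 p).zero_mem

theorem isIntegral_proj {d : ℕ} (hd : 0 < d) {f : A} (hf : f ∈ 𝒜 d) (hf0 : f ≠ 0) :
    IsIntegral (Proj 𝒜) := by
  obtain ⟨η, -, hη⟩ := exists_mem_of_nonempty 𝒜 hd hf hf0
  have : PreirreducibleSpace (Proj 𝒜) := ⟨fun U V hU hV hUn hVn =>
    ⟨η, trivial, hη ⟨U, hU⟩ (by simpa using hUn), hη ⟨V, hV⟩ (by simpa using hVn)⟩⟩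
  have : IrreducibleSpace (Proj 𝒜) := ⟨⟨η⟩⟩
  have : IsReduced (Proj 𝒜) := ⟨fun U => ⟨fun a ⟨k, hk⟩ => evalAt_ext 𝒜 fun p hp => by
    have := IsLocalization.isDomain_localization (idealAt 𝒜 p).primeCompl_le_nonZeroDivisors
    have h := congrArg (evalAt 𝒜 p hp) hk
    rw [map_pow, map_zero] at h
    rw [map_zero]
    exact eq_zero_of_pow_eq_zero h⟩⟩
  exact isIntegral_of_irreducibleSpace_of_isReduced _

theorem dense_of_basicOpen_le {d : ℕ} (hd : 0 < d) {f : A} (hf : f ∈ 𝒜 d) (hf0 : f ≠ 0)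
    {U : (Proj 𝒜).Opens} (hU : Proj.basicOpen 𝒜 f ≤ U) : Dense (U : Set (Proj 𝒜)) := by
  obtain ⟨η, h0, hη⟩ := exists_mem_of_nonempty 𝒜 hd hf hf0
  refine dense_iff_inter_open.mpr fun V hV hVn => ⟨η, hη ⟨V, hV⟩ hVn, hU (h0 f hf0)⟩

end Domain

/-! ### The surface is integral, smooth and projective -/

section Surface

variable (n : ℚ)

/-- `ℚ[x, y, z, w]` as polynomials in `w` over `ℚ[x, y, z]`. -/
def polynomialInW : MvPolynomial (Fin 4) ℚ ≃ₐ[ℚ] Polynomial (MvPolynomial (Fin 3) ℚ) :=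
  (MvPolynomial.renameEquiv ℚ finSuccEquivLast).trans (MvPolynomial.optionEquivLeft ℚ (Fin 3))

theorem polynomialInW_w : polynomialInW w = Polynomial.X := by
  have h : finSuccEquivLast (3 : Fin 4) = none := rfl
  simp [polynomialInW, w, h]

theorem polynomialInW_inclXYZ (q : MvPolynomial (Fin 3) ℚ) :
    polynomialInW (inclXYZ q) = Polynomial.C q := by
  induction q using MvPolynomial.induction_on with
  | C c =>
    rw [← MvPolynomial.algebraMap_eq, AlgHom.commutes, AlgEquiv.commutes]
    rfl
  | add p q hp hq => rw [map_add, map_add, hp, hq, map_add]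
  | mul_X p l hp =>
    rw [map_mul, map_mul, map_mul, hp, inclXYZ_X]
    simp [polynomialInW]

/-- The right-hand side of the equation `w² = x⁴ + y⁴ - nz⁴`. -/
def quartic : MvPolynomial (Fin 3) ℚ := .X 0 ^ 4 + .X 1 ^ 4 - .C n * .X 2 ^ 4

/-- At `x = y = 1`, `z = 0` the quartic takes the value `2`, which is not a square. -/
theorem quartic_ne_sq (q : MvPolynomial (Fin 3) ℚ) : quartic n ≠ q ^ 2 := by
  intro h
  have h1 := congrArg (MvPolynomial.eval ![1, 1, 0]) h
  simp only [quartic, map_sub, map_add, map_mul, map_pow, MvPolynomial.eval_X,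
    MvPolynomial.eval_C, Matrix.cons_val_zero, Matrix.cons_val_one, Matrix.cons_val] at h1
  have h2 : IsSquare (2 : ℚ) := ⟨MvPolynomial.eval ![1, 1, 0] q, by rw [← sq, ← h1]; norm_num⟩
  rw [Rat.isSquare_iff] at h2
  exact Int.prime_two.irreducible.not_isSquare h2.1

theorem polynomialInW_equation :
    polynomialInW (x ^ 4 + y ^ 4 - MvPolynomial.C n * z ^ 4 - w ^ 2) =
      -(Polynomial.X ^ 2 - Polynomial.C (quartic n)) := by
  have h : x ^ 4 + y ^ 4 - MvPolynomial.C n * z ^ 4 = inclXYZ (quartic n) := by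
    have h : inclXYZ (.C n) = .C n := inclXYZ.commutes n
    simp only [quartic, map_sub, map_add, map_mul, map_pow, inclXYZ_X, h]
    rfl
  rw [h, map_sub, map_pow, polynomialInW_w, polynomialInW_inclXYZ]
  ring

theorem monic_X_sq_sub_quartic :
    (Polynomial.X ^ 2 - Polynomial.C (quartic n)).Monic :=
  Polynomial.monic_X_pow_sub_C _ two_ne_zero

/-- The equation is irreducible: as a monic polynomial of degree `2` in `w` it has no root. -/
instance : (surfaceIdeal n).IsPrime := by
  have hdeg : (Polynomial.X ^ 2 - Polynomial.C (quartic n)).natDegree = 2 :=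
    Polynomial.natDegree_X_pow_sub_C
  have hirr : Irreducible (Polynomial.X ^ 2 - Polynomial.C (quartic n)) := by
    rw [(monic_X_sq_sub_quartic n).irreducible_iff_roots_eq_zero_of_degree_le_three hdeg.ge
      (by omega), Multiset.eq_zero_iff_forall_notMem]
    intro r hr
    have := Polynomial.isRoot_of_mem_roots hr
    simp only [Polynomial.IsRoot, Polynomial.eval_sub, Polynomial.eval_pow, Polynomial.eval_X,
      Polynomial.eval_C] at this
    exact quartic_ne_sq n r (sub_eq_zero.mp this).symm
  have h1 : Irreducible (x ^ 4 + y ^ 4 - MvPolynomial.C n * z ^ 4 - w ^ 2) := by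
    rw [← MulEquiv.irreducible_iff polynomialInW.toMulEquiv]
    change Irreducible (polynomialInW _)
    rw [polynomialInW_equation]
    exact (Associated.refl _).neg_right.irreducible hirr
  exact (Ideal.span_singleton_prime h1.ne_zero).mpr h1.prime

variable {n} in
/-- There is no relation between `x`, `y`, `z` on the surface. -/
theorem eq_zero_of_cl_inclXYZ {q : MvPolynomial (Fin 3) ℚ} (h : cl n (inclXYZ q) = 0) : q = 0 := by
  obtain ⟨p, hp⟩ := Ideal.mem_span_singleton.mp (Ideal.Quotient.eq_zero_iff_mem.mp h)
  replace hp := congrArg polynomialInW hp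
  rw [map_mul, polynomialInW_inclXYZ, polynomialInW_equation] at hp
  have hdvd : Polynomial.X ^ 2 - Polynomial.C (quartic n) ∣ Polynomial.C q :=
    ⟨-polynomialInW p, by rw [hp]; ring⟩
  by_contra hq
  have h2 := Polynomial.degree_le_of_dvd hdvd (by simpa using hq)
  rw [Polynomial.degree_X_pow_sub_C two_pos] at h2
  exact absurd (h2.trans Polynomial.degree_C_le) (by decide)

theorem cl_x_ne_zero : cl n x ≠ 0 := by
  intro h
  have h1 : x = inclXYZ (.X 0) := (inclXYZ_X 0).symm
  rw [h1] at h
  exact MvPolynomial.X_ne_zero _ (eq_zero_of_cl_inclXYZ h)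

theorem isIntegral_surface : IsIntegral (Surface n) :=
  isIntegral_proj (surfaceGrading n) one_pos (cl_X_mem 0) (cl_x_ne_zero n)

variable {n}

theorem smooth_surface (hn : n ≠ 0) : SmoothOfRelativeDimension 2 (surfaceToSpec n) := by
  refine smoothOfRelativeDimension_of_charts _ (fun j : Fin 3 => Factorisation.openX n j)
    Factorisation.isAffineOpen_openX iSup_basicOpen_cl_X fun j => ?_
  rw [surfaceToSpec, scalars_eq_dehom _ (cl_X_mem j)]
  refine locally_isStandardSmooth ((dehom (surfaceGrading n) (cl_X_mem j)).comp (cl n))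
    ((dehom_surjective _ _).comp Ideal.Quotient.mk_surjective)
    (x ^ 4 + y ^ 4 - MvPolynomial.C n * z ^ 4 - w ^ 2) j.castSucc ?_ ?_
  · ext p
    rw [RingHom.mem_ker, RingHom.comp_apply, ← RingHom.mem_ker, ker_dehom, Ideal.span_insert,
      sup_comm, ← Ideal.mem_quotient_iff_mem_sup, Ideal.map_span, Set.image_singleton, map_sub,
      map_one]
  obtain ⟨T, hT⟩ : ∃ T, T = Ideal.span {x ^ 4 + y ^ 4 - MvPolynomial.C n * z ^ 4 - w ^ 2,
      .X j.castSucc - 1} ⊔ Ideal.span ((fun k => MvPolynomial.pderiv k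
        (x ^ 4 + y ^ 4 - MvPolynomial.C n * z ^ 4 - w ^ 2)) '' {k | k ≠ j.castSucc}) := ⟨_, rfl⟩
  have h1 : x ^ 4 + y ^ 4 - MvPolynomial.C n * z ^ 4 - w ^ 2 ∈ T :=
    hT ▸ Ideal.mem_sup_left (Ideal.subset_span (by simp))
  have h2 : .X j.castSucc - 1 ∈ T := hT ▸ Ideal.mem_sup_left (Ideal.subset_span (by simp))
  have h3 (k) (hk : k ≠ j.castSucc) : MvPolynomial.pderiv k
      (x ^ 4 + y ^ 4 - MvPolynomial.C n * z ^ 4 - w ^ 2) ∈ T :=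
    hT ▸ Ideal.mem_sup_right (Ideal.subset_span ⟨k, hk, rfl⟩)
  rw [← hT]
  clear hT
  -- Euler's relation for the weights `1, 1, 1, 2` expresses `4 x_j⁴` (up to the factor `-n` for
  -- `x_j = z`) through the equation and the partial derivatives other than the one by `x_j`.
  have h4 : ∃ c : ℚ, c ≠ 0 ∧ MvPolynomial.C c ∈ T := by
    have e3 := h3 3 (Fin.castSucc_lt_last j).ne'
    have hX (p : MvPolynomial (Fin 4) ℚ) (h : p * .X j.castSucc ^ 4 ∈ T) : p ∈ T := by
      rw [← Ideal.Quotient.eq_zero_iff_mem, map_sub, map_one, sub_eq_zero] at h2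
      rw [← Ideal.Quotient.eq_zero_iff_mem, map_mul, map_pow, h2, one_pow, mul_one] at h
      exact Ideal.Quotient.eq_zero_iff_mem.mp h
    have e0 := h3 0
    have e1 := h3 1
    have e2 := h3 2
    have h4 : (4 : MvPolynomial (Fin 4) ℚ) = .C 4 := (map_ofNat _ 4).symm
    simp [MvPolynomial.pderiv_X] at e0 e1 e2 e3
    obtain rfl | rfl | rfl : j = 0 ∨ j = 1 ∨ j = 2 := by omega
    · refine ⟨4, four_ne_zero, hX _ ?_⟩
      convert add_mem (add_mem (sub_mem (T.mul_mem_left 4 h1) (T.mul_mem_left y (e1 (by decide))))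
        (T.mul_mem_left z (e2 (by decide)))) (T.mul_mem_left (2 * w) e3) using 1
      rw [← h4]
      change 4 * x ^ 4 = _
      ring
    · refine ⟨4, four_ne_zero, hX _ ?_⟩
      convert add_mem (add_mem (sub_mem (T.mul_mem_left 4 h1) (T.mul_mem_left x (e0 (by decide))))
        (T.mul_mem_left z (e2 (by decide)))) (T.mul_mem_left (2 * w) e3) using 1
      rw [← h4]
      change 4 * y ^ 4 = _
      ring
    · refine ⟨-(4 * n), by simpa using hn, hX _ ?_⟩
      convert add_mem (sub_mem (sub_mem (T.mul_mem_left 4 h1) (T.mul_mem_left x (e0 (by decide))))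
        (T.mul_mem_left y (e1 (by decide)))) (T.mul_mem_left (2 * w) e3) using 1
      rw [map_neg, map_mul, ← h4]
      change -(4 * .C n) * z ^ 4 = _
      ring
  obtain ⟨c, hc, h⟩ := h4
  exact T.eq_top_of_isUnit_mem h ((Ne.isUnit hc).map MvPolynomial.C)

end Surface

section ProjectiveEmbedding

variable (n : ℚ)

/-- The monomials of weight `2`. -/
def monomialsTwo : Fin 7 → CoordRing n :=
  fun k => cl n (![x ^ 2, x * y, x * z, y ^ 2, y * z, z ^ 2, w] k)

theorem monomialsTwo_mem (k : Fin 7) : monomialsTwo n k ∈ surfaceGrading n 2 := by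
  have h := X_castSucc_mem
  have hx : x ∈ weightedGrading 1 := h 0
  have hy : y ∈ weightedGrading 1 := h 1
  have hz : z ∈ weightedGrading 1 := h 2
  refine cl_mem ?_
  fin_cases k
  exacts [SetLike.pow_mem_graded 2 hx, SetLike.mul_mem_graded hx hy, SetLike.mul_mem_graded hx hz,
    SetLike.pow_mem_graded 2 hy, SetLike.mul_mem_graded hy hz, SetLike.pow_mem_graded 2 hz, w_mem]

theorem mul_mem_range_monomialsTwo (a b : Fin 3) :
    cl n (.X a.castSucc * .X b.castSucc) ∈ Set.range (monomialsTwo n) := by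
  have h (k) : monomialsTwo n k = cl n (![x ^ 2, x * y, x * z, y ^ 2, y * z, z ^ 2, w] k) := rfl
  fin_cases a <;> fin_cases b
  exacts [⟨0, congrArg (cl n) (sq _)⟩, ⟨1, rfl⟩, ⟨2, rfl⟩, ⟨1, congrArg (cl n) (mul_comm _ _)⟩,
    ⟨3, congrArg (cl n) (sq _)⟩, ⟨4, rfl⟩, ⟨2, congrArg (cl n) (mul_comm _ _)⟩,
    ⟨4, congrArg (cl n) (mul_comm _ _)⟩, ⟨5, congrArg (cl n) (sq _)⟩]

theorem weight_weights (e : Fin 4 →₀ ℕ) :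
    Finsupp.weight weights e = e 0 + e 1 + e 2 + 2 * e 3 := by
  rw [Finsupp.weight_apply, Finsupp.sum_fintype _ _ (by simp)]
  simp [Fin.sum_univ_four]
  ring

/-- A monomial of weight `2m` is a product of `m` monomials of weight `2`. -/
theorem cl_monomial_mem_span_pow (m : ℕ) (e : Fin 4 →₀ ℕ)
    (he : e 0 + e 1 + e 2 + 2 * e 3 = m * 2) :
    cl n (.monomial e 1) ∈ Submodule.span ℚ (Set.range (monomialsTwo n)) ^ m := by
  induction m generalizing e with
  | zero =>
    have : e = 0 := by
      ext i
      fin_cases i <;> simp <;> omega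
    rw [this, Submodule.pow_zero]
    exact Submodule.one_le.mp le_rfl
  | succ m ih =>
    have key (e' e'' : Fin 4 →₀ ℕ) (h : e = e' + e'')
        (h' : e' 0 + e' 1 + e' 2 + 2 * e' 3 = m * 2)
        (h'' : cl n (.monomial e'' 1) ∈ Set.range (monomialsTwo n)) :
        cl n (.monomial e 1) ∈ Submodule.span ℚ (Set.range (monomialsTwo n)) ^ (m + 1) := by
      have : (MvPolynomial.monomial e (1 : ℚ)) = .monomial e' 1 * .monomial e'' 1 := by
        rw [MvPolynomial.monomial_mul, h, one_mul]
      rw [this, map_mul, Submodule.pow_succ]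
      exact Submodule.mul_mem_mul (ih e' h') (Submodule.subset_span h'')
    by_cases h3 : 1 ≤ e 3
    · refine key (e - Finsupp.single 3 1) (Finsupp.single 3 1) ?_ ?_ ⟨6, rfl⟩
      · exact (tsub_add_cancel_of_le (Finsupp.single_le_iff.mpr h3)).symm
      · simp [Finsupp.tsub_apply]
        omega
    have hex (e' : Fin 4 →₀ ℕ) (h' : 1 ≤ e' 0 + e' 1 + e' 2) : ∃ a : Fin 3, 1 ≤ e' a.castSucc := by
      by_contra! h
      have := h 0
      have := h 1
      have := h 2
      simp at *
      omega
    obtain ⟨a, ha⟩ := hex e (by omega)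
    obtain ⟨e₁, rfl⟩ : ∃ e₁, e = e₁ + Finsupp.single a.castSucc 1 :=
      ⟨_, (tsub_add_cancel_of_le (Finsupp.single_le_iff.mpr ha)).symm⟩
    have hs (a : Fin 3) : (Finsupp.single a.castSucc 1 : Fin 4 →₀ ℕ) 0 +
        (Finsupp.single a.castSucc 1 : Fin 4 →₀ ℕ) 1 +
        (Finsupp.single a.castSucc 1 : Fin 4 →₀ ℕ) 2 = 1 ∧
        (Finsupp.single a.castSucc 1 : Fin 4 →₀ ℕ) 3 = 0 := by
      fin_cases a <;> simp
    have hsa := hs a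
    simp only [Finsupp.add_apply] at he h3
    obtain ⟨b, hb⟩ := hex e₁ (by omega)
    obtain ⟨e₂, rfl⟩ : ∃ e₂, e₁ = e₂ + Finsupp.single b.castSucc 1 :=
      ⟨_, (tsub_add_cancel_of_le (Finsupp.single_le_iff.mpr hb)).symm⟩
    have hsb := hs b
    simp only [Finsupp.add_apply] at he h3
    refine key e₂ (Finsupp.single b.castSucc 1 + Finsupp.single a.castSucc 1) (add_assoc _ _ _)
      (by omega) ?_
    convert mul_mem_range_monomialsTwo n b a using 2
    rw [MvPolynomial.X, MvPolynomial.X, MvPolynomial.monomial_mul, one_mul]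

theorem surfaceGrading_le_span_pow (m : ℕ) :
    surfaceGrading n (m • 2) ≤ Submodule.span ℚ (Set.range (monomialsTwo n)) ^ m := by
  rintro _ ⟨p, hp, rfl⟩
  change cl n p ∈ _
  rw [p.as_sum, map_sum]
  refine sum_mem fun e he => ?_
  have h := hp (MvPolynomial.mem_support_iff.mp he)
  rw [weight_weights] at h
  rw [← mul_one (MvPolynomial.coeff e p), ← smul_eq_mul, ← MvPolynomial.smul_monomial]
  exact Submodule.smul_mem _ (MvPolynomial.coeff e p) (cl_monomial_mem_span_pow n m e h)

theorem projective_surface : ∃ (N : ℕ) (i : Surface n ⟶ ProjSpace ℚ N),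
    i ≫ projSpaceToSpec ℚ N = surfaceToSpec n ∧ IsClosedImmersion i := by
  have hc : ⨆ k, Proj.basicOpen (surfaceGrading n) (monomialsTwo n k) = ⊤ := by
    rw [eq_top_iff, ← iSup_basicOpen_cl_X]
    refine iSup_le fun l => ?_
    obtain ⟨k, hk⟩ := mul_mem_range_monomialsTwo n l l
    refine le_trans ?_ (le_iSup _ k)
    rw [hk, map_mul, Proj.basicOpen_mul, inf_idem]
  obtain ⟨i, hi⟩ := exists_closedImmersion (surfaceGrading n) two_pos (monomialsTwo n)
    (monomialsTwo_mem n) hc (surfaceGrading_le_span_pow n)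
  exact ⟨6, i, hom_SpecRat_ext _ _, hi⟩

theorem isSmoothProjectiveSurface {n : ℚ} (hn : n ≠ 0) :
    IsSmoothProjectiveSurface (surfaceToSpec n) :=
  ⟨isIntegral_surface n, smooth_surface hn, projective_surface n⟩

end ProjectiveEmbedding

/-! ### The embedding in `ℙ¹ × ℙ²` -/

namespace Factorisation

variable {n : ℚ} (D : Factorisation n)

theorem isEmbeddingOnto {π : Surface n ⟶ ProjSpace ℚ 1} {φ : Surface n ⟶ ProjSpace ℚ 2}
    {f : Surface n ⟶ P1P2 ℚ} (hπ : D.IsPi π) (hφ : IsPhi n φ) (h₁ : f ≫ pr₁ ℚ = π)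
    (h₂ : f ≫ pr₂ ℚ = φ) : IsEmbeddingOnto f D.form := by
  have key := D.isAffineOpen_and_surjective_and_ker hπ hφ h₁ h₂
  refine ⟨isClosedImmersion_of_affine_cover f (fun a : Fin 2 × Fin 3 => biChart ℚ a.1 a.2)
    (fun a => isAffineOpen_biChart ℚ _ _) (iSup_biChart ℚ) (fun a => (key a.1 a.2).1)
    fun a => ?_, fun i j => ?_⟩
  · exact Function.Surjective.of_comp (g := biDehom ℚ a.1 a.2) (key a.1 a.2).2.1
  · have h := (key i j).2.2
    rw [← RingHom.comap_ker] at h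
    rw [← Ideal.map_comap_of_surjective _ (biDehom_surjective ℚ i j)
      (RingHom.ker (f.app (biChart ℚ i j)).hom), h, chartIdeal, Ideal.map_span,
      biDehomogenize_eq]
    have h1 : biDehom ℚ i j (coef (.X i) - 1) = 0 := by
      rw [biDehom, map_sub, MvPolynomial.coe_eval₂Hom, MvPolynomial.eval₂_C,
        MvPolynomial.coe_eval₂Hom, MvPolynomial.eval₂_X, coord_self, map_one,
        MvPolynomial.eval₂_one, sub_self]
    have h2 : biDehom ℚ i j (.X j - 1) = 0 := by
      rw [biDehom, map_sub, MvPolynomial.coe_eval₂Hom, MvPolynomial.eval₂_X, coord_self, map_one,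
        MvPolynomial.eval₂_one, sub_self]
    simp [Set.image_insert_eq, h1, h2]

theorem c_ne_zero : D.c ≠ 0 := by
  intro h
  have := D.disc
  rw [h, mul_zero, sub_zero] at this
  exact quartic_ne_sq n _ this.symm

/-- The pair `(-c : b + ew)` alone is defined on a dense open, because `c ≠ 0`. -/
theorem isGivenBy_pi {π : Surface n ⟶ ProjSpace ℚ 1} (hπ : D.IsPi π) :
    IsGivenByPolynomials π (D.tuple 0) := by
  refine ⟨2, D.tuple_mem 0, dense_of_basicOpen_le _ two_pos (D.tuple_mem 0 0) ?_
    (le_iSup (fun i => Proj.basicOpen (surfaceGrading n) (cl n (D.tuple 0 i))) 0), hπ 0⟩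
  intro h
  simp only [tuple, Matrix.cons_val_zero, ← map_neg] at h
  exact neg_ne_zero.mpr D.c_ne_zero (eq_zero_of_cl_inclXYZ h)

theorem isGivenBy_phi {φ : Surface n ⟶ ProjSpace ℚ 2} (hφ : IsPhi n φ) :
    IsGivenByPolynomials φ ![x, y, z] := by
  have hg : ∀ l : Fin 3, ![x, y, z] l = .X l.castSucc := by
    intro l; fin_cases l <;> rfl
  have : (![x, y, z] : Fin 3 → MvPolynomial (Fin 4) ℚ) = fun l => .X l.castSucc := funext hg
  rw [this]
  exact ⟨1, cl_X_mem, dense_of_basicOpen_le _ one_pos (cl_X_mem 0) (cl_x_ne_zero n)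
    (le_iSup (fun i : Fin 3 => openX n i) 0), hφ⟩

end Factorisation

/-! ### Cartesian squares on affine covers -/

section AffineCover

theorem appLE_congr_hom {X Y : Scheme.{u}} {f g : X ⟶ Y} (h : f = g) {U : Y.Opens} {V : X.Opens}
    (e : V ≤ f ⁻¹ᵁ U) (e' : V ≤ g ⁻¹ᵁ U) : f.appLE U V e = g.appLE U V e' := by
  subst h; rfl

theorem appLE_comp_appLE_eq {W X Y S : Scheme.{u}} {a : W ⟶ X} {b : W ⟶ Y} {f : X ⟶ S} {g : Y ⟶ S}
    (w : a ≫ f = b ≫ g) {O : W.Opens} {U : X.Opens} {V : Y.Opens} {T : S.Opens} (h₁ : U ≤ f ⁻¹ᵁ T)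
    (h₂ : V ≤ g ⁻¹ᵁ T) (h₃ : O ≤ a ⁻¹ᵁ U) (h₄ : O ≤ b ⁻¹ᵁ V) :
    f.appLE T U h₁ ≫ a.appLE U O h₃ = g.appLE T V h₂ ≫ b.appLE V O h₄ := by
  rw [Scheme.Hom.appLE_comp_appLE, Scheme.Hom.appLE_comp_appLE]
  exact appLE_congr_hom w _ _

theorem isIso_of_affine_cover {X Y : Scheme.{u}} (f : X ⟶ Y) {ι : Type*}
    (U : ι → Y.Opens) (hU : ∀ i, IsAffineOpen (U i)) (hc : ⨆ i, U i = ⊤)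
    (hf : ∀ i, IsAffineOpen (f ⁻¹ᵁ U i)) (hs : ∀ i, IsIso (f.app (U i))) : IsIso f := by
  change MorphismProperty.isomorphisms Scheme.{u} f
  refine (IsZariskiLocalAtTarget.iff_of_iSup_eq_top (P := .isomorphisms Scheme.{u}) U hc).mpr
    fun i => ?_
  have : IsAffine (U i) := hU i
  have : IsAffine (f ⁻¹ᵁ U i) := hf i
  have hiso : IsIso (f ∣_ U i).appTop := by
    rw [morphismRestrict_appTop]
    have h : IsIso (f.app ((U i).ι ''ᵁ ⊤)) := by
      rw [Scheme.Opens.ι_image_top]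
      exact hs i
    have h' : IsIso (X.presheaf.map (eqToHom (image_morphismRestrict_preimage f (U i) ⊤)).op) :=
      inferInstance
    exact IsIso.comp_isIso' h h'
  exact (MorphismProperty.arrow_mk_iso_iff (.isomorphisms Scheme.{u})
    (arrowIsoSpecΓOfIsAffine (f ∣_ U i))).mpr (inferInstanceAs (IsIso (Spec.map (f ∣_ U i).appTop)))

/-- A square over affine schemes is cartesian if it is so on the rings of an affine cover. -/
theorem isPullback_of_affine_cover {W X Y S : Scheme.{u}} [IsAffine S] [IsAffine Y] {a : W ⟶ X}
    {b : W ⟶ Y} {f : X ⟶ S} {g : Y ⟶ S} (w : a ≫ f = b ≫ g) {ι : Type*} (U : ι → X.Opens)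
    (hU : ∀ i, IsAffineOpen (U i)) (hc : ⨆ i, U i = ⊤) (hW : ∀ i, IsAffineOpen (a ⁻¹ᵁ U i))
    (H : ∀ i, IsPushout (f.appLE ⊤ (U i) le_top) (g.appLE ⊤ ⊤ le_top)
      (a.appLE (U i) (a ⁻¹ᵁ U i) le_rfl) (b.appLE ⊤ (a ⁻¹ᵁ U i) le_top)) :
    IsPullback a b f g := by
  let l := pullback.lift a b w
  let V (i : ι) := pullback.fst f g ⁻¹ᵁ U i ⊓ pullback.snd f g ⁻¹ᵁ ⊤
  have hV (i) : l ⁻¹ᵁ V i = a ⁻¹ᵁ U i := by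
    simp only [V, l, Scheme.Hom.preimage_inf, ← Scheme.Hom.comp_preimage, pullback.lift_fst,
      pullback.lift_snd]
    exact inf_top_eq _
  have happ (i) : IsIso (l.app (V i)) := by
    have key (O) (h : O = l ⁻¹ᵁ V i) (h' : IsIso (l.appLE (V i) O h.le)) : IsIso (l.app (V i)) := by
      subst h
      rwa [Scheme.Hom.app_eq_appLE]
    refine key _ (hV i).symm ?_
    have h1 := isPushout_pullback f g (hU i) (isAffineOpen_top Y)
    have h2 : l.appLE (V i) (a ⁻¹ᵁ U i) (hV i).ge = (h1.isoIsPushout _ _ (H i)).hom := by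
      apply h1.hom_ext
      · rw [IsPushout.inl_isoIsPushout_hom, Scheme.Hom.appLE_comp_appLE]
        exact appLE_congr_hom (pullback.lift_fst _ _ _) _ _
      · rw [IsPushout.inr_isoIsPushout_hom, Scheme.Hom.appLE_comp_appLE]
        exact appLE_congr_hom (pullback.lift_snd _ _ _) _ _
    rw [h2]
    infer_instance
  have : IsIso l := by
    refine isIso_of_affine_cover l V
      (fun i => isAffineOpen_pullback f g (hU i) (isAffineOpen_top Y))
      ?_ (fun i => hV i ▸ hW i) happ
    simp only [V, Scheme.Hom.preimage_top, inf_top_eq, ← Scheme.Hom.preimage_iSup, hc]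
  exact .of_iso_pullback ⟨w⟩ (asIso l) (pullback.lift_fst _ _ _) (pullback.lift_snd _ _ _)

end AffineCover

/-! ### Base change of projective space -/

section BaseChange

variable {κ : Type} [Field κ] {r : ℕ}

/-- Projective space over an extension `κ` of `ℚ` is the base change of projective space over
`ℚ`. -/
theorem exists_baseChange (c : Spec (.of κ) ⟶ Spec (.of ℚ)) :
    ∃ β : ProjSpace κ r ⟶ ProjSpace ℚ r, (∀ j, MapsBy β (chart κ j) j (coord κ j)) ∧
      IsPullback β (projSpaceToSpec κ r) (projSpaceToSpec ℚ r) c := by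
  obtain ⟨β, hβ⟩ := exists_mapsBy (projSpaceToSpec κ r ≫ c) (fun j => chart κ j)
    (isAffineOpen_chart κ) (iSup_chart κ) id (fun j => coord κ j) (coord_self κ) (by
      intro a b k l
      rw [← map_coord_mul_coord κ l inf_le_left inf_le_right,
        ← map_coord_mul_coord κ k inf_le_left inf_le_right]
      ring)
  have hpre (j) : β ⁻¹ᵁ chart ℚ j = chart κ j := by
    have h (i) : chart κ i ⊓ β ⁻¹ᵁ chart ℚ j = chart κ i ⊓ chart κ j :=
      ((hβ i).preimage_inf j).trans (basicOpen_coord κ i j)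
    rw [← top_inf_eq (β ⁻¹ᵁ chart ℚ j), ← iSup_chart κ, iSup_inf_eq]
    simp only [h]
    rw [← iSup_inf_eq, iSup_chart, top_inf_eq]
  refine ⟨β, hβ, isPullback_of_affine_cover (hom_SpecRat_ext _ _) (fun j => chart ℚ j)
    (isAffineOpen_chart ℚ) (iSup_chart ℚ) (fun j => (hpre j).symm ▸ isAffineOpen_chart κ j)
    fun j => ?_⟩
  -- The preimage of `chart ℚ j` is equal to `chart κ j`, but not by definition.
  have key (O) (h : O = β ⁻¹ᵁ chart ℚ j) (hO : IsPushout
      ((projSpaceToSpec ℚ r).appLE ⊤ (chart ℚ j) le_top) (c.appLE ⊤ ⊤ le_top)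
      (β.appLE (chart ℚ j) O h.le) ((projSpaceToSpec κ r).appLE ⊤ O le_top)) : IsPushout
      ((projSpaceToSpec ℚ r).appLE ⊤ (chart ℚ j) le_top) (c.appLE ⊤ ⊤ le_top)
      (β.appLE (chart ℚ j) (β ⁻¹ᵁ chart ℚ j) le_rfl)
      ((projSpaceToSpec κ r).appLE ⊤ (β ⁻¹ᵁ chart ℚ j) le_top) := by
    subst h
    exact hO
  refine key _ (hpre j).symm ?_
  obtain ⟨e, he⟩ := hβ j
  have htop := appLE_top_eq (projSpaceToSpec κ r) (chart κ j)
  have hex (s : PushoutCocone ((projSpaceToSpec ℚ r).appLE ⊤ (chart ℚ j) le_top)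
      (c.appLE ⊤ ⊤ le_top)) := exists_chart_hom κ j s.pt
    (s.inr.hom.comp (Scheme.ΓSpecIso (.of κ)).inv.hom) (fun k => s.inl (coord ℚ j k))
    (by rw [coord_self]; exact map_one s.inl.hom)
  choose φ hφs hφ using hex
  refine ⟨⟨?_⟩, ⟨PushoutCocone.IsColimit.mk _ φ ?_ ?_ ?_⟩⟩
  · exact appLE_comp_appLE_eq (hom_SpecRat_ext _ _) _ _ _ _
  · intro s
    apply chart_hom_ext_rat
    intro k
    rw [CommRingCat.comp_apply]
    exact (congrArg (φ s) (he k)).trans (hφ s k)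
  · intro s
    ext a
    have h1 := RingHom.congr_fun (hφs s) ((Scheme.ΓSpecIso (.of κ)).hom a)
    have h2 : (Scheme.ΓSpecIso (.of κ)).inv.hom ((Scheme.ΓSpecIso (.of κ)).hom a) = a :=
      ConcreteCategory.congr_hom (Scheme.ΓSpecIso (.of κ)).hom_inv_id a
    refine (congrArg (φ s).hom (RingHom.congr_fun htop a)).trans (h1.trans ?_)
    exact congrArg s.inr.hom h2
  · intro s m h1 h2
    apply chart_hom_ext
    · rw [hφs, ← h2]
      rfl
    · intro k
      rw [hφ, ← h1]
      exact congrArg m.hom (he k).symm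

end BaseChange

/-! ### Functions at the spectrum of a residue field -/

section Evaluation

/-- Pulling a function back to the spectrum of the residue field at `p` is evaluation at `p`. -/
theorem appLE_fromSpecResidueField {X : Scheme.{u}} (p : X) (U : X.Opens) (hp : p ∈ U)
    (e : ⊤ ≤ X.fromSpecResidueField p ⁻¹ᵁ U) :
    (X.fromSpecResidueField p).appLE U ⊤ e =
      X.evaluation U p hp ≫ (Scheme.ΓSpecIso (X.residueField p)).inv := by
  have e' : ⊤ ≤ Spec.map (X.residue p) ⁻¹ᵁ X.fromSpecStalk p ⁻¹ᵁ U := e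
  have h : (X.fromSpecResidueField p).appLE U ⊤ e = (X.fromSpecStalk p).app U ≫
      (Spec.map (X.residue p)).appLE _ ⊤ e' := Scheme.Hom.comp_appLE _ _ _ _ _
  rw [h, Scheme.fromSpecStalk_app hp, Category.assoc, Category.assoc, Scheme.Hom.map_appLE,
    ← Scheme.germ_residue, Category.assoc, Scheme.ΓSpecIso_inv_naturality]
  simp [Scheme.Hom.appTop, Scheme.Hom.app_eq_appLE]

theorem top_le_preimage_fromSpecResidueField {X : Scheme.{u}} (p : X) (U : X.Opens) (hp : p ∈ U) :
    ⊤ ≤ X.fromSpecResidueField p ⁻¹ᵁ U := by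
  intro q _
  change X.fromSpecResidueField p q ∈ U
  rwa [Scheme.fromSpecResidueField_apply]

end Evaluation

/-! ### Fibres as plane curves -/

section Fibre

theorem biHom_ext {R : Type*} [Semiring R]
    {f g : MvPolynomial (Fin 3) (MvPolynomial (Fin 2) ℚ) →+* R}
    (h₁ : ∀ k, f (coef (.X k)) = g (coef (.X k))) (h₂ : ∀ k, f (.X k) = g (.X k)) : f = g := by
  refine MvPolynomial.ringHom_ext (fun q => ?_) h₂
  have : f.comp MvPolynomial.C = g.comp MvPolynomial.C :=
    MvPolynomial.ringHom_ext (fun a => hom_C_rat (f.comp MvPolynomial.C) _ a) h₁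
  exact RingHom.congr_fun this q

variable {κ : Type} [Field κ]

/-- The fibre of an embedded surface over a `κ`-point of the chart `t_i ≠ 0` of `ℙ¹` is the plane
curve whose equation is obtained by evaluating the coefficients at that point. -/
theorem exists_isHypersurface_fibre {X C : Scheme.{0}} {f : X ⟶ P1P2 ℚ}
    {F : MvPolynomial (Fin 3) (MvPolynomial (Fin 2) ℚ)} (hf : IsEmbeddingOnto f F)
    {π : X ⟶ ProjSpace ℚ 1} (h₁ : f ≫ pr₁ ℚ = π) {g : C ⟶ X} {c : C ⟶ Spec (.of κ)}
    {τ : Spec (.of κ) ⟶ ProjSpace ℚ 1} (H : IsPullback g c π τ) {i : Fin 2}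
    (e : ⊤ ≤ τ ⁻¹ᵁ chart ℚ i) (ev : MvPolynomial (Fin 2) ℚ →+* κ)
    (hev : ∀ k, (τ.appLE (chart ℚ i) ⊤ e).hom (coord ℚ i k) =
      (Scheme.ΓSpecIso (.of κ)).inv.hom (ev (.X k))) :
    ∃ ι : C ⟶ ProjSpace κ 2, ι ≫ projSpaceToSpec κ 2 = c ∧
      IsHypersurface ι (MvPolynomial.map ev F) := by
  obtain ⟨β, hβ, hpb⟩ := exists_baseChange (r := 2) (τ ≫ projSpaceToSpec ℚ 1)
  let v : ProjSpace κ 2 ⟶ P1P2 ℚ :=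
    pullback.lift (projSpaceToSpec κ 2 ≫ τ) β (hom_SpecRat_ext _ _)
  have hv₁ : v ≫ pr₁ ℚ = projSpaceToSpec κ 2 ≫ τ := pullback.lift_fst _ _ _
  have hv₂ : v ≫ pr₂ ℚ = β := pullback.lift_snd _ _ _
  -- `ℙ²_κ` is the fibre of `ℙ¹ × ℙ²` over the given point of `ℙ¹`.
  have Hv : IsPullback v (projSpaceToSpec κ 2) (pr₁ ℚ) τ := by
    refine .of_right (h₁₂ := pr₂ ℚ) (h₂₂ := projSpaceToSpec ℚ 1) ?_ hv₁
      (IsPullback.of_hasPullback _ _).flip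
    rwa [hv₂]
  subst h₁
  let ι : C ⟶ ProjSpace κ 2 := Hv.lift (g ≫ f) c (by rw [Category.assoc]; exact H.w)
  have hι : ι ≫ projSpaceToSpec κ 2 = c := Hv.lift_snd _ _ _
  have hιv : ι ≫ v = g ≫ f := Hv.lift_fst _ _ _
  have Hι : IsPullback g ι f v := .of_bot (by rwa [hι]) hιv.symm Hv
  have hcl := hf.1
  refine ⟨ι, hι, MorphismProperty.of_isPullback Hι hcl, fun j => ?_⟩
  have hle : chart κ j ≤ v ⁻¹ᵁ biChart ℚ i j := by
    rw [biChart, Scheme.Hom.preimage_inf, ← Scheme.Hom.comp_preimage, ← Scheme.Hom.comp_preimage,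
      hv₁, hv₂]
    exact le_inf (fun p _ => e trivial) (hβ j).1
  rw [ker_app_of_isPullback Hι (isAffineOpen_biChart ℚ i j) (isAffineOpen_chart κ j) hle, hf.2 i j,
    Ideal.map_span, Set.image_singleton, dehomogenize_eq_dehom, biDehomogenize_eq]
  have key : (v.appLE (biChart ℚ i j) (chart κ j) hle).hom.comp (biDehom ℚ i j) =
      (dehom _ (X_mem_homogeneousSubmodule κ j)).comp (MvPolynomial.map ev) := by
    refine biHom_ext (fun k => ?_) fun k => ?_
    · rw [RingHom.comp_apply, RingHom.comp_apply, biDehom, MvPolynomial.coe_eval₂Hom,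
        MvPolynomial.eval₂_C, MvPolynomial.coe_eval₂Hom, MvPolynomial.eval₂_X, MvPolynomial.map_C]
      have h1 := appLE_comp_appLE_eq hv₁ (T := chart ℚ i) (U := biChart ℚ i j) (V := ⊤)
        (O := chart κ j) inf_le_left e hle le_top
      refine (congrArg (fun z => z.hom (coord ℚ i k)) h1).trans ?_
      refine (congrArg ((projSpaceToSpec κ 2).appLE ⊤ (chart κ j) le_top).hom (hev k)).trans ?_
      exact RingHom.congr_fun (scalars_eq_dehom _ (X_mem_homogeneousSubmodule κ j)) (ev (.X k))
    · rw [RingHom.comp_apply, RingHom.comp_apply, biDehom, MvPolynomial.coe_eval₂Hom,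
        MvPolynomial.eval₂_X, MvPolynomial.map_X]
      have h1 : (pr₂ ℚ).appLE (chart ℚ j) (biChart ℚ i j) inf_le_right ≫
          v.appLE (biChart ℚ i j) (chart κ j) hle = β.appLE (chart ℚ j) (chart κ j) (hβ j).1 :=
        (Scheme.Hom.appLE_comp_appLE ..).trans (appLE_congr_hom hv₂ _ _)
      refine (congrArg (fun z => z.hom (coord ℚ j k)) h1).trans (((hβ j).2 k).trans ?_)
      rw [dehom_of_mem _ _ (X_mem_homogeneousSubmodule κ k)]
      rfl
  exact congrArg (fun z => Ideal.span {z}) (RingHom.congr_fun key F)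

end Fibre

/-! ### Smoothness of plane conics -/

section Conic

theorem ker_comp_eq_span {A B C : Type*} [CommRing A] [CommRing B] [CommRing C] {d : A →+* B}
    {e : B →+* C} (hd : Function.Surjective d) {q r : A} (he : RingHom.ker e = Ideal.span {d q})
    (hr : RingHom.ker d = Ideal.span {r}) : RingHom.ker (e.comp d) = Ideal.span {q, r} := by
  rw [← RingHom.comap_ker, he, Ideal.span_insert, ← hr, ← Set.image_singleton, ← Ideal.map_span,
    Ideal.comap_map_of_surjective' d hd]

/-- Over an algebraically closed field, a ternary quadratic form has a zero, already on the line
`x₂ = 0`. -/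
theorem exists_ne_zero_of_quad {k : Type*} [Field k] [IsAlgClosed k]
    {M : Matrix (Fin 3) (Fin 3) k} (hM : M.IsSymm) :
    ∃ v : Fin 3 → k, v ≠ 0 ∧ ∑ a, ∑ b, M a b * v a * v b = 0 := by
  have h1 : M 1 0 = M 0 1 := hM.apply 0 1
  by_cases h : M 0 0 = 0
  · exact ⟨![1, 0, 0], by simp [← Matrix.cons_zero_zero], by simp [Fin.sum_univ_three, h]⟩
  · obtain ⟨r, hr⟩ := IsAlgClosed.exists_pow_nat_eq (M 0 1 ^ 2 - M 0 0 * M 1 1) two_pos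
    refine ⟨![r - M 0 1, M 0 0, 0], fun h0 => h (congrFun h0 1), ?_⟩
    simp [Fin.sum_univ_three, h1]
    linear_combination M 0 0 * hr

variable {κ : Type} [Field κ] {C : Scheme.{0}} {ι : C ⟶ ProjSpace κ 2}
  {M : Matrix (Fin 3) (Fin 3) κ}

/-- The functions on the chart `x_j ≠ 0` of a plane curve, as a quotient of the polynomial ring. -/
def curveHom (ι : C ⟶ ProjSpace κ 2) (j : Fin 3) :
    MvPolynomial (Fin 3) κ →+* Γ(C, ι ⁻¹ᵁ chart κ j) :=
  (ι.app (chart κ j)).hom.comp (dehom _ (X_mem_homogeneousSubmodule κ j))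

section

variable {q : MvPolynomial (Fin 3) κ} (hι : IsHypersurface ι q)

include hι

theorem curveHom_surjective (j : Fin 3) : Function.Surjective (curveHom ι j) := by
  have := hι.1
  exact (ι.app_surjective _ (isAffineOpen_chart κ j)).comp (dehom_surjective _ _)

theorem ker_curveHom (j : Fin 3) : RingHom.ker (curveHom ι j) = Ideal.span {q, .X j - 1} :=
  ker_comp_eq_span (dehom_surjective _ _)
    ((hι.2 j).trans (by rw [dehomogenize_eq_dehom])) (ker_dehom _ _)

theorem isAffineOpen_preimage_chart (j : Fin 3) : IsAffineOpen (ι ⁻¹ᵁ chart κ j) := by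
  have := hι.1
  exact (isAffineOpen_chart κ j).preimage ι

end

theorem scalars_eq_curveHom (j : Fin 3) :
    scalars (ι ≫ projSpaceToSpec κ 2) (ι ⁻¹ᵁ chart κ j) = (curveHom ι j).comp MvPolynomial.C := by
  ext a
  rw [← appLE_scalars κ ι (projSpaceToSpec κ 2) (le_refl (ι ⁻¹ᵁ chart κ j)), projSpaceToSpec,
    scalars_eq_dehom _ (X_mem_homogeneousSubmodule κ j), ← Scheme.Hom.app_eq_appLE]
  rfl

theorem iSup_preimage_chart : ⨆ j, ι ⁻¹ᵁ chart κ j = ⊤ := by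
  rw [← Scheme.Hom.preimage_iSup, iSup_chart, Scheme.Hom.preimage_top]

theorem smooth_of_det_ne_zero [CharZero κ] (hι : IsHypersurface ι (quad M)) (hM : M.IsSymm)
    (hdet : M.det ≠ 0) : Smooth (ι ≫ projSpaceToSpec κ 2) := by
  have : SmoothOfRelativeDimension 1 (ι ≫ projSpaceToSpec κ 2) := by
    refine smoothOfRelativeDimension_of_charts _ (fun j => ι ⁻¹ᵁ chart κ j)
      (isAffineOpen_preimage_chart hι) iSup_preimage_chart fun j => ?_
    rw [scalars_eq_curveHom]
    exact locally_isStandardSmooth _ (curveHom_surjective hι j) _ j (ker_curveHom hι j)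
      (jacobian_quad hM hdet j)
  exact SmoothOfRelativeDimension.smooth 1 _

theorem not_smooth_of_det_eq_zero [CharZero κ] (hι : IsHypersurface ι (quad M)) (hM : M.IsSymm)
    (hM0 : M ≠ 0) (hdet : M.det = 0) : ¬ Smooth (ι ≫ projSpaceToSpec κ 2) := by
  intro hs
  obtain ⟨v, hv0, hv⟩ := Matrix.exists_mulVec_eq_zero_iff.mpr hdet
  obtain ⟨j, hj⟩ := Function.ne_iff.mp hv0
  have h := smooth_scalars (ι ≫ projSpaceToSpec κ 2) (isAffineOpen_preimage_chart hι j)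
  let := (scalars (ι ≫ projSpaceToSpec κ 2) (ι ⁻¹ᵁ chart κ j)).toAlgebra
  have h' : Algebra.Smooth κ Γ(C, ι ⁻¹ᵁ chart κ j) := h
  let θ : MvPolynomial (Fin 3) κ →ₐ[κ] Γ(C, ι ⁻¹ᵁ chart κ j) :=
    { curveHom ι j with
      commutes' := fun a => (RingHom.congr_fun (scalars_eq_curveHom (ι := ι) j) a).symm }
  refine not_formallySmooth_quad hM hM0 (v := fun b => v b / v j) (fun a => ?_)
    (div_self hj) θ (curveHom_surjective hι j) (ker_curveHom hι j) h'.formallySmooth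
  have := congrFun hv a
  simp only [Matrix.mulVec, dotProduct, Pi.zero_apply] at this
  rw [← zero_div (v j), ← this, Finset.sum_div]
  exact Finset.sum_congr rfl fun b _ => (mul_div_assoc _ _ _).symm

theorem nonempty_of_quad (hι : IsHypersurface ι (quad M)) (hM : M.IsSymm) : Nonempty C := by
  obtain ⟨v, hv0, hv⟩ := exists_ne_zero_of_quad (hM.map (algebraMap κ (AlgebraicClosure κ)))
  obtain ⟨j, hj⟩ := Function.ne_iff.mp hv0
  by_contra hC
  rw [not_nonempty_iff] at hC
  have h1 : (1 : MvPolynomial (Fin 3) κ) ∈ RingHom.ker (curveHom ι j) := by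
    rw [RingHom.mem_ker]
    exact Subsingleton.elim _ _
  have h2 : RingHom.ker (curveHom ι j) ≤
      RingHom.ker (MvPolynomial.aeval (R := κ) fun b => v b / v j).toRingHom := by
    rw [ker_curveHom hι j, Ideal.span_le]
    rintro _ (rfl | rfl)
    · have h3 : ∑ a, ∑ b, algebraMap κ (AlgebraicClosure κ) (M a b) * (v a / v j) * (v b / v j) =
          (∑ a, ∑ b, algebraMap κ (AlgebraicClosure κ) (M a b) * v a * v b) / (v j * v j) := by
        simp only [Finset.sum_div]
        refine Finset.sum_congr rfl fun a _ => Finset.sum_congr rfl fun b _ => ?_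
        field_simp
      refine Eq.trans ?_ (h3.trans ?_)
      · simp [quad]
      · simp only [Matrix.map_apply] at hv
        rw [hv, zero_div]
    · simp [RingHom.mem_ker, div_self hj]
  have h4 := h2 h1
  rw [RingHom.mem_ker, map_one] at h4
  exact one_ne_zero h4

end Conic

/-! ### Bidegree and symmetric matrix of a quadratic form over `ℚ[s, t]` -/

section QuadraticForm

theorem coeff_quad_mem {R : Type*} [CommRing R] (N : AddSubgroup R) {M : Matrix (Fin 3) (Fin 3) R}
    (h : ∀ a b, M a b ∈ N) (e : Fin 3 →₀ ℕ) : (quad M).coeff e ∈ N := by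
  rw [quad, MvPolynomial.coeff_sum]
  refine sum_mem fun a _ => ?_
  rw [MvPolynomial.coeff_sum]
  refine sum_mem fun b _ => ?_
  rw [mul_assoc, MvPolynomial.coeff_C_mul, MvPolynomial.X, MvPolynomial.X,
    MvPolynomial.monomial_mul, MvPolynomial.coeff_monomial]
  split_ifs
  · simpa using h a b
  · simp [N.zero_mem]

theorem quad_ne_zero {R : Type*} [CommRing R] [NoZeroDivisors R] [CharZero R]
    {M : Matrix (Fin 3) (Fin 3) R} (hM : M.IsSymm) (hM0 : M ≠ 0) : quad M ≠ 0 := by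
  intro h
  apply hM0
  ext i j
  have h1 := coeff_quad M i j
  rw [h, MvPolynomial.coeff_zero] at h1
  split_ifs at h1 with hij
  · subst hij
    exact h1.symm
  · rw [hM.apply i j, ← two_mul, eq_comm, mul_eq_zero] at h1
    exact h1.resolve_left two_ne_zero

variable {M : Matrix (Fin 3) (Fin 3) (MvPolynomial (Fin 2) ℚ)}

theorem isBidegreeTwoTwo_quad (h : ∀ a b, (M a b).IsHomogeneous 2) : IsBidegreeTwoTwo (quad M) :=
  ⟨quad_isHomogeneous M,
    coeff_quad_mem (MvPolynomial.homogeneousSubmodule (Fin 2) ℚ 2).toAddSubgroup h⟩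

theorem gramMatrix_quad (hM : M.IsSymm) : gramMatrix (quad M) = M := by
  ext1 i j
  rw [gramMatrix, Matrix.of_apply]
  split_ifs with h
  · subst h
    have : (Finsupp.single i 2 : Fin 3 →₀ ℕ) = Finsupp.single i 1 + Finsupp.single i 1 := by
      rw [← Finsupp.single_add]
    rw [this, coeff_quad, if_pos rfl]
  · rw [coeff_quad, if_neg h, hM.apply i j, ← two_mul, ← mul_assoc, ← map_ofNat MvPolynomial.C 2,
      ← MvPolynomial.C_mul]
    norm_num

theorem det_isHomogeneous (h : ∀ a b, (M a b).IsHomogeneous 2) : M.det.IsHomogeneous 6 := by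
  have h3 (a b c d e f) : (M a b * M c d * M e f) ∈ MvPolynomial.homogeneousSubmodule (Fin 2) ℚ 6 :=
    ((h a b).mul (h c d)).mul (h e f)
  rw [Matrix.det_fin_three]
  change _ ∈ MvPolynomial.homogeneousSubmodule (Fin 2) ℚ 6
  exact sub_mem (add_mem (add_mem (sub_mem (sub_mem (h3 ..) (h3 ..)) (h3 ..)) (h3 ..)) (h3 ..))
    (h3 ..)

end QuadraticForm

/-! ### From a factorisation to a conic bundle -/

section Evaluation

variable {i : Fin 2} {p : ProjSpace ℚ 1} (hp : p ∈ chart ℚ i)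

/-- The value `q(t_0 / t_i, t_1 / t_i)` of a polynomial `q` at a point of the chart `t_i ≠ 0`. -/
def valueAt : MvPolynomial (Fin 2) ℚ →+* (ProjSpace ℚ 1).residueField p :=
  ((ProjSpace ℚ 1).evaluation (chart ℚ i) p hp).hom.comp
    (dehom _ (X_mem_homogeneousSubmodule ℚ i))

theorem valueAt_X (k : Fin 2) :
    valueAt hp (.X k) = (ProjSpace ℚ 1).evaluation (chart ℚ i) p hp (coord ℚ i k) := by
  rw [valueAt, RingHom.comp_apply, dehom_of_mem _ _ (X_mem_homogeneousSubmodule ℚ k)]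
  rfl

theorem valueAt_X_self : valueAt hp (.X i) = 1 := by
  rw [valueAt_X, coord_self]
  exact map_one ((ProjSpace ℚ 1).evaluation (chart ℚ i) p hp).hom

theorem valueAt_eq_zero_iff {d : ℕ} {q : MvPolynomial (Fin 2) ℚ} (hq : q.IsHomogeneous d) :
    valueAt hp q = 0 ↔ p ∉ nonvanishing ℚ q := by
  refine ((ProjSpace ℚ 1).evaluation_eq_zero_iff_notMem_basicOpen p hp _).trans (not_congr ?_)
  rw [basicOpen_dehom _ (X_mem_homogeneousSubmodule ℚ i) hq]
  exact ⟨fun h => h.2, fun h => ⟨hp, h⟩⟩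

instance (p : ProjSpace ℚ 1) : CharZero ((ProjSpace ℚ 1).residueField p) := by
  have hp : p ∈ (⊤ : (ProjSpace ℚ 1).Opens) := trivial
  rw [← iSup_chart ℚ] at hp
  obtain ⟨i, hi⟩ := TopologicalSpace.Opens.mem_iSup.mp hp
  exact charZero_of_injective_ringHom ((valueAt hi).comp MvPolynomial.C).injective

end Evaluation

namespace Factorisation

variable {n : ℚ} (D : Factorisation n)

/-- The hypothesis `hM0` says that the entries of the matrix have no common zero on `ℙ¹`, so that no
fibre is the whole plane. -/
theorem hasConicBundle (hn : n ≠ 0) {M : Matrix (Fin 3) (Fin 3) (MvPolynomial (Fin 2) ℚ)}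
    (hM : M.IsSymm) (hdeg : ∀ a b, (M a b).IsHomogeneous 2)
    (hM0 : ∀ i, ∃ N, MvPolynomial.X i ^ N ∈
      Ideal.span (Set.range fun a : Fin 3 × Fin 3 => M a.1 a.2))
    (hF : D.form = quad M) : HasConicBundle n (D.tuple 0 0) (D.tuple 0 1) D.form M.det := by
  obtain ⟨π, hπ⟩ := D.exists_isPi
  obtain ⟨φ, hφ⟩ := exists_isPhi n
  let f : Surface n ⟶ P1P2 ℚ := pullback.lift π φ (hom_SpecRat_ext _ _)
  have h₁ : f ≫ pr₁ ℚ = π := pullback.lift_fst _ _ _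
  have h₂ : f ≫ pr₂ ℚ = φ := pullback.lift_snd _ _ _
  have hf := D.isEmbeddingOnto hπ hφ h₁ h₂
  -- The fibre over `p` is the conic of the matrix evaluated at `p`.
  have key (p : ProjSpace ℚ 1) : ∃ M' : Matrix (Fin 3) (Fin 3) ((ProjSpace ℚ 1).residueField p),
      M'.IsSymm ∧ M' ≠ 0 ∧ (M'.det = 0 ↔ p ∉ nonvanishing ℚ M.det) ∧
      ∃ ι : π.fiber p ⟶ ProjSpace ((ProjSpace ℚ 1).residueField p) 2,
        ι ≫ projSpaceToSpec _ 2 = π.fiberToSpecResidueField p ∧ IsHypersurface ι (quad M') := by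
    have hp : p ∈ (⊤ : (ProjSpace ℚ 1).Opens) := trivial
    rw [← iSup_chart ℚ] at hp
    obtain ⟨i, hi⟩ := TopologicalSpace.Opens.mem_iSup.mp hp
    refine ⟨M.map (valueAt hi), hM.map _, fun h0 => ?_, ?_, ?_⟩
    · obtain ⟨N, hN⟩ := hM0 i
      have hle : Ideal.span (Set.range fun a : Fin 3 × Fin 3 => M a.1 a.2) ≤
          RingHom.ker (valueAt hi) := by
        rw [Ideal.span_le]
        rintro _ ⟨a, rfl⟩
        exact congrFun (congrFun h0 a.1) a.2
      have h1 := hle hN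
      rw [RingHom.mem_ker, map_pow, valueAt_X_self, one_pow] at h1
      exact one_ne_zero h1
    · rw [← valueAt_eq_zero_iff hi (det_isHomogeneous hdeg), RingHom.map_det]
      rfl
    · rw [← map_quad, ← hF]
      have e := top_le_preimage_fromSpecResidueField p (chart ℚ i) hi
      refine exists_isHypersurface_fibre hf h₁ (IsPullback.of_hasPullback π _) e (valueAt hi) ?_
      intro k
      refine (congrArg (fun z => z.hom (coord ℚ i k)) (appLE_fromSpecResidueField p _ hi e)).trans
        (congrArg ((Scheme.ΓSpecIso ((ProjSpace ℚ 1).residueField p)).inv.hom)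
          (valueAt_X hi k).symm)
  have hsurj : Function.Surjective π := by
    intro p
    obtain ⟨M', hM', -, -, ι, -, hι⟩ := key p
    obtain ⟨q⟩ := nonempty_of_quad hι hM'
    have : π.fiberι p q ∈ π ⁻¹' {p} := π.range_fiberι p ▸ Set.mem_range_self q
    exact ⟨_, this⟩
  have hAB : ![D.tuple 0 0, D.tuple 0 1] = D.tuple 0 := by
    ext1 k
    fin_cases k <;> rfl
  refine ⟨hF ▸ isBidegreeTwoTwo_quad hdeg, by rw [hF, gramMatrix_quad hM], π, φ, f,
    ⟨isSmoothProjectiveSurface hn, hom_SpecRat_ext _ _, ⟨hsurj.denseRange⟩, fun p => ?_⟩,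
    hAB ▸ D.isGivenBy_pi hπ, hom_SpecRat_ext _ _, isGivenBy_phi hφ, h₁, h₂, hf, fun p => ?_⟩
  · obtain ⟨M', hM', hM'0, -, ι, h, hι⟩ := key p
    exact ⟨quad M', quad_isHomogeneous M', quad_ne_zero hM' hM'0, ι, h, hι⟩
  · obtain ⟨M', hM', hM'0, hdet, ι, h, hι⟩ := key p
    rw [← hdet, ← h]
    refine ⟨fun hs => ?_, not_smooth_of_det_eq_zero hι hM' hM'0⟩
    by_contra h0
    exact hs (smooth_of_det_ne_zero hι hM' h0)

end Factorisation

/-! ### Factorisations given by matrices -/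

section Matrices

/-- The binary form `α s² + β s t + γ t²`. -/
def binaryForm (α β γ : ℚ) : MvPolynomial (Fin 2) ℚ :=
  const α * s ^ 2 + const β * (s * t) + const γ * t ^ 2

theorem binaryForm_isHomogeneous (α β γ : ℚ) : (binaryForm α β γ).IsHomogeneous 2 := by
  have hs := MvPolynomial.isHomogeneous_X ℚ (0 : Fin 2)
  have ht := MvPolynomial.isHomogeneous_X ℚ (1 : Fin 2)
  exact (((hs.pow 2).C_mul α).add ((hs.mul ht).C_mul β)).add ((ht.pow 2).C_mul γ)

theorem const_mul_binaryForm (c α β γ : ℚ) :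
    const c * binaryForm α β γ = binaryForm (c * α) (c * β) (c * γ) := by
  simp only [binaryForm, const, map_mul]
  ring

theorem binaryForm_add (α β γ α' β' γ' : ℚ) :
    binaryForm α β γ + binaryForm α' β' γ' = binaryForm (α + α') (β + β') (γ + γ') := by
  simp only [binaryForm, const, map_add]
  ring

/-- The matrix of the quadratic form `a s² + 2 b s t + c t²`, for `a`, `b`, `c` with matrices `Ma`,
`Mb`, `Mc`. -/
def pencil (Ma Mb Mc : Matrix (Fin 3) (Fin 3) ℚ) :
    Matrix (Fin 3) (Fin 3) (MvPolynomial (Fin 2) ℚ) :=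
  Matrix.of fun i j => binaryForm (Ma i j) (2 * Mb i j) (Mc i j)

theorem quad_eq {R : Type*} [CommRing R] {M : Matrix (Fin 3) (Fin 3) R} (hM : M.IsSymm) :
    quad M = .C (M 0 0) * .X 0 ^ 2 + .C (M 1 1) * .X 1 ^ 2 + .C (M 2 2) * .X 2 ^ 2 +
      .C (2 * M 0 1) * (.X 0 * .X 1) + .C (2 * M 0 2) * (.X 0 * .X 2) +
      .C (2 * M 1 2) * (.X 1 * .X 2) := by
  have h1 : M 1 0 = M 0 1 := hM.apply 0 1
  have h2 : M 2 0 = M 0 2 := hM.apply 0 2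
  have h3 : M 2 1 = M 1 2 := hM.apply 1 2
  simp only [quad, Fin.sum_univ_three, h1, h2, h3, map_mul, map_ofNat]
  ring

namespace Factorisation

variable {n : ℚ} (D : Factorisation n)

theorem form_eq_quad {Ma Mb Mc : Matrix (Fin 3) (Fin 3) ℚ} (ha : D.a = quad Ma)
    (hb : D.b = quad Mb) (hc : D.c = quad Mc) : D.form = quad (pencil Ma Mb Mc) := by
  rw [form, ha, hb, hc, inclBi, map_quad, map_quad, map_quad]
  simp only [quad, Fin.sum_univ_three, pencil, binaryForm, Matrix.of_apply, Matrix.map_apply,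
    map_add, map_mul, map_pow, map_ofNat]
  ring

end Factorisation

/-- A factorisation given by the matrices of `a`, `b`, `c` yields a conic bundle with
`(A, B) = (-c, b + ew)`. -/
theorem hasConicBundle_of_matrices {n : ℚ} (hn : n ≠ 0) {Ma Mb Mc : Matrix (Fin 3) (Fin 3) ℚ}
    (hMa : Ma.IsSymm) (hMb : Mb.IsSymm) (hMc : Mc.IsSymm) {e : ℚ} (he : e * e = 1)
    (disc : quad Mb ^ 2 - quad Ma * quad Mc = quartic n)
    (noZero : ∀ l, ∃ N, MvPolynomial.X l ^ N ∈ Ideal.span {quad Ma, quad Mb, quad Mc})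
    (hspan : ∀ i, ∃ N, MvPolynomial.X i ^ N ∈
      Ideal.span (Set.range fun a : Fin 3 × Fin 3 => pencil Ma Mb Mc a.1 a.2)) :
    HasConicBundle n (-inclXYZ (quad Mc)) (inclXYZ (quad Mb) + .C e * w)
      (quad (pencil Ma Mb Mc)) (pencil Ma Mb Mc).det := by
  let D : Factorisation n :=
    { a := quad Ma, b := quad Mb, c := quad Mc, e := e, ha := quad_isHomogeneous _,
      hb := quad_isHomogeneous _, hc := quad_isHomogeneous _, he := he, disc := disc,
      noZero := noZero }
  have hF : D.form = quad (pencil Ma Mb Mc) := D.form_eq_quad rfl rfl rfl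
  have hM : (pencil Ma Mb Mc).IsSymm := Matrix.IsSymm.ext fun i j => by
    simp only [pencil, Matrix.of_apply, hMa.apply i j, hMb.apply i j, hMc.apply i j]
  have h := D.hasConicBundle hn hM (fun a b => binaryForm_isHomogeneous _ _ _) hspan hF
  have h0 : D.tuple 0 0 = -inclXYZ (quad Mc) := rfl
  have h1 : D.tuple 0 1 = inclXYZ (quad Mb) + .C e * w := rfl
  rwa [hF, h0, h1] at h

theorem mem_span_triple {R : Type*} [CommRing R] {a b c p : R} (u v w : R)
    (h : u * a + v * b + w * c = p) : p ∈ Ideal.span {a, b, c} :=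
  h ▸ add_mem (add_mem (Ideal.mul_mem_left _ u (Ideal.subset_span (by simp)))
    (Ideal.mul_mem_left _ v (Ideal.subset_span (by simp))))
    (Ideal.mul_mem_left _ w (Ideal.subset_span (by simp)))

/-- The entries of the matrix have no common zero on `ℙ¹` if `s²` and `t²` are rational linear
combinations of two of them. -/
theorem pow_mem_span_pencil {Ma Mb Mc : Matrix (Fin 3) (Fin 3) ℚ} (a b : Fin 3 × Fin 3)
    (u v u' v' : ℚ)
    (h₁ : const u * pencil Ma Mb Mc a.1 a.2 + const v * pencil Ma Mb Mc b.1 b.2 =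
      binaryForm 1 0 0)
    (h₂ : const u' * pencil Ma Mb Mc a.1 a.2 + const v' * pencil Ma Mb Mc b.1 b.2 =
      binaryForm 0 0 1) (i : Fin 2) : ∃ N, MvPolynomial.X i ^ N ∈
      Ideal.span (Set.range fun a : Fin 3 × Fin 3 => pencil Ma Mb Mc a.1 a.2) := by
  let M (a : Fin 3 × Fin 3) := pencil Ma Mb Mc a.1 a.2
  have key (u v : ℚ) := add_mem
    (Ideal.mul_mem_left _ (const u) (Ideal.subset_span (Set.mem_range_self (f := M) a)))
    (Ideal.mul_mem_left _ (const v) (Ideal.subset_span (Set.mem_range_self (f := M) b)))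
  refine ⟨2, ?_⟩
  obtain rfl | rfl : i = 0 ∨ i = 1 := by omega
  · have h := h₁ ▸ key u v
    simpa [binaryForm] using h
  · have h := h₂ ▸ key u' v'
    simpa [binaryForm] using h

end Matrices

/-! ### The four families -/

section Cases

theorem C_two {σ R : Type*} [CommSemiring R] : (.C 2 : MvPolynomial σ R) = 2 := map_ofNat _ 2

theorem C_four {σ R : Type*} [CommSemiring R] : (.C 4 : MvPolynomial σ R) = 4 := map_ofNat _ 4

/-- The relation that determines the constant `a⁻¹`. Identities between polynomials with inverse
constants are derived from it, with the inverses as further indeterminates. -/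
theorem C_inv_mul_C {σ : Type*} {a : ℚ} (ha : a ≠ 0) :
    (.C a⁻¹ : MvPolynomial σ ℚ) * .C a = 1 := by
  rw [← MvPolynomial.C_mul, inv_mul_cancel₀ ha, MvPolynomial.C_1]

theorem C_inv_two_mul_two {σ : Type*} : (.C 2⁻¹ : MvPolynomial σ ℚ) * 2 = 1 :=
  C_two (σ := σ) (R := ℚ) ▸ C_inv_mul_C two_ne_zero

theorem inclXYZ_X_zero : inclXYZ (.X 0) = x := inclXYZ_X 0

theorem inclXYZ_X_one : inclXYZ (.X 1) = y := inclXYZ_X 1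

theorem inclXYZ_X_two : inclXYZ (.X 2) = z := inclXYZ_X 2

variable {m : ℚ} (hm : m ≠ 0)

include hm

/-- The factorisation `x⁴ + 4m⁴z⁴ = (x² - 2mxz + 2m²z²)(x² + 2mxz + 2m²z²)`, with `b = -y²`. -/
theorem hasConicBundle_neg_four_mul_pow_four :
    HasConicBundle (-4 * m ^ 4)
      (x ^ 2 + 2 * MvPolynomial.C m * x * z + 2 * MvPolynomial.C m ^ 2 * z ^ 2)
      (w - y ^ 2)
      (coef (s ^ 2 - t ^ 2) * x₀ ^ 2 - coef (2 * s * t) * x₁ ^ 2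
        - coef (2 * const m * (s ^ 2 + t ^ 2)) * x₀ * x₂
        + coef (2 * const m ^ 2 * (s ^ 2 - t ^ 2)) * x₂ ^ 2)
      (-2 * const m ^ 2 * s * t * (s ^ 2 - 2 * s * t - t ^ 2) * (s ^ 2 + 2 * s * t - t ^ 2)) := by
  have hi : (.C m⁻¹ : MvPolynomial (Fin 3) ℚ) * .C m = 1 := C_inv_mul_C hm
  have h2 : (.C 2⁻¹ : MvPolynomial (Fin 3) ℚ) * 2 = 1 := C_inv_two_mul_two
  have ha : (!![1, 0, -m; 0, 0, 0; -m, 0, 2 * m ^ 2] : Matrix (Fin 3) (Fin 3) ℚ).IsSymm := by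
    ext i j; fin_cases i <;> fin_cases j <;> rfl
  have hb : (!![0, 0, 0; 0, -1, 0; 0, 0, 0] : Matrix (Fin 3) (Fin 3) ℚ).IsSymm := by
    ext i j; fin_cases i <;> fin_cases j <;> rfl
  have hc : (!![-1, 0, -m; 0, 0, 0; -m, 0, -(2 * m ^ 2)] : Matrix (Fin 3) (Fin 3) ℚ).IsSymm := by
    ext i j; fin_cases i <;> fin_cases j <;> rfl
  have h := hasConicBundle_of_matrices (n := -4 * m ^ 4) (by simpa using hm) ha hb hc
    (one_mul (1 : ℚ)) ?_ ?_ ?_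
  · rw [quad_eq hb, quad_eq hc] at h
    convert h using 1
    · simp [map_ofNat, inclXYZ_X_zero, inclXYZ_X_two]
      ring
    · simp [inclXYZ_X_one]
      ring
    · simp [quad, Fin.sum_univ_three, pencil, binaryForm, C_two]
      ring
    · simp [Matrix.det_fin_three, pencil, binaryForm, C_two]
      ring
  · rw [quad_eq ha, quad_eq hb, quad_eq hc, quartic]
    simp [C_two, C_four]
    ring
  · intro l
    rw [quad_eq ha, quad_eq hb, quad_eq hc]
    clear ha hb hc
    refine ⟨3, ?_⟩
    fin_cases l
    · refine mem_span_triple (.C 2⁻¹ * (.X 0 + .C m * .X 2)) 0 (.C 2⁻¹ * (-.X 0 + .C m * .X 2)) ?_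
      simp [C_two]
      grind
    · refine mem_span_triple 0 (-.X 1) 0 ?_
      simp
      ring
    · refine mem_span_triple (.C 2⁻¹ ^ 2 * .C m⁻¹ ^ 2 * (.X 2 + .C 2⁻¹ * .C m⁻¹ * .X 0)) 0
        (.C 2⁻¹ ^ 2 * .C m⁻¹ ^ 2 * (-.X 2 + .C 2⁻¹ * .C m⁻¹ * .X 0)) ?_
      simp [C_two]
      grind
  · refine pow_mem_span_pencil (0, 0) (0, 2) (1 / 2) (-1 / (2 * m)) (-1 / 2) (-1 / (2 * m))
      ?_ ?_ <;>
    · simp only [pencil, Matrix.of_apply, const_mul_binaryForm, binaryForm_add]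
      congr 1 <;> simp <;> field_simp <;> norm_num

/-- The factorisation `x⁴ - m²z⁴ = (x² + mz²)(x² - mz²)`, with `b = -y²`. -/
theorem hasConicBundle_sq :
    HasConicBundle (m ^ 2)
      (x ^ 2 - MvPolynomial.C m * z ^ 2)
      (w - y ^ 2)
      (coef (s ^ 2 - t ^ 2) * x₀ ^ 2 - coef (2 * s * t) * x₁ ^ 2
        + coef (const m * (s ^ 2 + t ^ 2)) * x₂ ^ 2)
      (-2 * const m * s * t * (s - t) * (s + t) * (s ^ 2 + t ^ 2)) := by
  have hi : (.C m⁻¹ : MvPolynomial (Fin 3) ℚ) * .C m = 1 := C_inv_mul_C hm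
  have h2 : (.C 2⁻¹ : MvPolynomial (Fin 3) ℚ) * 2 = 1 := C_inv_two_mul_two
  have ha : (!![1, 0, 0; 0, 0, 0; 0, 0, m] : Matrix (Fin 3) (Fin 3) ℚ).IsSymm := by
    ext i j; fin_cases i <;> fin_cases j <;> rfl
  have hb : (!![0, 0, 0; 0, -1, 0; 0, 0, 0] : Matrix (Fin 3) (Fin 3) ℚ).IsSymm := by
    ext i j; fin_cases i <;> fin_cases j <;> rfl
  have hc : (!![-1, 0, 0; 0, 0, 0; 0, 0, m] : Matrix (Fin 3) (Fin 3) ℚ).IsSymm := by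
    ext i j; fin_cases i <;> fin_cases j <;> rfl
  have h := hasConicBundle_of_matrices (n := m ^ 2) (by simpa using hm) ha hb hc
    (one_mul 1 : (1 : ℚ) * 1 = 1) ?_ ?_ ?_
  · rw [quad_eq hb, quad_eq hc] at h
    convert h using 1
    · simp [inclXYZ_X_zero, inclXYZ_X_two]
      ring
    · simp [inclXYZ_X_one]
      ring
    · simp [quad, Fin.sum_univ_three, pencil, binaryForm, C_two]
      ring
    · simp [Matrix.det_fin_three, pencil, binaryForm, C_two]
      ring
  · rw [quad_eq ha, quad_eq hb, quad_eq hc, quartic]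
    simp
    ring
  · intro l
    rw [quad_eq ha, quad_eq hb, quad_eq hc]
    clear ha hb hc
    refine ⟨2, ?_⟩
    fin_cases l
    · refine mem_span_triple (.C 2⁻¹) 0 (-.C 2⁻¹) ?_
      simp
      grind
    · refine mem_span_triple 0 (-1) 0 ?_
      simp
    · refine mem_span_triple (.C 2⁻¹ * .C m⁻¹) 0 (.C 2⁻¹ * .C m⁻¹) ?_
      simp
      grind
  · refine pow_mem_span_pencil (0, 0) (2, 2) (1 / 2) (1 / (2 * m)) (-1 / 2) (1 / (2 * m)) ?_ ?_ <;>
    · simp only [pencil, Matrix.of_apply, const_mul_binaryForm, binaryForm_add]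
      congr 1 <;> simp <;> field_simp <;> norm_num

/-- The factorisation `x⁴ + y⁴ - 2m²z⁴ = (x² - y²)² + 2(xy + mz²)(xy - mz²)`, with `b = x² - y²` and
`e = -1`. -/
theorem hasConicBundle_two_mul_sq :
    HasConicBundle (2 * m ^ 2)
      (x * y - MvPolynomial.C m * z ^ 2)
      (x ^ 2 - y ^ 2 - w)
      (coef (2 * s * t) * x₀ ^ 2 + coef (2 * s ^ 2 - t ^ 2) * x₀ * x₁ - coef (2 * s * t) * x₁ ^ 2
        + coef (const m * (2 * s ^ 2 + t ^ 2)) * x₂ ^ 2)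
      (const (-m / 4) * (2 * s ^ 2 + t ^ 2)
        * (4 * s ^ 4 + 12 * s ^ 2 * t ^ 2 + t ^ 4)) := by
  have hi : (.C m⁻¹ : MvPolynomial (Fin 3) ℚ) * .C m = 1 := C_inv_mul_C hm
  have hq : const (-m / 4) = -(const m * const 2⁻¹ ^ 2) := by
    rw [← map_pow, ← map_mul, ← map_neg]
    congr 1
    ring
  have h2 : (.C 2⁻¹ : MvPolynomial (Fin 3) ℚ) * 2 = 1 := C_inv_two_mul_two
  have ha : (!![0, 1, 0; 1, 0, 0; 0, 0, 2 * m] : Matrix (Fin 3) (Fin 3) ℚ).IsSymm := by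
    ext i j; fin_cases i <;> fin_cases j <;> rfl
  have hb : (!![1, 0, 0; 0, -1, 0; 0, 0, 0] : Matrix (Fin 3) (Fin 3) ℚ).IsSymm := by
    ext i j; fin_cases i <;> fin_cases j <;> rfl
  have hc : (!![0, -2⁻¹, 0; -2⁻¹, 0, 0; 0, 0, m] : Matrix (Fin 3) (Fin 3) ℚ).IsSymm := by
    ext i j; fin_cases i <;> fin_cases j <;> rfl
  have h := hasConicBundle_of_matrices (n := 2 * m ^ 2) (by simpa using hm) ha hb hc
    (by norm_num : (-1 : ℚ) * -1 = 1) ?_ ?_ ?_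
  · rw [quad_eq hb, quad_eq hc] at h
    convert h using 1
    · simp [inclXYZ_X_zero, inclXYZ_X_one, inclXYZ_X_two]
      ring
    · simp [inclXYZ_X_zero, inclXYZ_X_one]
      ring
    · have h4 : (coef (const 2⁻¹)) * 2 = 1 := by
        rw [← map_ofNat MvPolynomial.C 2, ← map_mul, C_inv_two_mul_two, map_one]
      simp [quad, Fin.sum_univ_three, pencil, binaryForm, C_two]
      linear_combination coef t ^ 2 * x₀ * x₁ * h4
    · have h4 : const 2⁻¹ * 2 = 1 := C_inv_two_mul_two
      rw [hq]
      simp [Matrix.det_fin_three, pencil, binaryForm, C_two]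
      clear h ha hb hc h2 hi
      grind
  · rw [quad_eq ha, quad_eq hb, quad_eq hc, quartic]
    clear ha hb hc
    simp [C_two]
    grind
  · intro l
    rw [quad_eq ha, quad_eq hb, quad_eq hc]
    clear ha hb hc
    refine ⟨3, ?_⟩
    fin_cases l
    · refine mem_span_triple (.C 2⁻¹ ^ 2 * .X 1) (.X 0) (-.C 2⁻¹ * .X 1) ?_
      simp [C_two]
      grind
    · refine mem_span_triple (.C 2⁻¹ ^ 2 * .X 0) (-.X 1) (-.C 2⁻¹ * .X 0) ?_
      simp [C_two]
      grind
    · refine mem_span_triple (.C 2⁻¹ ^ 2 * .C m⁻¹ * .X 2) 0 (.C 2⁻¹ * .C m⁻¹ * .X 2) ?_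
      simp [C_two]
      grind
  · refine pow_mem_span_pencil (0, 1) (2, 2) (1 / 2) (1 / (4 * m)) (-1) (1 / (2 * m)) ?_ ?_ <;>
    · simp only [pencil, Matrix.of_apply, const_mul_binaryForm, binaryForm_add]
      congr 1 <;> simp <;> field_simp <;> norm_num

/-- The factorisation `x⁴ + y⁴ + 2m²z⁴ = (x² + y²)² - 2(xy + mz²)(xy - mz²)`, with `b = x² + y²` and
`e = -1`. -/
theorem hasConicBundle_neg_two_mul_sq :
    HasConicBundle (-2 * m ^ 2)
      (x * y - MvPolynomial.C m * z ^ 2)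
      (x ^ 2 + y ^ 2 - w)
      (coef (2 * s * t) * x₀ ^ 2 - coef (2 * s ^ 2 + t ^ 2) * x₀ * x₁ + coef (2 * s * t) * x₁ ^ 2
        - coef (const m * (2 * s ^ 2 - t ^ 2)) * x₂ ^ 2)
      (const (m / 4) * (2 * s ^ 2 - t ^ 2)
        * (2 * s ^ 2 - 4 * s * t + t ^ 2) * (2 * s ^ 2 + 4 * s * t + t ^ 2)) := by
  have hi : (.C m⁻¹ : MvPolynomial (Fin 3) ℚ) * .C m = 1 := C_inv_mul_C hm
  have hq : const (m / 4) = const m * const 2⁻¹ ^ 2 := by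
    rw [← map_pow, ← map_mul]
    congr 1
    ring
  have h2 : (.C 2⁻¹ : MvPolynomial (Fin 3) ℚ) * 2 = 1 := C_inv_two_mul_two
  have ha : (!![0, -1, 0; -1, 0, 0; 0, 0, -(2 * m)] : Matrix (Fin 3) (Fin 3) ℚ).IsSymm := by
    ext i j; fin_cases i <;> fin_cases j <;> rfl
  have hb : (!![1, 0, 0; 0, 1, 0; 0, 0, 0] : Matrix (Fin 3) (Fin 3) ℚ).IsSymm := by
    ext i j; fin_cases i <;> fin_cases j <;> rfl
  have hc : (!![0, -2⁻¹, 0; -2⁻¹, 0, 0; 0, 0, m] : Matrix (Fin 3) (Fin 3) ℚ).IsSymm := by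
    ext i j; fin_cases i <;> fin_cases j <;> rfl
  have h := hasConicBundle_of_matrices (n := -2 * m ^ 2) (by simpa using hm) ha hb hc
    (by norm_num : (-1 : ℚ) * -1 = 1) ?_ ?_ ?_
  · rw [quad_eq hb, quad_eq hc] at h
    convert h using 1
    · simp [inclXYZ_X_zero, inclXYZ_X_one, inclXYZ_X_two]
      ring
    · simp [inclXYZ_X_zero, inclXYZ_X_one]
      ring
    · have h4 : (coef (const 2⁻¹)) * 2 = 1 := by
        rw [← map_ofNat MvPolynomial.C 2, ← map_mul, C_inv_two_mul_two, map_one]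
      simp [quad, Fin.sum_univ_three, pencil, binaryForm, C_two]
      linear_combination coef t ^ 2 * x₀ * x₁ * h4
    · have h4 : const 2⁻¹ * 2 = 1 := C_inv_two_mul_two
      rw [hq]
      simp [Matrix.det_fin_three, pencil, binaryForm, C_two]
      clear h ha hb hc h2 hi
      grind
  · rw [quad_eq ha, quad_eq hb, quad_eq hc, quartic]
    clear ha hb hc
    simp [C_two]
    grind
  · intro l
    rw [quad_eq ha, quad_eq hb, quad_eq hc]
    clear ha hb hc
    refine ⟨3, ?_⟩
    fin_cases l
    · refine mem_span_triple (.C 2⁻¹ ^ 2 * .X 1) (.X 0) (.C 2⁻¹ * .X 1) ?_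
      simp [C_two]
      grind
    · refine mem_span_triple (.C 2⁻¹ ^ 2 * .X 0) (.X 1) (.C 2⁻¹ * .X 0) ?_
      simp [C_two]
      grind
    · refine mem_span_triple (-(.C 2⁻¹ ^ 2 * .C m⁻¹ * .X 2)) 0 (.C 2⁻¹ * .C m⁻¹ * .X 2) ?_
      simp [C_two]
      grind
  · refine pow_mem_span_pencil (0, 1) (2, 2) (-1 / 2) (-1 / (4 * m)) (-1) (1 / (2 * m)) ?_ ?_ <;>
    · simp only [pencil, Matrix.of_apply, const_mul_binaryForm, binaryForm_add]
      congr 1 <;> simp <;> field_simp <;> norm_num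

end Cases

end FermatDelPezzo

end

theorem proposition5 (m : ℚ) (hm : m ≠ 0) :
    HasConicBundle (-4 * m ^ 4)
      (x ^ 2 + 2 * MvPolynomial.C m * x * z + 2 * MvPolynomial.C m ^ 2 * z ^ 2)
      (w - y ^ 2)
      (coef (s ^ 2 - t ^ 2) * x₀ ^ 2 - coef (2 * s * t) * x₁ ^ 2
        - coef (2 * const m * (s ^ 2 + t ^ 2)) * x₀ * x₂
        + coef (2 * const m ^ 2 * (s ^ 2 - t ^ 2)) * x₂ ^ 2)
      (-2 * const m ^ 2 * s * t * (s ^ 2 - 2 * s * t - t ^ 2) * (s ^ 2 + 2 * s * t - t ^ 2)) ∧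
    HasConicBundle (m ^ 2)
      (x ^ 2 - MvPolynomial.C m * z ^ 2)
      (w - y ^ 2)
      (coef (s ^ 2 - t ^ 2) * x₀ ^ 2 - coef (2 * s * t) * x₁ ^ 2
        + coef (const m * (s ^ 2 + t ^ 2)) * x₂ ^ 2)
      (-2 * const m * s * t * (s - t) * (s + t) * (s ^ 2 + t ^ 2)) ∧
    HasConicBundle (2 * m ^ 2)
      (x * y - MvPolynomial.C m * z ^ 2)
      (x ^ 2 - y ^ 2 - w)
      (coef (2 * s * t) * x₀ ^ 2 + coef (2 * s ^ 2 - t ^ 2) * x₀ * x₁ - coef (2 * s * t) * x₁ ^ 2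
        + coef (const m * (2 * s ^ 2 + t ^ 2)) * x₂ ^ 2)
      (const (-m / 4) * (2 * s ^ 2 + t ^ 2)
        * (4 * s ^ 4 + 12 * s ^ 2 * t ^ 2 + t ^ 4)) ∧
    HasConicBundle (-2 * m ^ 2)
      (x * y - MvPolynomial.C m * z ^ 2)
      (x ^ 2 + y ^ 2 - w)
      (coef (2 * s * t) * x₀ ^ 2 - coef (2 * s ^ 2 + t ^ 2) * x₀ * x₁ + coef (2 * s * t) * x₁ ^ 2
        - coef (const m * (2 * s ^ 2 - t ^ 2)) * x₂ ^ 2)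
      (const (m / 4) * (2 * s ^ 2 - t ^ 2)
        * (2 * s ^ 2 - 4 * s * t + t ^ 2) * (2 * s ^ 2 + 4 * s * t + t ^ 2)) :=
  ⟨hasConicBundle_neg_four_mul_pow_four hm, hasConicBundle_sq hm, hasConicBundle_two_mul_sq hm,
    hasConicBundle_neg_two_mul_sq hm⟩
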